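/- **Setting.** Let $F\neq\mathbb{Q}$ be a totally real number field, $E/F$ a totally imaginary quadratic extension, and $V$ a 3-dimensional $E$-vector space with a nondegenerate Hermitian form $\langle\,,\rangle$ (linear in the first variable, conjugate-linear in the second). Let $\mathbf G=\mathrm U(V)$, with center $\mathbf Z$, and write $G_v=\mathbf G(F_v)$. Fix an archimedean place $v_0$ of $F$ such that $V$ is definite at every other archimedean place, and fix a complex embedding of $E$ above $v_0$ and a basis of $V\otimes_E\mathbb C=\mathbb C^3$ in which the form is $z_1\overline{w_3}+z_2\overline{w_2}+z_3\overline{w_1}$. Thus $G_0:=G_{v_0}=\mathrm U(2,1)=\{g\in\mathrm{GL}_3(\mathbb C): g^*Jg=J\}$, where $J$ is the matrix with ones on the antidiagonal. Let $K_0=\{g\in G_0:g^*g=1\}$, $A=\{\mathrm{diag}(e^{t/2},1,e^{-t/2}):t\in\mathbb R\}$, and let $M$ be the centralizer of $A$ in $K_0$. Let $d$ be the left-invariant Riemannian distance on $G_0$ given at the identity by the Euclidean norm of $M_3(\mathbb C)$ restricted to the Lie algebra. Let $L\subset V$ be an $\mathcal O_E$-lattice, $L_v=L\otimes_{\mathcal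 O_F}\mathcal O_v$. Let $S$ be a finite set of places of $F$ containing all archimedean and dyadic places, such that $L_v$ is self-dual for $v\notin S$. For finite $v\notin S$ let $K_v$ be the stabilizer of $L_v$ in $G_v$; for finite $v\in S$ let $K_v$ be any compact open subgroup of $G_v$ stabilizing $L_v$. Let $S_0\supset S$ be a finite set of places such that the rings of $S_0$-integers of $F$ and of $E$ are principal ideal domains. Let $\mathscr P$ be the set of finite places $v\notin S$ that split in $E$, and $\mathscr P_0=\mathscr P\setminus S_0$. For $v\in\mathscr P$ choose an ordering $w,w'$ of the places of $E$ above $v$, and identify $V_v=V_w\times V_{w'}$ with $F_v^3\times F_v^3$ so that $L_v$ becomes $\mathcal O_v^3\times\mathcal O_v^3$ and the pairing of $V_w$ with $V_{w'}$ becomes the standard one; the action on $V_w$ then identifies $G_v$ with $\mathrm{GL}_3(F_v)$ and $K_v$ with $\mathrm{GL}_3(\mathcal O_v)$. For nonzero ideals $\mathfrak n_1,\mathfrak n_2,\mathfrak n_3\subset\mathcal O_F$ divisible only by primes in $\mathscr P$ put $$K(\mathfrak n_1,\mathfrak n_2,\mathfrak n_3)=\prod_{v\in\mathscr P}K_v\,\mathrm{diag}\bigl(\varpi_v^{\mathrm{ord}_v\mathfrak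 n_1},\varpi_v^{\mathrm{ord}_v\mathfrak n_2},\varpi_v^{\mathrm{ord}_v\mathfrak n_3}\bigr)K_v\times\prod_{v<\infty,\,v\notin\mathscr P}K_v .$$ For $g\in G_0$ and $\kappa>0$ let $\overline{\mathcal M}(g,\mathfrak n_1,\mathfrak n_2,\mathfrak n_3,\kappa)$ be the set of $\gamma\in\mathbf Z(F)\backslash\mathbf G(F)$ whose image in $\mathbf G(\mathbb A_f)/\mathbf Z(\mathbb A_f)$ lies in the image of $K(\mathfrak n_1,\mathfrak n_2,\mathfrak n_3)$ and which satisfy $d(g^{-1}\gamma g,e)\le 1$ and $d(g^{-1}\gamma g,MA)\le\kappa$. Here the first distance is taken in $G_0$ modulo its center $Z_0$, that is, it is $d(g^{-1}xg,Z_0)$ for any representative $x\in\mathbf G(F)$ of $\gamma$; the second is $d(g^{-1}xg,MA)$, which does not depend on $x$ either. **Proposition.** Let $\Omega\subset G_0$ be compact. There is a constant $0<C=C(\Omega,L)<1$ (for fixed $F,E,V$ and fixed coordinates at $v_0$) such that the following holds whenever $g\in\Omega$, the nonzero ideals $\mathfrak n_1,\mathfrak n_2,\mathfrak n_3\subset\mathcal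 O_F$ are divisible only by primes in $\mathscr P_0$, $n=\mathrm N(\mathfrak n_1\mathfrak n_2\mathfrak n_3)$, and $0<\kappa\le Cn^{-1}$. 1. For every $\epsilon>0$, the set $\overline{\mathcal M}(g,\mathfrak n_1,\mathfrak n_2,\mathfrak n_3,\kappa)$ is finite and has $\ll_{\Omega,\epsilon}n^{\epsilon}$ elements. The implied constant may depend also on $L$, but not on $g,\mathfrak n_i,\kappa,S,S_0,(K_v)_v$ or the identifications at the places in $\mathscr P$. 2. There is a (commutative) cubic étale $E$-algebra $H\subset\mathrm{End}_E(V)$ that contains every $x\in\mathbf G(F)$ whose class lies in $\overline{\mathcal M}(g,\mathfrak n_1,\mathfrak n_2,\mathfrak n_3,\kappa)$; in particular all these $x$ commute. -/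

import Mathlib

open scoped NumberField TensorProduct ENNReal Matrix Topology
open IsDedekindDomain NumberField

noncomputable section

namespace HeckeReturn

/-! ### The real group `U(2,1)`, its subgroups and its left-invariant metric -/

/-- The Hermitian matrix `J` with ones on the antidiagonal. -/
def J : Matrix (Fin 3) (Fin 3) ℂ := !![0, 0, 1; 0, 1, 0; 1, 0, 0]

/-- The group `U(2,1) = {g ∈ GL(3,ℂ) : g* J g = J}`. -/
def G₀ : Subgroup (GL (Fin 3) ℂ) where
  carrier := {g | (g : Matrix (Fin 3) (Fin 3) ℂ)ᴴ * J * (g : Matrix (Fin 3) (Fin 3) ℂ) = J}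
  one_mem' := by simp
  mul_mem' := by
    intro a b ha hb
    simp only [Set.mem_ofPred_eq, Units.val_mul, Matrix.conjTranspose_mul] at *
    calc _ = (b : Matrix (Fin 3) (Fin 3) ℂ)ᴴ * ((a : Matrix (Fin 3) (Fin 3) ℂ)ᴴ * J *
          (a : Matrix (Fin 3) (Fin 3) ℂ)) * (b : Matrix (Fin 3) (Fin 3) ℂ) := by
          simp only [Matrix.mul_assoc]
      _ = J := by rw [ha, hb]
  inv_mem' := by
    intro a ha
    simp only [Set.mem_ofPred_eq] at *
    have h1 : (a : Matrix (Fin 3) (Fin 3) ℂ) * ((a⁻¹ : GL (Fin 3) ℂ) : Matrix _ _ ℂ) = 1 :=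
      Units.mul_inv a
    have h2 : ((a⁻¹ : GL (Fin 3) ℂ) : Matrix (Fin 3) (Fin 3) ℂ)ᴴ *
        (a : Matrix (Fin 3) (Fin 3) ℂ)ᴴ = 1 := by
      rw [← Matrix.conjTranspose_mul, h1, Matrix.conjTranspose_one]
    calc _ = ((a⁻¹ : GL (Fin 3) ℂ) : Matrix (Fin 3) (Fin 3) ℂ)ᴴ *
          ((a : Matrix (Fin 3) (Fin 3) ℂ)ᴴ * J * (a : Matrix (Fin 3) (Fin 3) ℂ)) *
          ((a⁻¹ : GL (Fin 3) ℂ) : Matrix (Fin 3) (Fin 3) ℂ) := by rw [ha]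
      _ = (((a⁻¹ : GL (Fin 3) ℂ) : Matrix (Fin 3) (Fin 3) ℂ)ᴴ *
          (a : Matrix (Fin 3) (Fin 3) ℂ)ᴴ) * J * ((a : Matrix (Fin 3) (Fin 3) ℂ) *
          ((a⁻¹ : GL (Fin 3) ℂ) : Matrix (Fin 3) (Fin 3) ℂ)) := by
          simp only [Matrix.mul_assoc]
      _ = J := by rw [h1, h2]; simp

/-- The underlying matrix of an element of `U(2,1)`. -/
def toMat (g : G₀) : Matrix (Fin 3) (Fin 3) ℂ := ((g : GL (Fin 3) ℂ) : Matrix (Fin 3) (Fin 3) ℂ)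

/-- The standard Euclidean norm on `M₃(ℂ) = ℂ⁹`. -/
def euclNorm (X : Matrix (Fin 3) (Fin 3) ℂ) : ℝ := Real.sqrt (∑ i, ∑ j, ‖X i j‖ ^ 2)

/-- The entrywise derivative on `[0,1]` (one-sided at the end points) of a path of matrices. -/
def velocity (c : ℝ → Matrix (Fin 3) (Fin 3) ℂ) (t : ℝ) : Matrix (Fin 3) (Fin 3) ℂ :=
  Matrix.of fun i j => derivWithin (fun s => c s i j) (Set.Icc 0 1) t

/-- `c` restricted to `[0,1]` is a `C¹` path from `x` to `y` inside `U(2,1)`. -/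
structure IsPath (c : ℝ → Matrix (Fin 3) (Fin 3) ℂ) (x y : G₀) : Prop where
  contDiff : ∀ i j, ContDiffOn ℝ 1 (fun t => c t i j) (Set.Icc 0 1)
  mem : ∀ t ∈ Set.Icc (0 : ℝ) 1, ∃ g : G₀, c t = toMat g
  source : c 0 = toMat x
  target : c 1 = toMat y

/-- The length of a path for the left-invariant Riemannian metric whose value at the identity is
the restriction of the Euclidean norm to the Lie algebra. -/
def pathLength (c : ℝ → Matrix (Fin 3) (Fin 3) ℂ) : ℝ≥0∞ :=
  ∫⁻ t in Set.Icc (0 : ℝ) 1, ENNReal.ofReal (euclNorm ((c t)⁻¹ * velocity c t))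

/-- The left-invariant Riemannian distance on `U(2,1)`. -/
def dist₀ (x y : G₀) : ℝ≥0∞ :=
  ⨅ (c : ℝ → Matrix (Fin 3) (Fin 3) ℂ) (_ : IsPath c x y), pathLength c

/-- The distance from a point to a subset of `U(2,1)`. -/
def distTo (x : G₀) (T : Set G₀) : ℝ≥0∞ := ⨅ y ∈ T, dist₀ x y

/-- The matrix `a(t) = diag(e^{t/2}, 1, e^{-t/2})`. -/
def aMat (t : ℝ) : Matrix (Fin 3) (Fin 3) ℂ :=
  Matrix.diagonal ![(Real.exp (t / 2) : ℂ), 1, (Real.exp (-t / 2) : ℂ)]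

/-- The subgroup `A = {a(t)}`, as a set. -/
def A : Set G₀ := {g | ∃ t : ℝ, toMat g = aMat t}

/-- The maximal compact subgroup `K₀ = {g ∈ U(2,1) : g* g = 1}`, as a set. -/
def K₀ : Set G₀ := {g | (toMat g)ᴴ * toMat g = 1}

/-- The centralizer `M` of `A` in `K₀`, as a set. -/
def M : Set G₀ := {m | m ∈ K₀ ∧ ∀ a ∈ A, m * a = a * m}

/-- The set `MA`. -/
def MA : Set G₀ := {g | ∃ m ∈ M, ∃ a ∈ A, g = m * a}

/-- The center of `U(2,1)`: the unitary scalars. -/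
def Z₀ : Set G₀ := {g | ∃ z : ℂ, toMat g = z • (1 : Matrix (Fin 3) (Fin 3) ℂ)}

/-! ### Hermitian spaces over `E/F` -/

section Global

variable (F E V : Type*) [Field F] [NumberField F] [Field E] [NumberField E] [Algebra F E]
  [AddCommGroup V] [Module E V] [Module F V] [IsScalarTower F E V]

/-- A nondegenerate Hermitian form on `V` relative to `E/F`, together with a complex embedding
`φ₀` of `E`, such that `V` becomes isometric to `(ℂ³, J)` at the archimedean place `v₀` of `F`
under `φ₀`, in a chosen basis, and is definite at every other archimedean place of `F`. -/
structure HermitianDatum where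
  /-- the nontrivial automorphism of `E/F` -/
  conj : E →ₐ[F] E
  conj_ne : conj ≠ AlgHom.id F E
  /-- the form, linear in the first and conjugate-linear in the second variable -/
  form : V →ₗ[E] V →ₛₗ[(conj : E →+* E)] E
  hermitian : ∀ x y, conj (form x y) = form y x
  nondegenerate : ∀ x, (∀ y, form x y = 0) → x = 0
  /-- the complex embedding giving the place `w₀` of `E` -/
  φ₀ : E →+* ℂ
  /-- the coordinates on `V ⊗ ℂ = ℂ³` at `w₀` -/
  coord : V →ₛₗ[φ₀] (Fin 3 → ℂ)
  coord_form : ∀ x y, φ₀ (form x y) = ∑ i, ∑ j, coord x i * J i j * star (coord y j)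
  definite : ∀ φ : E →+* ℂ,
    (InfinitePlace.mk φ).comap (algebraMap F E) ≠ (InfinitePlace.mk φ₀).comap (algebraMap F E) →
    ∃ (s : ℝ) (Q : V →ₛₗ[φ] (Fin 3 → ℂ)), (s = 1 ∨ s = -1) ∧
      ∀ x y, φ (form x y) = s * ∑ i, Q x i * star (Q y i)

variable {F E V}

/-- `H` is a commutative cubic étale algebra over `E`. -/
def IsCubicEtale (H : Subalgebra E (Module.End E V)) : Prop :=
  Module.finrank E H = 3 ∧ ∃ hc : ∀ a b : H, a * b = b * a,
    letI : CommRing H := { (inferInstance : Ring H) with mul_comm := hc }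
    Algebra.Etale E H

namespace HermitianDatum

variable (D : HermitianDatum F E V)

/-- The group `G(F)` of isometries of `V`. -/
def G : Subgroup (V ≃ₗ[E] V) where
  carrier := {g | ∀ x y, D.form (g x) (g y) = D.form x y}
  one_mem' := fun _ _ => rfl
  mul_mem' := by
    intro a b ha hb x y
    exact (ha _ _).trans (hb _ _)
  inv_mem' := by
    intro a ha x y
    have h := ha (a⁻¹ x) (a⁻¹ y)
    have e : ∀ z, a (a⁻¹ z) = z := fun z => a.apply_symm_apply z
    rw [e, e] at h
    exact h.symm

/-- The group `Z(F)` of scalars in `G(F)`. -/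
def Z : Subgroup D.G where
  carrier := {g | ∃ z : E, ∀ x, (g : V ≃ₗ[E] V) x = z • x}
  one_mem' := ⟨1, fun x => by simp⟩
  mul_mem' := by
    rintro a b ⟨z, hz⟩ ⟨w, hw⟩
    refine ⟨z * w, fun x => ?_⟩
    change (a : V ≃ₗ[E] V) ((b : V ≃ₗ[E] V) x) = _
    rw [hw, hz, mul_smul]
  inv_mem' := by
    rintro a ⟨z, hz⟩
    refine ⟨z⁻¹, fun x => ?_⟩
    change (a : V ≃ₗ[E] V).symm x = _
    rw [LinearEquiv.symm_apply_eq]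
    by_cases h : z = 0
    · subst h
      have h0 : ∀ y : V, y = 0 := fun y => by
        have := hz y
        rw [zero_smul] at this
        exact (LinearEquiv.map_eq_zero_iff _).1 this
      rw [h0 x, smul_zero, map_zero]
    · rw [hz, smul_smul, mul_inv_cancel₀ h, one_smul]

/-- `g ∈ U(2,1)` is the image `x_{v₀}` of `x ∈ G(F)` in the chosen coordinates at `v₀`. -/
def IsImage₀ (x : D.G) (g : G₀) : Prop :=
  ∀ y, D.coord ((x : V ≃ₗ[E] V) y) = toMat g *ᵥ D.coord y

/-! ### Local objects at a finite place `v` -/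

/-- The Hermitian form as an `F`-bilinear map. -/
def formF : V →ₗ[F] V →ₗ[F] E :=
  LinearMap.mk₂ F (fun x y => D.form x y) (by simp) (by
      intro c x y
      rw [← algebraMap_smul E c x, map_smul, LinearMap.smul_apply, algebraMap_smul]) (by simp) (by
      intro c x y
      rw [← algebraMap_smul E c y, LinearMap.map_smulₛₗ]
      simp [Algebra.smul_def])

variable (v : HeightOneSpectrum (𝓞 F))

/-- The Hermitian form on `V_v = F_v ⊗ V` with values in `E_v = F_v ⊗ E`. -/
def localForm : v.adicCompletion F ⊗[F] V →ₗ[v.adicCompletion F]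
    v.adicCompletion F ⊗[F] V →ₗ[v.adicCompletion F] v.adicCompletion F ⊗[F] E :=
  LinearMap.BilinMap.baseChange (v.adicCompletion F) D.formF

end HermitianDatum

variable (v : HeightOneSpectrum (𝓞 F))

/-- The action of `e ∈ E` on `V_v`. -/
def localScalar (e : E) : Module.End (v.adicCompletion F) (v.adicCompletion F ⊗[F] V) :=
  (Algebra.lsmul F F V e).baseChange (v.adicCompletion F)

/-- The `𝒪_v`-submodule of `F_v ⊗ W` generated by `1 ⊗ T`. For `T` an `𝒪_E`-lattice this is
`T ⊗ 𝒪_v`. -/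
def localLattice {W : Type*} [AddCommGroup W] [Module F W] (T : Set W) :
    Submodule (v.adicCompletionIntegers F) (v.adicCompletion F ⊗[F] W) :=
  Submodule.span (v.adicCompletionIntegers F) ((fun x => (1 : v.adicCompletion F) ⊗ₜ[F] x) '' T)

/-- `v` splits in `E`, that is, `E_v = F_v × F_v`. -/
def IsSplitPlace (E : Type*) [Field E] [Algebra F E] : Prop :=
  Nonempty ((v.adicCompletion F ⊗[F] E) ≃ₐ[v.adicCompletion F]
    (v.adicCompletion F × v.adicCompletion F))

namespace HermitianDatum

variable (D : HermitianDatum F E V)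

/-- The group `G_v` of `E_v`-linear isometries of `V_v`. -/
def localG : Subgroup ((v.adicCompletion F ⊗[F] V) ≃ₗ[v.adicCompletion F]
    (v.adicCompletion F ⊗[F] V)) where
  carrier := {g | (∀ (e : E) x, g (localScalar v e x) = localScalar v e (g x)) ∧
    ∀ x y, D.localForm v (g x) (g y) = D.localForm v x y}
  one_mem' := ⟨fun _ _ => rfl, fun _ _ => rfl⟩
  mul_mem' := by
    rintro a b ⟨ha, ha'⟩ ⟨hb, hb'⟩
    refine ⟨fun e x => ?_, fun x y => (ha' _ _).trans (hb' _ _)⟩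
    change a (b _) = localScalar v e (a (b x))
    rw [hb, ha]
  inv_mem' := by
    rintro a ⟨ha, ha'⟩
    have e : ∀ z, a (a⁻¹ z) = z := fun z => a.apply_symm_apply z
    refine ⟨fun c x => a.injective ?_, fun x y => ?_⟩
    · rw [ha, e, e]
    · have h := ha' (a⁻¹ x) (a⁻¹ y)
      rw [e, e] at h
      exact h.symm

/-- The center `Z(F_v)` of `G_v`: the elements that act through a scalar in `E_v = F_v ⊗ E`, that
is, through an `F_v`-linear combination of scalars in `E`. -/
def localZ : Set ((v.adicCompletion F ⊗[F] V) ≃ₗ[v.adicCompletion F]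
    (v.adicCompletion F ⊗[F] V)) :=
  {z | z ∈ D.localG v ∧ (z : Module.End (v.adicCompletion F) (v.adicCompletion F ⊗[F] V)) ∈
    Submodule.span (v.adicCompletion F) (Set.range fun e : E => localScalar (V := V) v e)}

/-- The image `x_v` in `Aut(V_v)` of `x ∈ G(F)`. -/
def toLocal (x : D.G) : (v.adicCompletion F ⊗[F] V) ≃ₗ[v.adicCompletion F]
    (v.adicCompletion F ⊗[F] V) :=
  LinearEquiv.baseChange F (v.adicCompletion F) V V ((x : V ≃ₗ[E] V).restrictScalars F)

variable [Module (𝓞 E) V] (L : Submodule (𝓞 E) V)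

/-- The stabilizer in `G_v` of `L_v`. -/
def latticeStab : Set ((v.adicCompletion F ⊗[F] V) ≃ₗ[v.adicCompletion F]
    (v.adicCompletion F ⊗[F] V)) :=
  {g | g ∈ D.localG v ∧
    (g : v.adicCompletion F ⊗[F] V → v.adicCompletion F ⊗[F] V) '' (localLattice v (L : Set V)) =
      localLattice v (L : Set V)}

/-- `L_v` is self-dual: it equals `{x ∈ V_v : ⟨x, L_v⟩ ⊆ 𝒪_{E,v}}`. -/
def IsSelfDual : Prop :=
  ∀ x, x ∈ localLattice v (L : Set V) ↔ ∀ y ∈ localLattice v (L : Set V),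
    D.localForm v x y ∈ localLattice v (Set.range (algebraMap (𝓞 E) E))

/-- An identification `ι_v` of `V_v = V_w × V_{w'}` with `F_v³ × F_v³` at a split place `v`, where
`w` and `w'` correspond to the `F`-embedding `ψ : E → F_v` and to its conjugate. It is
`E_v`-linear, it carries the Hermitian form to
`((v₁,v₁'),(v₂,v₂')) ↦ (v₁ ⬝ v₂', v₂ ⬝ v₁') ∈ F_v × F_v = E_v`, and `L_v` to `𝒪_v³ × 𝒪_v³`. -/
structure SplitFrame where
  ψ : E →ₐ[F] v.adicCompletion F
  ι : (v.adicCompletion F ⊗[F] V) ≃ₗ[v.adicCompletion F]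
    ((Fin 3 → v.adicCompletion F) × (Fin 3 → v.adicCompletion F))
  linear : ∀ (e : E) x, ι (localScalar v e x) = (ψ e • (ι x).1, ψ (D.conj e) • (ι x).2)
  form_fst : ∀ x y, Algebra.TensorProduct.lift (Algebra.ofId (v.adicCompletion F)
      (v.adicCompletion F)) ψ (fun _ _ => Commute.all _ _) (D.localForm v x y) =
    (ι x).1 ⬝ᵥ (ι y).2
  form_snd : ∀ x y, Algebra.TensorProduct.lift (Algebra.ofId (v.adicCompletion F)
      (v.adicCompletion F)) (ψ.comp D.conj) (fun _ _ => Commute.all _ _) (D.localForm v x y) =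
    (ι y).1 ⬝ᵥ (ι x).2
  lattice : ∀ x, x ∈ localLattice v (L : Set V) ↔
    (∀ i, (ι x).1 i ∈ v.adicCompletionIntegers F) ∧ ∀ i, (ι x).2 i ∈ v.adicCompletionIntegers F

variable {D v L} in
/-- The double coset `K_v(a₁,a₂,a₃) = GL(3,𝒪_v) diag(ϖ^{a₁},ϖ^{a₂},ϖ^{a₃}) GL(3,𝒪_v)`, with `G_v`
identified with `GL(3,F_v)` through its action on `V_w`. -/
def SplitFrame.doubleCoset (f : D.SplitFrame v L) (a : Fin 3 → ℕ) :
    Set ((v.adicCompletion F ⊗[F] V) ≃ₗ[v.adicCompletion F] (v.adicCompletion F ⊗[F] V)) :=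
  {g | g ∈ D.localG v ∧ ∃ (ϖ : v.adicCompletionIntegers F)
    (k k' : GL (Fin 3) (v.adicCompletionIntegers F)), Irreducible ϖ ∧ ∀ x, (f.ι (g x)).1 =
      (((k : Matrix (Fin 3) (Fin 3) (v.adicCompletionIntegers F)) *
        Matrix.diagonal (fun i => ϖ ^ a i) *
        (k' : Matrix (Fin 3) (Fin 3) (v.adicCompletionIntegers F))).map
          (algebraMap (v.adicCompletionIntegers F) (v.adicCompletion F))) *ᵥ (f.ι x).1}

/-- The finite part of the level structure: the finite places in `S`, the groups `K_v`, the
identifications `ι_v` at the split places outside `S`, and the larger set `S₀`. Both `S` and `S₀`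
also contain all archimedean places, which are left implicit. -/
structure Level where
  S : Finset (HeightOneSpectrum (𝓞 F))
  dyadic : ∀ v : HeightOneSpectrum (𝓞 F), (2 : 𝓞 F) ∈ v.asIdeal → v ∈ S
  selfDual : ∀ v : HeightOneSpectrum (𝓞 F), v ∉ S → D.IsSelfDual v L
  K : ∀ v : HeightOneSpectrum (𝓞 F), Subgroup ((v.adicCompletion F ⊗[F] V)
    ≃ₗ[v.adicCompletion F] (v.adicCompletion F ⊗[F] V))
  K_good : ∀ v, v ∉ S → (K v : Set _) = D.latticeStab v L
  K_stab : ∀ v ∈ S, (K v : Set _) ⊆ D.latticeStab v L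
  /-- `K_v` is compact; `End(V_v)` carries its topology as a finite-dimensional space. -/
  K_compact : ∀ v ∈ S, @IsCompact _ (moduleTopology (v.adicCompletion F)
      (Module.End (v.adicCompletion F) (v.adicCompletion F ⊗[F] V)))
    ((fun g : (v.adicCompletion F ⊗[F] V) ≃ₗ[v.adicCompletion F]
        (v.adicCompletion F ⊗[F] V) =>
      (g : Module.End (v.adicCompletion F) (v.adicCompletion F ⊗[F] V))) ''
      (K v : Set ((v.adicCompletion F ⊗[F] V) ≃ₗ[v.adicCompletion F]
        (v.adicCompletion F ⊗[F] V))))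
  /-- `K_v` is open in `G_v`. -/
  K_open : ∀ v ∈ S, ∃ U : Set (Module.End (v.adicCompletion F) (v.adicCompletion F ⊗[F] V)),
    IsOpen[moduleTopology (v.adicCompletion F)
      (Module.End (v.adicCompletion F) (v.adicCompletion F ⊗[F] V))] U ∧
    ∀ g, g ∈ K v ↔ g ∈ D.localG v ∧
      (g : Module.End (v.adicCompletion F) (v.adicCompletion F ⊗[F] V)) ∈ U
  frame : ∀ v, v ∉ S → IsSplitPlace v E → D.SplitFrame v L
  S₀ : Finset (HeightOneSpectrum (𝓞 F))
  S_subset : S ⊆ S₀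
  pidF : IsPrincipalIdealRing (Set.integer (S₀ : Set (HeightOneSpectrum (𝓞 F))) F)
  pidE : IsPrincipalIdealRing (Set.integer {w : HeightOneSpectrum (𝓞 E) |
    ∃ v ∈ S₀, w.asIdeal.comap (algebraMap (𝓞 F) (𝓞 E)) = v.asIdeal} E)

namespace Level

variable {D L} (𝓛 : D.Level L)

/-- The nonzero ideal `𝔫` is divisible only by primes in `𝒫₀`, the set of finite places outside
`S₀` that split in `E`. -/
def IsSupported (𝔫 : Ideal (𝓞 F)) : Prop :=
  𝔫 ≠ ⊥ ∧ ∀ v : HeightOneSpectrum (𝓞 F), v.asIdeal ∣ 𝔫 → v ∉ 𝓛.S₀ ∧ IsSplitPlace v E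

/-- The image of `x ∈ G(F)` in `G(𝔸_f)/Z(𝔸_f)` lies in the image of `K(𝔫₁,𝔫₂,𝔫₃)`: at each finite
place, `x_v` lies in the local component of `K(𝔫₁,𝔫₂,𝔫₃)` up to `Z(F_v)`. (The local scalars
automatically form a finite adele, because `x_v ∈ K_v` for almost all `v`.) -/
def MemHecke (𝔫 : Fin 3 → Ideal (𝓞 F)) (x : D.G) : Prop :=
  (∀ v (hS : v ∉ 𝓛.S) (hv : IsSplitPlace v E), ∃ ζ ∈ D.localZ v,
    ζ * D.toLocal v x ∈
      (𝓛.frame v hS hv).doubleCoset (fun i => multiplicity v.asIdeal (𝔫 i))) ∧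
  ∀ v, ¬ (v ∉ 𝓛.S ∧ IsSplitPlace v E) → ∃ ζ ∈ D.localZ v, ζ * D.toLocal v x ∈ 𝓛.K v

/-- The conditions on a representative `x ∈ G(F)` of a Hecke return. They only depend on the class
of `x` modulo `Z(F)`; in particular the distance of `g⁻¹ x g` to the identity is measured in
`U(2,1)` modulo its center. -/
def IsReturn (g : G₀) (𝔫 : Fin 3 → Ideal (𝓞 F)) (κ : ℝ) (x : D.G) : Prop :=
  𝓛.MemHecke 𝔫 x ∧ ∃ x₀ : G₀, D.IsImage₀ x x₀ ∧
    distTo (g⁻¹ * x₀ * g) Z₀ ≤ 1 ∧ distTo (g⁻¹ * x₀ * g) MA ≤ ENNReal.ofReal κ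

/-- The set of Hecke returns in `Z(F)\G(F)`. -/
def returns (g : G₀) (𝔫 : Fin 3 → Ideal (𝓞 F)) (κ : ℝ) : Set (D.G ⧸ D.Z) :=
  {γ | ∃ x : D.G, (x : D.G ⧸ D.Z) = γ ∧ 𝓛.IsReturn g 𝔫 κ x}

end Level

end HermitianDatum

end Global

end HeckeReturn

end

set_option linter.unusedSectionVars false

/-! Fix an `E`-basis of `V` and write isometries as matrices. A Hecke return is controlled at the
finite places only up to local central factors, so its single entries have no bounded denominators.
Products of an entry of `x` with a conjugated entry of `x`, or with an entry of `x⁻¹`, do: a central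
factor cancels in them, and at a split place one factor is integral while the other becomes integral
after multiplication by elements of `I = 𝔫₁𝔫₂𝔫₃`. Hence a constant times `I` clears their
denominators (`exists_nat_isIntegral_mat`). At the archimedean places all entries are bounded: away
from `v₀` the form is definite, and at `v₀` the return is near the center after conjugation by an
element of a compact set (`exists_norm_map_mat_le`).

Commutation is a product formula argument (`exists_forall_isReturn_commute`). After conjugation by
`g`, returns are diagonal up to `O(κ)`, so an entry `t` of the commutator of two returns is `O(κ)`
at `v₀`. Up to a constant, `I²` clears the denominators of `N_{E/F}(t)`, so if `t ≠ 0` the absolute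
norm of `N_{E/F}(t)` is `≫ n⁻²`, whereas the archimedean bounds make it `≪ κ²`. This is impossible
when `κn` is small.

Since `F ≠ ℚ`, the form is definite at some archimedean place, hence anisotropic. The algebra
generated by commuting returns and their inverses is commutative and stable under adjoints, and
anisotropy excludes nilpotents (`exists_isCommReduced`). A maximal commutative reduced algebra `H`
containing it has dimension `dim V` (`IsCommReduced.exists_le_finrank_eq`), and it is étale because
`E` is perfect.

For the count, let `χ, χ'` be complex characters of `H`. The ratio `χ(x)χ'(x⁻¹)` and its inverse are
bounded at all archimedean places and have denominators dividing a multiple `m` of `n`. There are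
`O(m^ε)` such numbers `r` in a number field: the ideal `(mr)` divides `(m²)`, and numbers with the
same ideal differ by units of bounded size (`exists_card_le_rpow`). All ratios together determine
`x` up to a scalar (`exists_card_isBoundedPair_le`). Since `H` and the value field vary with the
data, every bound is made uniform over fields of bounded degree. -/

namespace HeckeReturn

/-! ### The Euclidean norm on matrices -/

section EuclNorm

open scoped Matrix.Norms.Frobenius in
theorem euclNorm_eq_frobenius (X : Matrix (Fin 3) (Fin 3) ℂ) : euclNorm X = ‖X‖ := by
  rw [euclNorm, Matrix.frobenius_norm_def, Real.sqrt_eq_rpow]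
  simp

theorem euclNorm_nonneg (X : Matrix (Fin 3) (Fin 3) ℂ) : 0 ≤ euclNorm X := Real.sqrt_nonneg _

theorem euclNorm_mul_le (X Y : Matrix (Fin 3) (Fin 3) ℂ) :
    euclNorm (X * Y) ≤ euclNorm X * euclNorm Y := by
  simp only [euclNorm_eq_frobenius]
  exact Matrix.frobenius_norm_mul X Y

open scoped Matrix.Norms.Frobenius in
theorem euclNorm_add_le (X Y : Matrix (Fin 3) (Fin 3) ℂ) :
    euclNorm (X + Y) ≤ euclNorm X + euclNorm Y := by
  simp only [euclNorm_eq_frobenius]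
  exact norm_add_le X Y

open scoped Matrix.Norms.Frobenius in
theorem euclNorm_neg (X : Matrix (Fin 3) (Fin 3) ℂ) : euclNorm (-X) = euclNorm X := by
  simp only [euclNorm_eq_frobenius]
  exact norm_neg X

theorem euclNorm_sub_le (X Y : Matrix (Fin 3) (Fin 3) ℂ) :
    euclNorm (X - Y) ≤ euclNorm X + euclNorm Y := by
  rw [sub_eq_add_neg, ← euclNorm_neg Y]
  exact euclNorm_add_le X (-Y)

theorem euclNorm_conjTranspose (X : Matrix (Fin 3) (Fin 3) ℂ) : euclNorm Xᴴ = euclNorm X := by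
  rw [euclNorm, euclNorm, Finset.sum_comm]
  simp [Matrix.conjTranspose_apply]

theorem euclNorm_sq (X : Matrix (Fin 3) (Fin 3) ℂ) : euclNorm X ^ 2 = ∑ i, ∑ j, ‖X i j‖ ^ 2 :=
  Real.sq_sqrt (by positivity)

theorem norm_apply_le_euclNorm (X : Matrix (Fin 3) (Fin 3) ℂ) (i j : Fin 3) :
    ‖X i j‖ ≤ euclNorm X := by
  refine Real.le_sqrt_of_sq_le ?_
  calc ‖X i j‖ ^ 2 ≤ ∑ j, ‖X i j‖ ^ 2 :=
        Finset.single_le_sum (f := fun j => ‖X i j‖ ^ 2) (fun _ _ => by positivity)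
          (Finset.mem_univ j)
    _ ≤ _ := Finset.single_le_sum (f := fun i => ∑ j, ‖X i j‖ ^ 2) (fun _ _ => by positivity)
          (Finset.mem_univ i)

theorem euclNorm_le_of_norm_apply_le {X : Matrix (Fin 3) (Fin 3) ℂ} {B : ℝ}
    (h : ∀ i j, ‖X i j‖ ≤ B) : euclNorm X ≤ 3 * B := by
  have hB : 0 ≤ B := (norm_nonneg _).trans (h 0 0)
  refine Real.sqrt_le_iff.2 ⟨by positivity, ?_⟩
  calc ∑ i, ∑ j, ‖X i j‖ ^ 2 ≤ ∑ _i : Fin 3, ∑ _j : Fin 3, B ^ 2 := by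
        gcongr with i _ j _
        exact h i j
    _ = (3 * B) ^ 2 := by simp; ring

/-- Cauchy–Schwarz over the nine entries. The left side is the derivative of the squared norm at `X`
in the direction `Y`. -/
theorem abs_sum_inner_le (X Y : Matrix (Fin 3) (Fin 3) ℂ) :
    |∑ i, ∑ j, 2 * inner ℝ (X i j) (Y i j)| ≤ 2 * (euclNorm X * euclNorm Y) := by
  simp only [← Finset.mul_sum, abs_mul, abs_two]
  refine mul_le_mul_of_nonneg_left ?_ zero_le_two
  simp only [euclNorm, ← Finset.sum_product']
  calc |∑ p ∈ Finset.univ ×ˢ Finset.univ, inner ℝ (X p.1 p.2) (Y p.1 p.2)|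
      ≤ ∑ p ∈ Finset.univ ×ˢ Finset.univ, ‖X p.1 p.2‖ * ‖Y p.1 p.2‖ :=
        (Finset.abs_sum_le_sum_abs _ _).trans
          (Finset.sum_le_sum fun p _ => abs_real_inner_le_norm _ _)
    _ ≤ _ := Real.sum_mul_le_sqrt_mul_sqrt _ _ _

end EuclNorm

/-! ### Lengths of paths -/

theorem J_mul_J : J * J = 1 := by
  ext i j
  fin_cases i <;> fin_cases j <;> simp [J, Matrix.mul_apply, Fin.sum_univ_three]

theorem J_conjTranspose : Jᴴ = J := by
  ext i j
  fin_cases i <;> fin_cases j <;> simp [J, Matrix.conjTranspose_apply]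

/-- In this form the inverse is polynomial in the entries and their conjugates, which gives
continuity of the speed of a path and a norm bound for inverses. -/
theorem toMat_inv (g : G₀) : (toMat g)⁻¹ = J * (toMat g)ᴴ * J := by
  refine Matrix.inv_eq_left_inv ?_
  have h : (toMat g)ᴴ * J * toMat g = J := g.2
  rw [Matrix.mul_assoc, Matrix.mul_assoc, ← Matrix.mul_assoc _ J, h, J_mul_J]

theorem toMat_mul (g h : G₀) : toMat (g * h) = toMat g * toMat h := rfl

theorem toMat_inv' (g : G₀) : toMat g⁻¹ = (toMat g)⁻¹ := by
  refine (Matrix.inv_eq_left_inv ?_).symm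
  rw [← toMat_mul, inv_mul_cancel]
  rfl

theorem toMat_inv_eq (g : G₀) : toMat g⁻¹ = J * (toMat g)ᴴ * J := by rw [toMat_inv', toMat_inv]

theorem toMat_mul_inv (g : G₀) : toMat g * (toMat g)⁻¹ = 1 := by
  rw [← toMat_inv', ← toMat_mul, mul_inv_cancel]
  rfl

theorem euclNorm_toMat_pos (g : G₀) : 0 < euclNorm (toMat g) := by
  refine lt_of_le_of_ne (euclNorm_nonneg _) fun h => ?_
  have h0 : toMat g = 0 := by
    ext i j
    exact norm_le_zero_iff.1 ((norm_apply_le_euclNorm _ i j).trans h.ge)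
  have h1 := toMat_mul_inv g
  rw [h0, zero_mul] at h1
  exact zero_ne_one h1

/-! ### Growth of matrices along paths -/

section Path

variable {c : ℝ → Matrix (Fin 3) (Fin 3) ℂ} {x y : G₀}

theorem IsPath.hasDerivWithinAt (hc : IsPath c x y) (i j : Fin 3) {t : ℝ}
    (ht : t ∈ Set.Icc (0 : ℝ) 1) :
    HasDerivWithinAt (fun s => c s i j) (velocity c t i j) (Set.Icc 0 1) t :=
  ((hc.contDiff i j).differentiableOn one_ne_zero t ht).hasDerivWithinAt

theorem IsPath.continuousOn_inv_mul_velocity (hc : IsPath c x y) :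
    ContinuousOn (fun t => (c t)⁻¹ * velocity c t) (Set.Icc 0 1) := by
  have h1 : ContinuousOn c (Set.Icc 0 1) :=
    continuousOn_pi.2 fun i => continuousOn_pi.2 fun j => (hc.contDiff i j).continuousOn
  have h2 : ContinuousOn (velocity c) (Set.Icc 0 1) :=
    continuousOn_pi.2 fun i => continuousOn_pi.2 fun j =>
      (hc.contDiff i j).continuousOn_derivWithin (uniqueDiffOn_Icc zero_lt_one) le_rfl
  have h3 : ContinuousOn (fun t => J * (c t)ᴴ * J * velocity c t) (Set.Icc 0 1) := by
    have h4 : ContinuousOn (fun t => (c t)ᴴ) (Set.Icc 0 1) :=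
      continuous_id.matrix_conjTranspose.comp_continuousOn h1
    exact ((continuousOn_const.mul h4).mul continuousOn_const).mul h2
  refine h3.congr fun t ht => ?_
  obtain ⟨g, hg⟩ := hc.mem t ht
  simp only [hg, toMat_inv]

theorem continuous_euclNorm : Continuous euclNorm := by
  unfold euclNorm
  fun_prop

/-- The speed of a path, extended to a continuous function on the line. -/
noncomputable def speed (c : ℝ → Matrix (Fin 3) (Fin 3) ℂ) : ℝ → ℝ :=
  Set.IccExtend (zero_le_one' ℝ) fun t => euclNorm ((c t)⁻¹ * velocity c t)

theorem IsPath.continuous_speed (hc : IsPath c x y) : Continuous (speed c) := by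
  refine Continuous.Icc_extend' ?_
  exact continuousOn_iff_continuous_domRestrict.1
    (continuous_euclNorm.comp_continuousOn hc.continuousOn_inv_mul_velocity)

theorem speed_of_mem {t : ℝ} (ht : t ∈ Set.Icc (0 : ℝ) 1) :
    speed c t = euclNorm ((c t)⁻¹ * velocity c t) :=
  Set.IccExtend_of_mem _ _ ht

theorem speed_nonneg (t : ℝ) : 0 ≤ speed c t := euclNorm_nonneg _

theorem IsPath.integral_speed_le (hc : IsPath c x y) {l : ℝ} (hl : 0 ≤ l)
    (h : pathLength c ≤ ENNReal.ofReal l) {t : ℝ} (ht : t ∈ Set.Icc (0 : ℝ) 1) :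
    ∫ s in (0 : ℝ)..t, speed c s ≤ l := by
  have hi : ∀ a b, IntervalIntegrable (speed c) MeasureTheory.volume a b :=
    fun a b => hc.continuous_speed.intervalIntegrable a b
  have h1 : ∫ s in (0 : ℝ)..t, speed c s ≤ ∫ s in (0 : ℝ)..1, speed c s :=
    intervalIntegral.integral_mono_interval le_rfl ht.1 ht.2
      (Filter.Eventually.of_forall speed_nonneg) (hi 0 1)
  refine h1.trans ?_
  rw [intervalIntegral.integral_of_le zero_le_one, ← MeasureTheory.integral_Icc_eq_integral_Ioc,
    ← ENNReal.ofReal_le_ofReal_iff hl, MeasureTheory.ofReal_integral_eq_lintegral_ofReal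
      (hc.continuous_speed.continuousOn.integrableOn_compact isCompact_Icc)
      (Filter.Eventually.of_forall speed_nonneg)]
  refine le_trans (le_of_eq ?_) h
  exact MeasureTheory.setLIntegral_congr_fun measurableSet_Icc fun t ht => by
    simp only [speed_of_mem ht]

/-- A function on `[0,1]` whose derivative is bounded by a multiple of the speed of a path. -/
theorem IsPath.norm_sub_le {W : Type*} [NormedAddCommGroup W] [NormedSpace ℝ W]
    (hc : IsPath c x y) {f f' : ℝ → W} {k : ℝ}
    (hf : ∀ t ∈ Set.Icc (0 : ℝ) 1, HasDerivWithinAt f (f' t) (Set.Icc 0 1) t)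
    (hf' : ∀ t ∈ Set.Icc (0 : ℝ) 1, ‖f' t‖ ≤ k * speed c t) {t : ℝ}
    (ht : t ∈ Set.Icc (0 : ℝ) 1) :
    ‖f t - f 0‖ ≤ k * ∫ s in (0 : ℝ)..t, speed c s := by
  have hB : ∀ t, HasDerivAt (fun t => k * ∫ s in (0 : ℝ)..t, speed c s) (k * speed c t) t :=
    fun t => (hc.continuous_speed.integral_hasStrictDerivAt 0 t).hasDerivAt.const_mul k
  refine image_norm_le_of_norm_deriv_right_le_deriv_boundary (f := fun t => f t - f 0) (f' := f')
    (a := 0) (b := 1) ?_ ?_ (by simp) hB (fun t ht => hf' t ⟨ht.1, ht.2.le⟩) ht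
  · exact ContinuousOn.sub (fun t ht => (hf t ht).continuousWithinAt) continuousOn_const
  · intro t ht
    exact ((hf t ⟨ht.1, ht.2.le⟩).mono_of_mem_nhdsWithin
      (Icc_mem_nhdsGE_of_mem ht)).sub_const (f 0)

/-- The metric is left-invariant, so the Euclidean velocity exceeds the speed by at most the norm of
the current point. -/
theorem IsPath.euclNorm_velocity_le (hc : IsPath c x y) {t : ℝ} (ht : t ∈ Set.Icc (0 : ℝ) 1) :
    euclNorm (velocity c t) ≤ euclNorm (c t) * speed c t := by
  rw [speed_of_mem ht]
  obtain ⟨g, hg⟩ := hc.mem t ht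
  calc euclNorm (velocity c t) = euclNorm (c t * ((c t)⁻¹ * velocity c t)) := by
        rw [← Matrix.mul_assoc, hg, toMat_mul_inv, one_mul]
    _ ≤ _ := euclNorm_mul_le _ _

/-- A Gronwall estimate: the logarithmic derivative of the squared norm is at most twice the speed.
-/
theorem IsPath.abs_log_sub_le (hc : IsPath c x y) {t : ℝ} (ht : t ∈ Set.Icc (0 : ℝ) 1) :
    |Real.log (euclNorm (c t) ^ 2) - Real.log (euclNorm (c 0) ^ 2)| ≤
      2 * ∫ s in (0 : ℝ)..t, speed c s := by
  have hpos : ∀ t ∈ Set.Icc (0 : ℝ) 1, 0 < euclNorm (c t) := fun t ht => by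
    obtain ⟨g, hg⟩ := hc.mem t ht
    rw [hg]
    exact euclNorm_toMat_pos g
  refine hc.norm_sub_le (f := fun t => Real.log (euclNorm (c t) ^ 2))
    (f' := fun t => (∑ i, ∑ j, 2 * inner ℝ (c t i j) (velocity c t i j)) / euclNorm (c t) ^ 2)
    (fun t ht => ?_) (fun t ht => ?_) ht
  · have h1 : HasDerivWithinAt (fun t => euclNorm (c t) ^ 2)
        (∑ i, ∑ j, 2 * inner ℝ (c t i j) (velocity c t i j)) (Set.Icc 0 1) t := by
      simp only [euclNorm_sq]
      exact HasDerivWithinAt.fun_sum fun i _ => HasDerivWithinAt.fun_sum fun j _ =>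
        (hc.hasDerivWithinAt i j ht).norm_sq
    exact h1.log (pow_pos (hpos t ht) 2).ne'
  · have h0 := hpos t ht
    rw [Real.norm_eq_abs, abs_div, abs_of_pos (pow_pos h0 2), div_le_iff₀ (pow_pos h0 2)]
    refine (abs_sum_inner_le _ _).trans ?_
    nlinarith [hc.euclNorm_velocity_le ht]

/-- Both directions are needed: paths start at the group element, whereas the norm is known a priori
at the end point in the center. -/
theorem IsPath.euclNorm_le (hc : IsPath c x y) {l : ℝ} (hl : 0 ≤ l)
    (h : pathLength c ≤ ENNReal.ofReal l) {t : ℝ} (ht : t ∈ Set.Icc (0 : ℝ) 1) :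
    euclNorm (c t) ≤ Real.exp l * euclNorm (toMat x) ∧
      euclNorm (toMat x) ≤ Real.exp l * euclNorm (c t) := by
  have h1 := hc.abs_log_sub_le ht
  have h2 := hc.integral_speed_le hl h ht
  obtain ⟨g, hg⟩ := hc.mem t ht
  have hx := euclNorm_toMat_pos x
  have hy := euclNorm_toMat_pos g
  rw [hc.source, hg, Real.log_pow, Real.log_pow, abs_le] at h1
  push_cast at h1
  rw [hg]
  constructor
  · rw [← Real.log_le_log_iff hy (by positivity), Real.log_mul (Real.exp_pos l).ne' hx.ne',
      Real.log_exp]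
    linarith [h1.2]
  · rw [← Real.log_le_log_iff hx (by positivity), Real.log_mul (Real.exp_pos l).ne' hy.ne',
      Real.log_exp]
    linarith [h1.1]

theorem IsPath.norm_apply_sub_le (hc : IsPath c x y) {l : ℝ} (hl : 0 ≤ l)
    (h : pathLength c ≤ ENNReal.ofReal l) (i j : Fin 3) :
    ‖toMat y i j - toMat x i j‖ ≤ Real.exp l * euclNorm (toMat x) * l := by
  have h1 := hc.norm_sub_le (f := fun t => c t i j) (f' := fun t => velocity c t i j)
    (k := Real.exp l * euclNorm (toMat x)) (fun t ht => hc.hasDerivWithinAt i j ht)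
    (fun t ht => ((norm_apply_le_euclNorm _ i j).trans (hc.euclNorm_velocity_le ht)).trans
      (mul_le_mul_of_nonneg_right (hc.euclNorm_le hl h ht).1 (speed_nonneg t)))
    (Set.right_mem_Icc.2 zero_le_one)
  simp only [hc.source, hc.target] at h1
  refine h1.trans (mul_le_mul_of_nonneg_left
    (hc.integral_speed_le hl h (Set.right_mem_Icc.2 zero_le_one)) ?_)
  exact mul_nonneg (Real.exp_pos l).le (euclNorm_nonneg _)

end Path

theorem exists_path_of_distTo_lt {x : G₀} {T : Set G₀} {r : ℝ≥0∞} (h : distTo x T < r) :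
    ∃ y ∈ T, ∃ c, IsPath c x y ∧ pathLength c < r := by
  simp only [distTo, dist₀, iInf_lt_iff] at h
  obtain ⟨y, hy, c, hc, hl⟩ := h
  exact ⟨y, hy, c, hc, hl⟩

/-! ### Elements close to the center, and to `MA` -/

theorem euclNorm_of_mem_Z₀ {z : G₀} (hz : z ∈ Z₀) : euclNorm (toMat z) ≤ 3 := by
  obtain ⟨w, hw⟩ := hz
  have h : (toMat z)ᴴ * J * toMat z = J := z.2
  have h1 : ‖w‖ ≤ 1 := by
    -- The middle entry of `g* J g = J` says that the scalar has absolute value 1.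
    have h2 := congrFun (congrFun h 1) 1
    simp [hw, J, Matrix.mul_apply, Fin.sum_univ_three] at h2
    have h3 := congrArg norm h2
    simp only [norm_mul, norm_one, RCLike.norm_conj] at h3
    nlinarith [norm_nonneg w]
  have := euclNorm_le_of_norm_apply_le (X := toMat z) (B := 1) fun i j => by
    rw [hw]
    by_cases hij : i = j <;> simp [hij, h1]
  linarith

theorem euclNorm_le_of_distTo_Z₀ {h : G₀} (hh : distTo h Z₀ ≤ 1) :
    euclNorm (toMat h) ≤ Real.exp 2 * 3 := by
  -- The infimum need not be attained, so the length bound 1 is relaxed to 2.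
  obtain ⟨z, hz, c, hc, hl⟩ := exists_path_of_distTo_lt
    (hh.trans_lt (show (1 : ℝ≥0∞) < ENNReal.ofReal 2 by simp))
  have := (hc.euclNorm_le zero_le_two hl.le (Set.right_mem_Icc.2 zero_le_one)).2
  rw [hc.target] at this
  exact this.trans (mul_le_mul_of_nonneg_left (euclNorm_of_mem_Z₀ hz) (Real.exp_pos _).le)

/-- Every element of `MA` is diagonal. -/
theorem isDiag_of_mem_MA {g : G₀} (hg : g ∈ MA) : ∃ d : Fin 3 → ℂ, toMat g = Matrix.diagonal d := by
  obtain ⟨m, hm, a, ⟨t, ha⟩, rfl⟩ := hg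
  -- One element of `A` suffices: the diagonal entries of `a(1)` are distinct, so whatever commutes
  -- with it is diagonal.
  have hmem : aMat 1 ∈ Set.range toMat := by
    have h0 : aMat 1 * aMat (-1) = 1 := by
      simp only [aMat, Matrix.diagonal_mul_diagonal, ← Matrix.diagonal_one]
      congr 1
      ext i
      fin_cases i <;> simp [← Complex.exp_add] <;> norm_num
    have h1 : aMat (-1) * aMat 1 = 1 := by
      simp only [aMat, Matrix.diagonal_mul_diagonal, ← Matrix.diagonal_one]
      congr 1
      ext i
      fin_cases i <;> simp [← Complex.exp_add] <;> norm_num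
    refine ⟨⟨⟨aMat 1, aMat (-1), h0, h1⟩, ?_⟩, rfl⟩
    change (aMat 1)ᴴ * J * aMat 1 = J
    ext i j
    fin_cases i <;> fin_cases j <;>
      simp [aMat, J, Matrix.diagonal_conjTranspose, Matrix.mul_diagonal, Matrix.diagonal_mul,
        -Complex.ofReal_exp, ← Complex.ofReal_mul, ← Real.exp_add] <;>
      norm_num [← Real.exp_add]
  obtain ⟨a₁, ha₁⟩ := hmem
  have hcomm : toMat m * aMat 1 = aMat 1 * toMat m := by
    rw [← ha₁, ← toMat_mul, ← toMat_mul, hm.2 a₁ ⟨1, ha₁⟩]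
  have hdiag : ∀ i j, i ≠ j → toMat m i j = 0 := by
    intro i j hij
    have h1 := congrFun (congrFun hcomm i) j
    rw [aMat, Matrix.mul_diagonal, Matrix.diagonal_mul, mul_comm, ← sub_eq_zero, ← sub_mul] at h1
    refine (mul_eq_zero.1 h1).resolve_left fun h2 => ?_
    have hlt : Real.exp (-1 / 2) < 1 := Real.exp_lt_one_iff.2 (by norm_num)
    have hgt : 1 < Real.exp (1 / 2) := Real.one_lt_exp_iff.2 (by norm_num)
    rw [sub_eq_zero] at h2
    have h3 : (![Real.exp (1 / 2), 1, Real.exp (-1 / 2)] : Fin 3 → ℝ) j =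
        (![Real.exp (1 / 2), 1, Real.exp (-1 / 2)] : Fin 3 → ℝ) i := by
      have h4 : ∀ k, (![(Real.exp (1 / 2) : ℂ), 1, (Real.exp (-1 / 2) : ℂ)] : Fin 3 → ℂ) k =
          ((![Real.exp (1 / 2), 1, Real.exp (-1 / 2)] : Fin 3 → ℝ) k : ℂ) := by
        intro k
        fin_cases k <;> simp
      rw [h4, h4] at h2
      exact Complex.ofReal_injective h2
    generalize Real.exp (1 / 2) = p at h3 hgt
    generalize Real.exp (-1 / 2) = q at h3 hlt
    fin_cases i <;> fin_cases j <;> simp at hij h3 <;> linarith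
  refine ⟨fun i => toMat m i i * (![(Real.exp (t / 2) : ℂ), 1, (Real.exp (-t / 2) : ℂ)]) i, ?_⟩
  rw [toMat_mul, ha]
  ext i j
  rw [aMat, Matrix.mul_diagonal]
  by_cases hij : i = j
  · subst hij
    rw [Matrix.diagonal_apply_eq]
  · rw [Matrix.diagonal_apply_ne _ hij, hdiag i j hij, zero_mul]

theorem exists_near_MA {h : G₀} (hh : distTo h Z₀ ≤ 1) {κ : ℝ} (hκ : 0 < κ) (hκ1 : κ ≤ 1)
    (hM : distTo h MA ≤ ENNReal.ofReal κ) :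
    ∃ d : Fin 3 → ℂ, euclNorm (toMat h - Matrix.diagonal d) ≤ 18 * Real.exp 4 * κ := by
  obtain ⟨m, hm, c, hc, hl⟩ := exists_path_of_distTo_lt
    (hM.trans_lt (show ENNReal.ofReal κ < ENNReal.ofReal (2 * κ) from
      (ENNReal.ofReal_lt_ofReal_iff (by linarith)).2 (by linarith)))
  obtain ⟨d, hd⟩ := isDiag_of_mem_MA hm
  refine ⟨d, ?_⟩
  rw [← hd]
  -- Uses `κ ≤ 1` and the bound `3e²` for elements near the center. Passing from entries to the norm
  -- later costs a further factor 3.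
  have h1 : Real.exp (2 * κ) * euclNorm (toMat h) * (2 * κ) ≤ 6 * Real.exp 4 * κ := by
    calc Real.exp (2 * κ) * euclNorm (toMat h) * (2 * κ)
        ≤ Real.exp 2 * (Real.exp 2 * 3) * (2 * κ) := by
          gcongr
          · exact euclNorm_nonneg _
          · linarith
          · exact euclNorm_le_of_distTo_Z₀ hh
      _ = 6 * (Real.exp 2 * Real.exp 2) * κ := by ring
      _ = 6 * Real.exp 4 * κ := by rw [← Real.exp_add]; norm_num
  have h2 := euclNorm_le_of_norm_apply_le (X := toMat h - toMat m) (B := 6 * Real.exp 4 * κ)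
    fun i j => by
      rw [Matrix.sub_apply, norm_sub_rev]
      exact (hc.norm_apply_sub_le (by linarith) hl.le i j).trans h1
  linarith

/-- Elements near the center and close to `MA` almost commute. -/
theorem exists_euclNorm_commutator_le : ∃ B : ℝ, ∀ (κ : ℝ) (h k : G₀), 0 < κ → κ ≤ 1 →
    distTo h Z₀ ≤ 1 → distTo k Z₀ ≤ 1 → distTo h MA ≤ ENNReal.ofReal κ →
    distTo k MA ≤ ENNReal.ofReal κ →
    euclNorm (toMat h * toMat k - toMat k * toMat h) ≤ B * κ := by
  set b := Real.exp 2 * 3 with hb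
  set e := 18 * Real.exp 4 with he
  have hb0 : 0 ≤ b := by positivity
  have he0 : 0 ≤ e := by positivity
  refine ⟨2 * (e * b + (b + e) * e), fun κ h k hκ hκ1 hh hk hhM hkM => ?_⟩
  obtain ⟨d, hd⟩ := exists_near_MA hh hκ hκ1 hhM
  obtain ⟨d', hd'⟩ := exists_near_MA hk hκ hκ1 hkM
  have hbh := euclNorm_le_of_distTo_Z₀ hh
  have hbk := euclNorm_le_of_distTo_Z₀ hk
  rw [← hb] at hbh hbk
  rw [← he] at hd hd'
  set X := toMat h
  set Y := toMat k
  set P := Matrix.diagonal d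
  set Q := Matrix.diagonal d'
  have hPQ : P * Q = Q * P := by
    simp only [P, Q, Matrix.diagonal_mul_diagonal, mul_comm]
  have hs : ∀ {U W : Matrix (Fin 3) (Fin 3) ℂ}, euclNorm U ≤ b → euclNorm (U - W) ≤ e * κ →
      euclNorm W ≤ b + e := fun {U W} h1 h2 => by
    have h3 := euclNorm_sub_le U (U - W)
    rw [sub_sub_cancel] at h3
    nlinarith
  have hP := hs hbh hd
  have hQ := hs hbk hd'
  -- The diagonal parts commute, so every remaining term contains a difference of size `O(κ)`.
  have key : X * Y - Y * X = ((X - P) * Y + P * (Y - Q)) - ((Y - Q) * X + Q * (X - P)) := by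
    simp only [sub_mul, mul_sub, hPQ]
    abel
  have h1 : ∀ {U W U' W' : Matrix (Fin 3) (Fin 3) ℂ}, euclNorm U ≤ e * κ → euclNorm W ≤ b →
      euclNorm U' ≤ b + e → euclNorm W' ≤ e * κ →
      euclNorm (U * W + U' * W') ≤ (e * b + (b + e) * e) * κ := fun {U W U' W'} h1 h2 h3 h4 => by
    calc euclNorm (U * W + U' * W') ≤ euclNorm U * euclNorm W + euclNorm U' * euclNorm W' :=
          (euclNorm_add_le _ _).trans (add_le_add (euclNorm_mul_le _ _) (euclNorm_mul_le _ _))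
      _ ≤ (e * κ) * b + (b + e) * (e * κ) := by
          gcongr
          all_goals exact euclNorm_nonneg _
      _ = _ := by ring
  rw [key]
  refine (euclNorm_sub_le _ _).trans ?_
  linarith [h1 hd hbk hP hd', h1 hd' hbh hQ hd]

/-! ### Commutative reduced algebras of endomorphisms -/

/-- In a reduced Artinian ring every element `a` is divisible by `a ^ 2`. -/
theorem exists_eq_mul_self_mul {A : Type*} [CommRing A] [IsArtinianRing A] [IsReduced A] (a : A) :
    ∃ b, a = a * a * b := by
  -- Stabilization of the chain of ideals `(aⁿ)` gives `aⁿ = aⁿ⁺¹y`, which makes `a(1 - ay)`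
  -- nilpotent.
  obtain ⟨n, y, hy⟩ := IsArtinian.exists_pow_succ_smul_dvd a (1 : A)
  simp only [smul_eq_mul, mul_one] at hy
  refine ⟨y, ?_⟩
  have h : (a * (1 - a * y)) ^ (n + 1) = 0 := by
    have h1 : a ^ n * (1 - a * y) = 0 := by
      rw [mul_sub, ← mul_assoc, ← pow_succ, hy]
      ring
    rw [mul_pow, pow_succ, pow_succ (1 - a * y)]
    calc _ = (a ^ n * (1 - a * y)) * (a * (1 - a * y) ^ n) := by ring
      _ = 0 := by rw [h1, zero_mul]
  have h2 := IsReduced.eq_zero _ ⟨_, h⟩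
  linear_combination h2

/-- A faithful semisimple module over a commutative algebra `H` whose idempotent endomorphisms all
come from `H` has the dimension of `H`. -/
theorem finrank_eq_of_forall_isIdempotentElem {E H V : Type*} [Field E] [CommRing H] [Algebra E H]
    [AddCommGroup V] [Module E V] [Module H V] [IsScalarTower E H V] [FiniteDimensional E V]
    [IsSemisimpleModule H V] (hf : ∀ h : H, (∀ x : V, h • x = 0) → h = 0)
    (hp : ∀ p : V →ₗ[H] V, (∀ x, p (p x) = p x) → ∃ h : H, ∀ x, p x = h • x) :
    Module.finrank E H = Module.finrank E V := by
  let d : V → ℕ := fun v => Module.finrank E ((Submodule.span H {v}).restrictScalars E)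
  -- A vector `v` with cyclic submodule `Hv` of largest dimension generates `V`: for `w ≠ 0` in a
  -- complement, the projection onto `Hv` lies in `H`, so `H(v + w)` contains both `v` and `w` and
  -- is larger.
  obtain ⟨v, hv⟩ : ∃ v, ∀ w, d w ≤ d v := by
    have hb : BddAbove (Set.range d) := ⟨Module.finrank E V, by
      rintro _ ⟨w, rfl⟩
      exact Submodule.finrank_le _⟩
    obtain ⟨v, hv⟩ := Nat.sSup_mem (Set.range_nonempty d) hb
    exact ⟨v, fun w => hv.ge.trans' (le_csSup hb ⟨w, rfl⟩)⟩
  have htop : Submodule.span H {v} = ⊤ := by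
    by_contra hne
    obtain ⟨U, hU⟩ := exists_isCompl (Submodule.span H {v})
    have hU0 : U ≠ ⊥ := fun h => hne (by simpa [h] using hU.sup_eq_top)
    obtain ⟨w, hwU, hw0⟩ := Submodule.exists_mem_ne_zero_of_ne_bot hU0
    obtain ⟨h, hh⟩ := hp ((Submodule.span H {v}).projection U hU) fun x =>
      Submodule.projection_apply_of_mem_left hU (Submodule.projection_apply_mem hU x)
    have hvw : v = h • (v + w) := by
      rw [← hh, map_add, Submodule.projection_apply_of_mem_left hU
        (Submodule.mem_span_singleton_self v),
        Submodule.projection_apply_of_mem_right hU hwU, add_zero]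
    have hv' : v ∈ Submodule.span H {v + w} := Submodule.mem_span_singleton.2 ⟨h, hvw.symm⟩
    have hw' : w ∈ Submodule.span H {v + w} := by
      have := Submodule.sub_mem _ (Submodule.mem_span_singleton_self (R := H) (v + w)) hv'
      rwa [add_sub_cancel_left] at this
    have hlt : Submodule.span H {v} < Submodule.span H {v + w} := by
      refine lt_of_le_of_ne ((Submodule.span_singleton_le_iff_mem _ _).2 hv') fun heq => hw0 ?_
      rw [← heq] at hw'
      exact Submodule.disjoint_def.1 hU.disjoint w hw' hwU
    have hlt' : (Submodule.span H {v}).restrictScalars E <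
        (Submodule.span H {v + w}).restrictScalars E := hlt
    exact (hv (v + w)).not_gt (Submodule.finrank_lt_finrank_of_lt hlt')
  -- By commutativity an element that kills the generator `v` kills all of `V`, so faithfulness
  -- gives injectivity.
  have hbij : Function.Bijective (LinearMap.toSpanSingleton H V v) := by
    constructor
    · rw [← LinearMap.ker_eq_bot, LinearMap.ker_eq_bot']
      intro h hh
      rw [LinearMap.toSpanSingleton_apply] at hh
      refine hf h fun x => ?_
      obtain ⟨a, rfl⟩ := Submodule.mem_span_singleton.1 (htop ▸ Submodule.mem_top : x ∈ _)
      rw [smul_comm, hh, smul_zero]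
    · intro x
      obtain ⟨a, rfl⟩ := Submodule.mem_span_singleton.1 (htop ▸ Submodule.mem_top : x ∈ _)
      exact ⟨a, rfl⟩
  exact ((LinearEquiv.ofBijective _ hbij).restrictScalars E).finrank_eq

/-- A finite commutative reduced algebra over a perfect field is étale. -/
theorem etale_of_isReduced (E H : Type*) [Field E] [PerfectField E] [CommRing H] [Algebra E H]
    [FiniteDimensional E H] [IsReduced H] : Algebra.Etale E H := by
  have : IsArtinianRing H := IsArtinianRing.of_finite E H
  rw [Algebra.Etale.iff_exists_algEquiv_prod]
  refine ⟨MaximalSpectrum H, inferInstance, fun I => H ⧸ I.asIdeal,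
    fun I => Ideal.Quotient.field _, fun I => inferInstance, ?_, fun I => ?_⟩
  · exact AlgEquiv.ofRingEquiv (f := IsArtinianRing.equivPi H) fun r => rfl
  · let := Ideal.Quotient.field I.asIdeal
    have : FiniteDimensional E (H ⧸ I.asIdeal) :=
      inferInstance
    exact ⟨inferInstance, inferInstance⟩

/-! ### Enlarging commutative reduced subalgebras by idempotents -/

section Subalgebra

variable {E A : Type*} [Field E] [Ring A] [Algebra E A]

/-- A subalgebra is commutative and reduced. -/
def IsCommReduced (H : Subalgebra E A) : Prop :=
  (∀ a ∈ H, ∀ b ∈ H, a * b = b * a) ∧ ∀ a ∈ H, a * a = 0 → a = 0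

/-- The commutative ring structure on a commutative subalgebra. -/
abbrev IsCommReduced.commRing {H : Subalgebra E A} (h : IsCommReduced H) : CommRing H :=
  { (inferInstance : Ring H) with
    mul_comm := fun a b => Subtype.ext (h.1 a a.2 b b.2) }

theorem IsCommReduced.isReduced {H : Subalgebra E A} (h : IsCommReduced H) : IsReduced H := by
  refine (isReduced_iff_pow_one_lt 2 one_lt_two).2 fun a ha => Subtype.ext (h.2 a a.2 ?_)
  rw [← pow_two]
  exact congrArg Subtype.val ha

/-- The subalgebra `H(1 - p) + Hp` for an idempotent `p` commuting with `H`. -/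
def adjoinIdempotent (H : Subalgebra E A) (p : A) (hp : p * p = p) (hpH : ∀ a ∈ H, a * p = p * a) :
    Subalgebra E A where
  carrier := {z | ∃ a ∈ H, ∃ b ∈ H, z = a * (1 - p) + b * p}
  add_mem' := by
    rintro _ _ ⟨a, ha, b, hb, rfl⟩ ⟨a', ha', b', hb', rfl⟩
    exact ⟨a + a', add_mem ha ha', b + b', add_mem hb hb', by noncomm_ring⟩
  mul_mem' := by
    rintro _ _ ⟨a, ha, b, hb, rfl⟩ ⟨a', ha', b', hb', rfl⟩
    refine ⟨a * a', mul_mem ha ha', b * b', mul_mem hb hb', ?_⟩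
    have h1 : (1 - p) * a' = a' * (1 - p) := by rw [sub_mul, mul_sub, hpH a' ha']; simp
    have h2 : p * b' = b' * p := (hpH b' hb').symm
    have h3 : (1 - p) * b' = b' * (1 - p) := by rw [sub_mul, mul_sub, hpH b' hb']; simp
    have h4 : p * a' = a' * p := (hpH a' ha').symm
    have h5 : (1 - p) * (1 - p) = 1 - p := by simp [sub_mul, mul_sub, hp]
    have h6 : (1 - p) * p = 0 := by simp [sub_mul, hp]
    have h7 : p * (1 - p) = 0 := by simp [mul_sub, hp]
    calc (a * (1 - p) + b * p) * (a' * (1 - p) + b' * p)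
        = a * ((1 - p) * a') * (1 - p) + a * ((1 - p) * b') * p + b * (p * a') * (1 - p) +
          b * (p * b') * p := by noncomm_ring
      _ = a * a' * ((1 - p) * (1 - p)) + a * b' * ((1 - p) * p) + b * a' * (p * (1 - p)) +
          b * b' * (p * p) := by rw [h1, h2, h3, h4]; noncomm_ring
      _ = _ := by rw [h5, h6, h7, hp]; simp
  algebraMap_mem' r := ⟨_, algebraMap_mem H r, _, algebraMap_mem H r, by rw [← mul_add]; simp⟩

/-- Multiplication is componentwise in `a(1 - p) + bp`. If the square vanishes then `a²(1 - p) = 0`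
and `b²p = 0`; since `a` and `b` are multiples of their squares within `H`, both components vanish.
-/
theorem IsCommReduced.isCommReduced_adjoinIdempotent [FiniteDimensional E A] {H : Subalgebra E A}
    (h : IsCommReduced H) (p : A) (hp : p * p = p) (hpH : ∀ a ∈ H, a * p = p * a) :
    IsCommReduced (adjoinIdempotent H p hp hpH) := by
  have h6 : (1 - p) * p = 0 := by simp [sub_mul, hp]
  have h7 : p * (1 - p) = 0 := by simp [mul_sub, hp]
  have h5 : (1 - p) * (1 - p) = 1 - p := by simp [sub_mul, mul_sub, hp]
  have hq : ∀ a ∈ H, a * (1 - p) = (1 - p) * a := fun a ha => by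
    rw [sub_mul, mul_sub, hpH a ha]; simp
  have key : ∀ a ∈ H, ∀ b ∈ H, ∀ a' ∈ H, ∀ b' ∈ H,
      (a * (1 - p) + b * p) * (a' * (1 - p) + b' * p) = a * a' * (1 - p) + b * b' * p := by
    intro a ha b hb a' ha' b' hb'
    calc (a * (1 - p) + b * p) * (a' * (1 - p) + b' * p)
        = a * ((1 - p) * a') * (1 - p) + a * ((1 - p) * b') * p + b * (p * a') * (1 - p) +
          b * (p * b') * p := by noncomm_ring
      _ = a * a' * ((1 - p) * (1 - p)) + a * b' * ((1 - p) * p) + b * a' * (p * (1 - p)) +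
          b * b' * (p * p) := by
            rw [← hq a' ha', ← hq b' hb', ← hpH a' ha', ← hpH b' hb']; noncomm_ring
      _ = _ := by rw [h5, h6, h7, hp]; simp
  have hreg : ∀ a ∈ H, ∃ b ∈ H, a = b * (a * a) := fun a ha => by
    let := h.commRing
    have := h.isReduced
    have : IsArtinianRing H := IsArtinianRing.of_finite E H
    obtain ⟨b, hb⟩ := exists_eq_mul_self_mul (⟨a, ha⟩ : H)
    exact ⟨b, b.2, by
      rw [mul_comm] at hb
      exact congrArg Subtype.val hb⟩
  constructor
  · rintro _ ⟨a, ha, b, hb, rfl⟩ _ ⟨a', ha', b', hb', rfl⟩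
    rw [key a ha b hb a' ha' b' hb', key a' ha' b' hb' a ha b hb, h.1 a ha a' ha', h.1 b hb b' hb']
  · rintro _ ⟨a, ha, b, hb, rfl⟩ h0
    rw [key a ha b hb a ha b hb] at h0
    have h1 : a * a * (1 - p) = 0 := by
      have := congrArg (· * (1 - p)) h0
      simpa [add_mul, mul_assoc, h5, h7] using this
    have h2 : b * b * p = 0 := by rwa [h1, zero_add] at h0
    obtain ⟨a', -, ha2⟩ := hreg a ha
    obtain ⟨b', -, hb2⟩ := hreg b hb
    rw [ha2, hb2, mul_assoc, mul_assoc b', h1, h2]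
    simp

end Subalgebra

/-- A commutative reduced algebra of endomorphisms of `V` is contained in one of dimension
`dim V`. -/
theorem IsCommReduced.exists_le_finrank_eq {E V : Type*} [Field E] [AddCommGroup V] [Module E V]
    [FiniteDimensional E V] {R : Subalgebra E (Module.End E V)} (hR : IsCommReduced R) :
    ∃ H, R ≤ H ∧ IsCommReduced H ∧ Module.finrank E H = Module.finrank E V := by
  obtain ⟨H, ⟨hRH, hH⟩, hmax⟩ : ∃ H : Subalgebra E (Module.End E V), (R ≤ H ∧ IsCommReduced H) ∧
      ∀ H', R ≤ H' ∧ IsCommReduced H' → Module.finrank E H' ≤ Module.finrank E H := by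
    let s : Set ℕ := (fun H : Subalgebra E (Module.End E V) => Module.finrank E H) ''
      {H | R ≤ H ∧ IsCommReduced H}
    have hb : BddAbove s := ⟨Module.finrank E (Module.End E V), by
      rintro _ ⟨H, -, rfl⟩
      exact Submodule.finrank_le (Subalgebra.toSubmodule H)⟩
    obtain ⟨H, hH, heq⟩ := Nat.sSup_mem (s := s) ⟨_, R, ⟨le_rfl, hR⟩, rfl⟩ hb
    exact ⟨H, hH, fun H' hH' => heq.ge.trans' (le_csSup hb ⟨H', hH', rfl⟩)⟩
  refine ⟨H, hRH, hH, ?_⟩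
  -- Adjoining a commuting idempotent keeps the algebra commutative and reduced, so by maximality it
  -- was already there.
  have hidem : ∀ p : Module.End E V, p * p = p → (∀ a ∈ H, a * p = p * a) → p ∈ H := by
    intro p hp hpH
    have hle : H ≤ adjoinIdempotent H p hp hpH := fun a ha =>
      ⟨a, ha, a, ha, by rw [← mul_add]; simp⟩
    have heq := Submodule.eq_of_le_of_finrank_le (S₁ := Subalgebra.toSubmodule H)
      (S₂ := Subalgebra.toSubmodule (adjoinIdempotent H p hp hpH)) hle
      (hmax _ ⟨hRH.trans hle, hH.isCommReduced_adjoinIdempotent p hp hpH⟩)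
    change p ∈ Subalgebra.toSubmodule H
    rw [heq]
    exact ⟨0, zero_mem _, 1, one_mem _, by simp⟩
  let := hH.commRing
  have := hH.isReduced
  have : IsArtinianRing H := IsArtinianRing.of_finite E H
  have : IsSemisimpleRing H := IsArtinianRing.isSemisimpleRing_of_isReduced H
  have : IsScalarTower E H V := ⟨fun a h x => rfl⟩
  refine finrank_eq_of_forall_isIdempotentElem (E := E) (H := H) (V := V)
    (fun h hh => Subtype.ext (LinearMap.ext hh)) fun p hp => ?_
  refine ⟨⟨p.restrictScalars E, hidem _ (LinearMap.ext hp) fun a ha => LinearMap.ext fun x => ?_⟩,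
    fun x => rfl⟩
  exact (p.map_smul (⟨a, ha⟩ : H) x).symm

theorem isCubicEtale_of_isCommReduced {E V : Type*} [Field E] [NumberField E] [AddCommGroup V]
    [Module E V] [FiniteDimensional E V] {H : Subalgebra E (Module.End E V)}
    (hH : IsCommReduced H) (h3 : Module.finrank E H = 3) : IsCubicEtale H := by
  refine ⟨h3, fun a b => Subtype.ext (hH.1 a a.2 b b.2), ?_⟩
  let := hH.commRing
  have := hH.isReduced
  exact etale_of_isReduced E H

/-! ### Hermitian spaces -/

namespace HermitianDatum

section Basic

variable {F E V : Type*} [Field F] [NumberField F] [Field E] [NumberField E] [Algebra F E]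
  [AddCommGroup V] [Module E V] [Module F V] [IsScalarTower F E V] (D : HermitianDatum F E V)

theorem form_smul_right (e : E) (x y : V) : D.form x (e • y) = D.conj e * D.form x y := by
  rw [LinearMap.map_smulₛₗ]
  rfl

theorem form_smul_left (e : E) (x y : V) : D.form (e • x) y = e * D.form x y := by
  rw [map_smul, LinearMap.smul_apply, smul_eq_mul]

theorem exists_form_eq [Nontrivial V] (e : E) : ∃ x y, D.form x y = e := by
  obtain ⟨x, hx⟩ := exists_ne (0 : V)
  obtain ⟨y, hy⟩ : ∃ y, D.form x y ≠ 0 := by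
    by_contra! h
    exact hx (D.nondegenerate x h)
  exact ⟨(e * (D.form x y)⁻¹) • x, y, by rw [form_smul_left, mul_assoc, inv_mul_cancel₀ hy, mul_one]⟩

/-- Every element of `E` is a value of the form, so Hermitian symmetry, applied twice, proves this;
the next lemma uses the same device with the symmetry of `J`. -/
theorem conj_conj [Nontrivial V] (e : E) : D.conj (D.conj e) = e := by
  obtain ⟨x, y, rfl⟩ := D.exists_form_eq e
  rw [D.hermitian, D.hermitian]

theorem φ₀_conj [Nontrivial V] (e : E) : D.φ₀ (D.conj e) = star (D.φ₀ e) := by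
  obtain ⟨x, y, rfl⟩ := D.exists_form_eq e
  rw [D.hermitian, D.coord_form, D.coord_form, star_sum, Finset.sum_comm]
  refine Finset.sum_congr rfl fun i _ => ?_
  rw [star_sum]
  refine Finset.sum_congr rfl fun j _ => ?_
  have hJ : J j i = star (J i j) := by
    rw [← Matrix.conjTranspose_apply, J_conjTranspose]
  rw [hJ, star_mul', star_mul', star_star]
  ring

/-- A fixed element outside `F` would form an `F`-basis together with 1, and the conjugation would
be trivial. -/
theorem exists_algebraMap_eq [Algebra.IsQuadraticExtension F E] {z : E} (hz : D.conj z = z) :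
    ∃ f, algebraMap F E f = z := by
  by_contra! hne
  have hli : LinearIndependent F ![1, z] := by
    rw [LinearIndependent.pair_iff]
    intro a b hab
    have hb : b = 0 := by
      by_contra hb
      refine hne (-a / b) ?_
      rw [Algebra.smul_def, Algebra.smul_def, mul_one] at hab
      have hb' : algebraMap F E b ≠ 0 := (map_ne_zero _).2 hb
      rw [map_div₀, map_neg, div_eq_iff hb']
      linear_combination -hab
    subst hb
    rw [zero_smul, add_zero, Algebra.smul_def, mul_one, map_eq_zero] at hab
    exact ⟨hab, rfl⟩
  have hspan := hli.span_eq_top_of_card_eq_finrank' (by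
    rw [Algebra.IsQuadraticExtension.finrank_eq_two F E]; rfl)
  refine D.conj_ne (AlgHom.toLinearMap_injective (LinearMap.ext_on hspan ?_))
  rintro _ ⟨i, rfl⟩
  fin_cases i <;> simp [hz]

theorem exists_trace [Nontrivial V] [Algebra.IsQuadraticExtension F E] (e : E) :
    ∃ t, algebraMap F E t = e + D.conj e :=
  D.exists_algebraMap_eq (by rw [map_add, conj_conj, add_comm])

theorem exists_norm [Nontrivial V] [Algebra.IsQuadraticExtension F E] (e : E) :
    ∃ t, algebraMap F E t = e * D.conj e :=
  D.exists_algebraMap_eq (by rw [map_mul, conj_conj, mul_comm])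

/-- Every linear functional is given by the form. -/
theorem exists_form_right_eq [FiniteDimensional E V] [Nontrivial V] (l : Module.Dual E V) :
    ∃ y, ∀ x, D.form x y = l x := by
  let W : Submodule E (Module.Dual E V) :=
    { carrier := {l | ∃ y, ∀ x, D.form x y = l x}
      add_mem' := by
        rintro a b ⟨y, hy⟩ ⟨z, hz⟩
        exact ⟨y + z, fun x => by rw [map_add, hy, hz, LinearMap.add_apply]⟩
      zero_mem' := ⟨0, fun x => by simp⟩
      smul_mem' := by
        rintro c a ⟨y, hy⟩
        exact ⟨D.conj c • y, fun x => by
          rw [form_smul_right, conj_conj, hy, LinearMap.smul_apply, smul_eq_mul]⟩ }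
  have hW : W = ⊤ := by
    rw [← Subspace.dualCoannihilator_dualAnnihilator_eq (W := W)]
    have h0 : W.dualCoannihilator = ⊥ := by
      rw [eq_bot_iff]
      intro x hx
      rw [Submodule.mem_dualCoannihilator] at hx
      refine (Submodule.mem_bot E).2 (D.nondegenerate x fun y => ?_)
      let ly : Module.Dual E V :=
        { toFun := fun z => D.form z y
          map_add' := fun a b => by rw [map_add, LinearMap.add_apply]
          map_smul' := fun c a => D.form_smul_left c a y }
      exact hx ly ⟨y, fun x => rfl⟩
    rw [h0, Submodule.dualAnnihilator_bot]
  have hl : l ∈ W := hW ▸ Submodule.mem_top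
  exact hl

theorem coe_inv_apply (x : D.G) (y : V) : ((x⁻¹ : D.G) : V ≃ₗ[E] V) ((x : V ≃ₗ[E] V) y) = y :=
  (x : V ≃ₗ[E] V).symm_apply_apply y

theorem apply_coe_inv (x : D.G) (y : V) : (x : V ≃ₗ[E] V) (((x⁻¹ : D.G) : V ≃ₗ[E] V) y) = y :=
  (x : V ≃ₗ[E] V).apply_symm_apply y

theorem form_apply_left (x : D.G) (y z : V) :
    D.form ((x : V ≃ₗ[E] V) y) z = D.form y (((x⁻¹ : D.G) : V ≃ₗ[E] V) z) := by
  have h := x.2 y (((x⁻¹ : D.G) : V ≃ₗ[E] V) z)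
  rwa [apply_coe_inv] at h

theorem exists_embedding_comap_ne [NumberField.IsTotallyReal F] (hF : Module.finrank ℚ F ≠ 1) :
    ∃ φ : E →+* ℂ, φ.comp (algebraMap F E) ≠ D.φ₀.comp (algebraMap F E) := by
  have hcard : 1 < Fintype.card (F →+* ℂ) := by
    rw [NumberField.Embeddings.card]
    have := Module.finrank_pos (R := ℚ) (M := F)
    omega
  obtain ⟨σ, hσ⟩ := Fintype.exists_ne_of_one_lt_card hcard (D.φ₀.comp (algebraMap F E))
  let := σ.toAlgebra
  have : Algebra.IsAlgebraic F E := Algebra.IsAlgebraic.tower_top (K := ℚ) F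
  let τ : E →ₐ[F] ℂ := IsAlgClosed.lift
  exact ⟨τ, fun h => hσ (by rw [← h]; exact τ.comp_algebraMap.symm)⟩

/-- Embeddings of the totally real field `F` are real, so each is determined by its place. -/
theorem comap_ne_of_comp_ne [NumberField.IsTotallyReal F] {φ : E →+* ℂ}
    (h : φ.comp (algebraMap F E) ≠ D.φ₀.comp (algebraMap F E)) :
    (InfinitePlace.mk φ).comap (algebraMap F E) ≠
      (InfinitePlace.mk D.φ₀).comap (algebraMap F E) := by
  rw [InfinitePlace.comap_mk, InfinitePlace.comap_mk]
  intro heq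
  rcases InfinitePlace.mk_eq_iff.1 heq with h1 | h1
  · exact h h1
  · refine h ?_
    have hr : ComplexEmbedding.IsReal (φ.comp (algebraMap F E)) :=
      InfinitePlace.isReal_of_mk_isReal (NumberField.IsTotallyReal.isReal _)
    rwa [ComplexEmbedding.isReal_iff.1 hr] at h1

/-- If `F` is not `ℚ` then the Hermitian form is anisotropic. -/
theorem anisotropic [NumberField.IsTotallyReal F] (hF : Module.finrank ℚ F ≠ 1) {x : V}
    (hx : D.form x x = 0) : x = 0 := by
  -- Since `F ≠ ℚ` there is a second archimedean place, and the form is definite there.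
  obtain ⟨φ, hφ⟩ := D.exists_embedding_comap_ne hF
  obtain ⟨s, Q, hs, hQ⟩ := D.definite φ (D.comap_ne_of_comp_ne hφ)
  have hs0 : (s : ℂ) ≠ 0 := by
    rcases hs with rfl | rfl <;> simp
  have h1 := hQ x x
  rw [hx, map_zero, eq_comm, mul_eq_zero, or_iff_right hs0] at h1
  have h2 : ∑ i, ‖Q x i‖ ^ 2 = 0 := by
    have h3 : ((∑ i, ‖Q x i‖ ^ 2 : ℝ) : ℂ) = 0 := by
      rw [← h1]
      push_cast
      exact Finset.sum_congr rfl fun i _ => (Complex.mul_conj' _).symm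
    exact_mod_cast h3
  have h3 : Q x = 0 := by
    ext i
    have := (Finset.sum_eq_zero_iff_of_nonneg fun i _ => by positivity).1 h2 i (Finset.mem_univ i)
    simpa using this
  refine D.nondegenerate x fun y => ?_
  have h4 := hQ x y
  rw [h3] at h4
  simpa using h4

/-- A family of commuting isometries generates a commutative reduced algebra. -/
theorem exists_isCommReduced [NumberField.IsTotallyReal F] (hF : Module.finrank ℚ F ≠ 1)
    {T : Set D.G} (hT : ∀ x ∈ T, ∀ y ∈ T, x * y = y * x) :
    ∃ R : Subalgebra E (Module.End E V), IsCommReduced R ∧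
      ∀ x ∈ T, ((x : V ≃ₗ[E] V) : Module.End E V) ∈ R ∧
        (((x⁻¹ : D.G) : V ≃ₗ[E] V) : Module.End E V) ∈ R := by
  let i : D.G → Module.End E V := fun x => ((x : V ≃ₗ[E] V) : Module.End E V)
  let s : Set (Module.End E V) := i '' (T ∪ T⁻¹)
  have hs : ∀ x ∈ T ∪ T⁻¹, ∀ y ∈ T ∪ T⁻¹, Commute x y := by
    have hinv : ∀ x ∈ T ∪ T⁻¹, ∃ y ∈ T, x = y ∨ x = y⁻¹ := by
      rintro x (hx | hx)
      · exact ⟨x, hx, Or.inl rfl⟩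
      · exact ⟨x⁻¹, hx, Or.inr (inv_inv x).symm⟩
    intro x hx y hy
    obtain ⟨x', hx', rfl | rfl⟩ := hinv x hx <;> obtain ⟨y', hy', rfl | rfl⟩ := hinv y hy
    · exact hT _ hx' _ hy'
    · exact Commute.inv_right (hT _ hx' _ hy')
    · exact Commute.inv_left (hT _ hx' _ hy')
    · exact Commute.inv_inv (hT _ hx' _ hy')
  have hcomm : ∀ a ∈ s, ∀ b ∈ s, a * b = b * a := by
    rintro _ ⟨x, hx, rfl⟩ _ ⟨y, hy, rfl⟩
    exact congrArg i (hs x hx y hy)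
  -- The adjoint of an isometry is its inverse, and the generating set is closed under inverses, so
  -- the algebra is closed under adjoints.
  have hadj : ∀ a ∈ Algebra.adjoin E s, ∃ b ∈ Algebra.adjoin E s,
      (∀ x y, D.form (a x) y = D.form x (b y)) ∧ ∀ x y, D.form (b x) y = D.form x (a y) := by
    intro a ha
    induction ha using Algebra.adjoin_induction with
    | mem a ha =>
      obtain ⟨x, hx, rfl⟩ := ha
      have hx' : x⁻¹ ∈ T ∪ T⁻¹ := by
        rcases hx with hx | hx
        · exact Or.inr (by simpa using hx)
        · exact Or.inl hx
      refine ⟨i x⁻¹, Algebra.subset_adjoin ⟨_, hx', rfl⟩, fun y z => D.form_apply_left x y z,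
        fun y z => ?_⟩
      have := D.form_apply_left x⁻¹ y z
      rwa [inv_inv] at this
    | algebraMap r =>
      by_cases hV : Nontrivial V
      · refine ⟨algebraMap E _ (D.conj r), Subalgebra.algebraMap_mem _ _, fun x y => ?_,
          fun x y => ?_⟩
        · rw [Module.algebraMap_end_apply, Module.algebraMap_end_apply, form_smul_left,
            form_smul_right, conj_conj]
        · rw [Module.algebraMap_end_apply, Module.algebraMap_end_apply, form_smul_left,
            form_smul_right]
      · rw [not_nontrivial_iff_subsingleton] at hV
        exact ⟨0, zero_mem _, fun x y => by rw [Subsingleton.elim x 0]; simp,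
          fun x y => by rw [Subsingleton.elim x 0]; simp⟩
    | add a b _ _ ha hb =>
      obtain ⟨a', ha', h1, h2⟩ := ha
      obtain ⟨b', hb', h3, h4⟩ := hb
      exact ⟨a' + b', add_mem ha' hb', fun x y => by simp [h1, h3], fun x y => by simp [h2, h4]⟩
    | mul a b _ _ ha hb =>
      obtain ⟨a', ha', h1, h2⟩ := ha
      obtain ⟨b', hb', h3, h4⟩ := hb
      exact ⟨b' * a', mul_mem hb' ha', fun x y => by simp [Module.End.mul_apply, h1, h3],
        fun x y => by simp [Module.End.mul_apply, h2, h4]⟩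
  have hC : ∀ a ∈ Algebra.adjoin E s, ∀ b ∈ Algebra.adjoin E s, a * b = b * a := by
    have := Algebra.isMulCommutative_adjoin E hcomm
    intro a ha b hb
    exact congrArg Subtype.val
      (mul_comm' (⟨a, ha⟩ : Algebra.adjoin E s) (⟨b, hb⟩ : Algebra.adjoin E s))
  refine ⟨Algebra.adjoin E s, ⟨hC, fun a ha h0 => ?_⟩, fun x hx =>
    ⟨Algebra.subset_adjoin ⟨x, Or.inl hx, rfl⟩,
      Algebra.subset_adjoin ⟨x⁻¹, Or.inr (by simpa using hx), rfl⟩⟩⟩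
  obtain ⟨b, hb, h1, h2⟩ := hadj a ha
  -- With `b` the adjoint of `a` and `a² = 0`: `⟨bax, bax⟩ = ⟨ax, abax⟩ = ⟨ax, baax⟩ = 0`. Then
  -- `⟨ax, ax⟩ = ⟨x, bax⟩ = 0` gives `a = 0`.
  have hba : ∀ x, b (a x) = 0 := fun x => by
    refine D.anisotropic hF ?_
    have h3 : a (b (a x)) = b (a (a x)) := LinearMap.congr_fun (hC a ha b hb) (a x)
    have h4 : a (a x) = 0 := LinearMap.congr_fun h0 x
    rw [h2, h3, h4, map_zero, map_zero]
  ext x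
  refine D.anisotropic hF ?_
  rw [h1, hba, map_zero]

end Basic

/-! ### Matrices of isometries at the archimedean places -/

section Matrix

variable {F E V : Type*} [Field F] [NumberField F] [Field E] [NumberField E] [Algebra F E]
  [AddCommGroup V] [Module E V] [Module F V] [IsScalarTower F E V] (D : HermitianDatum F E V)
  (b : Module.Basis (Fin 3) E V)

/-- The matrix of an isometry in a basis. -/
noncomputable def mat (x : D.G) : Matrix (Fin 3) (Fin 3) E :=
  LinearMap.toMatrix b b ((x : V ≃ₗ[E] V) : Module.End E V)

theorem mat_apply (x : D.G) (i j : Fin 3) : D.mat b x i j = b.repr ((x : V ≃ₗ[E] V) (b j)) i :=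
  LinearMap.toMatrix_apply _ _ _ _ _

theorem mat_mul (x y : D.G) : D.mat b (x * y) = D.mat b x * D.mat b y :=
  LinearMap.toMatrix_mul _ _ _

variable {D} in
theorem mat_injective : Function.Injective (D.mat b) := fun x y h => by
  refine Subtype.ext (LinearEquiv.toLinearMap_injective ?_)
  exact (LinearMap.toMatrix b b).injective h

/-- The matrix of the values of a semilinear map on a basis. -/
noncomputable def baseMat {φ : E →+* ℂ} (Q : V →ₛₗ[φ] (Fin 3 → ℂ)) : Matrix (Fin 3) (Fin 3) ℂ :=
  Matrix.of fun i j => Q (b j) i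

theorem baseMat_mul_map {φ : E →+* ℂ} (Q : V →ₛₗ[φ] (Fin 3 → ℂ)) (x : D.G) (i j : Fin 3) :
    (baseMat b Q * (D.mat b x).map φ) i j = Q ((x : V ≃ₗ[E] V) (b j)) i := by
  conv_rhs => rw [← b.sum_repr ((x : V ≃ₗ[E] V) (b j))]
  rw [map_sum, Finset.sum_apply, Matrix.mul_apply]
  refine Finset.sum_congr rfl fun k _ => ?_
  rw [LinearMap.map_smulₛₗ, Pi.smul_apply, smul_eq_mul, mul_comm, Matrix.map_apply, mat_apply]
  rfl

/-- Evaluating the form on the basis and on its dual basis with respect to the form exhibits an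
inverse of the transpose. -/
theorem isUnit_det_baseMat [FiniteDimensional E V] [Nontrivial V] {φ : E →+* ℂ}
    (Q : V →ₛₗ[φ] (Fin 3 → ℂ)) (T : Matrix (Fin 3) (Fin 3) ℂ)
    (hQ : ∀ x y, φ (D.form x y) = ∑ i, ∑ j, Q x i * T i j * star (Q y j)) :
    IsUnit (baseMat b Q).det := by
  choose b' hb' using fun i => D.exists_form_right_eq (b.coord i)
  have h : (baseMat b Q)ᵀ * (T * Matrix.of fun j l => star (Q (b' l) j)) = 1 := by
    ext k l
    have h1 := hQ (b k) (b' l)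
    rw [hb', Module.Basis.coord_apply, Module.Basis.repr_self] at h1
    rw [← Matrix.mul_assoc, Matrix.mul_apply]
    simp only [Matrix.mul_apply, Finset.sum_mul]
    rw [Finset.sum_comm]
    refine Eq.trans h1.symm ?_
    rw [Matrix.one_apply, Finsupp.single_apply]
    split_ifs <;> simp
  have h2 := Matrix.isUnit_det_of_right_inverse h
  rwa [Matrix.det_transpose] at h2

/-- Compactness of the unitary group at a definite place: in unitary coordinates the images of the
basis vectors keep their lengths, and the change of basis is fixed. -/
theorem exists_norm_map_mat_le_of_definite [FiniteDimensional E V] [Nontrivial V] {φ : E →+* ℂ}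
    (hφ : (InfinitePlace.mk φ).comap (algebraMap F E) ≠
      (InfinitePlace.mk D.φ₀).comap (algebraMap F E)) :
    ∃ B : ℝ, ∀ (x : D.G) i j, ‖φ (D.mat b x i j)‖ ≤ B := by
  obtain ⟨s, Q, hs, hQ⟩ := D.definite φ hφ
  have hs0 : (s : ℂ) ≠ 0 := by
    rcases hs with rfl | rfl <;> simp
  have hu := D.isUnit_det_baseMat b Q ((s : ℂ) • 1) fun x y => by
    rw [hQ, Finset.mul_sum]
    refine Finset.sum_congr rfl fun i _ => ?_
    rw [Finset.sum_eq_single i (fun j _ hj => by simp [Matrix.one_apply_ne' hj]) (by simp)]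
    simp
    ring
  have hcol : ∀ (x : D.G) j, ∑ i, ‖Q ((x : V ≃ₗ[E] V) (b j)) i‖ ^ 2 = ∑ i, ‖Q (b j) i‖ ^ 2 := by
    intro x j
    have h1 := hQ ((x : V ≃ₗ[E] V) (b j)) ((x : V ≃ₗ[E] V) (b j))
    rw [x.2, hQ, mul_right_inj' hs0] at h1
    have h2 : ((∑ i, ‖Q (b j) i‖ ^ 2 : ℝ) : ℂ) =
        ((∑ i, ‖Q ((x : V ≃ₗ[E] V) (b j)) i‖ ^ 2 : ℝ) : ℂ) := by
      push_cast
      simpa only [← Complex.mul_conj', ← starRingEnd_apply] using h1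
    exact (Complex.ofReal_injective h2).symm
  refine ⟨euclNorm (baseMat b Q)⁻¹ * euclNorm (baseMat b Q), fun x i j => ?_⟩
  have h1 : (D.mat b x).map φ = (baseMat b Q)⁻¹ * (baseMat b Q * (D.mat b x).map φ) := by
    rw [← Matrix.mul_assoc, Matrix.nonsing_inv_mul _ hu, one_mul]
  have h2 : euclNorm (baseMat b Q * (D.mat b x).map φ) = euclNorm (baseMat b Q) := by
    rw [euclNorm, euclNorm, Finset.sum_comm, Finset.sum_comm (f := fun i j => ‖baseMat b Q i j‖ ^ 2)]
    congr 1
    refine Finset.sum_congr rfl fun j _ => ?_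
    simp only [baseMat_mul_map]
    exact hcol x j
  calc ‖φ (D.mat b x i j)‖ = ‖(D.mat b x).map φ i j‖ := rfl
    _ ≤ euclNorm ((D.mat b x).map φ) := norm_apply_le_euclNorm _ i j
    _ ≤ _ := by
      refine (congrArg euclNorm h1).trans_le ((euclNorm_mul_le _ _).trans_eq ?_)
      rw [h2]

/-- Both `φ₀ e` and `φ₀ (conj e)` are roots of the same quadratic polynomial over `F` as `φ e`, and
they have equal absolute value. -/
theorem norm_eq_of_comp_eq [Nontrivial V] [Algebra.IsQuadraticExtension F E] {φ : E →+* ℂ}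
    (hφ : φ.comp (algebraMap F E) = D.φ₀.comp (algebraMap F E)) (e : E) :
    ‖φ e‖ = ‖D.φ₀ e‖ := by
  obtain ⟨t, ht⟩ := D.exists_trace e
  obtain ⟨n, hn⟩ := D.exists_norm e
  have h : ∀ f, φ (algebraMap F E f) = D.φ₀ (algebraMap F E f) := fun f => RingHom.congr_fun hφ f
  have h1 : (φ e - D.φ₀ e) * (φ e - D.φ₀ (D.conj e)) = 0 := by
    have h2 : φ e * φ e - φ (e + D.conj e) * φ e + φ (e * D.conj e) = 0 := by
      rw [map_add, map_mul]
      ring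
    rw [← ht, ← hn, h, h, ht, hn, map_add, map_mul] at h2
    linear_combination h2
  rcases mul_eq_zero.1 h1 with h2 | h2
  · rw [sub_eq_zero.1 h2]
  · rw [sub_eq_zero.1 h2, φ₀_conj, norm_star]

theorem baseMat_mul_map_of_isImage₀ {x : D.G} {x₀ : G₀} (hx : D.IsImage₀ x x₀) :
    baseMat b D.coord * (D.mat b x).map D.φ₀ = toMat x₀ * baseMat b D.coord := by
  ext i j
  rw [baseMat_mul_map, hx]
  rfl

theorem isImage₀_inv {x : D.G} {x₀ : G₀} (hx : D.IsImage₀ x x₀) : D.IsImage₀ x⁻¹ x₀⁻¹ := by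
  intro y
  have h := hx (((x⁻¹ : D.G) : V ≃ₗ[E] V) y)
  rw [apply_coe_inv] at h
  rw [h, Matrix.mulVec_mulVec, ← toMat_mul, inv_mul_cancel]
  exact (Matrix.one_mulVec _).symm

end Matrix

end HermitianDatum

theorem euclNorm_J_le : euclNorm J ≤ 3 := by
  have := euclNorm_le_of_norm_apply_le (X := J) (B := 1) fun i j => by
    fin_cases i <;> fin_cases j <;> simp [J]
  linarith

theorem euclNorm_toMat_inv_le (g : G₀) : euclNorm (toMat g⁻¹) ≤ 9 * euclNorm (toMat g) := by
  rw [toMat_inv_eq]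
  have h1 := euclNorm_mul_le (J * (toMat g)ᴴ) J
  have h2 := euclNorm_mul_le J (toMat g)ᴴ
  rw [euclNorm_conjTranspose] at h2
  have h3 := euclNorm_nonneg (toMat g)
  have h4 := euclNorm_nonneg (J * (toMat g)ᴴ)
  nlinarith [euclNorm_J_le, euclNorm_nonneg J]

theorem exists_euclNorm_le_of_isCompact {Ω : Set G₀} (hΩ : IsCompact Ω) :
    ∃ B : ℝ, 0 ≤ B ∧ ∀ g ∈ Ω, euclNorm (toMat g) ≤ B ∧ euclNorm (toMat g⁻¹) ≤ B := by
  have hc : Continuous fun g : G₀ => euclNorm (toMat g) :=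
    continuous_euclNorm.comp (Units.continuous_val.comp continuous_subtype_val)
  obtain ⟨B, hB⟩ := (hΩ.image hc).bddAbove
  have hB' : ∀ g ∈ Ω, euclNorm (toMat g) ≤ B := fun g hg => hB ⟨g, hg, rfl⟩
  refine ⟨9 * |B|, by positivity, fun g hg => ⟨?_, ?_⟩⟩
  · linarith [hB' g hg, le_abs_self B, abs_nonneg B]
  · linarith [hB' g hg, le_abs_self B, abs_nonneg B, euclNorm_toMat_inv_le g]

namespace HermitianDatum

/-! ### Uniform archimedean bounds for returns -/

section Bounds

variable {F E V : Type*} [Field F] [NumberField F] [Field E] [NumberField E] [Algebra F E]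
  [AddCommGroup V] [Module E V] [Module F V] [IsScalarTower F E V] (D : HermitianDatum F E V)
  (b : Module.Basis (Fin 3) E V) [FiniteDimensional E V] [Nontrivial V]

theorem isUnit_det_baseMat_coord : IsUnit (baseMat b D.coord).det :=
  D.isUnit_det_baseMat b D.coord J D.coord_form

theorem map_mat_eq_of_isImage₀ {x : D.G} {x₀ : G₀} (hx : D.IsImage₀ x x₀) :
    (D.mat b x).map D.φ₀ = (baseMat b D.coord)⁻¹ * toMat x₀ * baseMat b D.coord := by
  rw [Matrix.mul_assoc, ← D.baseMat_mul_map_of_isImage₀ b hx, ← Matrix.mul_assoc,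
    Matrix.nonsing_inv_mul _ (D.isUnit_det_baseMat_coord b), one_mul]

/-- Isometries whose image at `v₀` is close to the center, up to conjugation by a compact set, have
bounded matrix entries at all archimedean places. -/
theorem exists_norm_map_mat_le [NumberField.IsTotallyReal F] [Algebra.IsQuadraticExtension F E]
    {Ω : Set G₀} (hΩ : IsCompact Ω) :
    ∃ B : ℝ, 0 < B ∧ ∀ g ∈ Ω, ∀ (x : D.G) (x₀ : G₀), D.IsImage₀ x x₀ →
      distTo (g⁻¹ * x₀ * g) Z₀ ≤ 1 → ∀ (φ : E →+* ℂ) i j,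
        ‖φ (D.mat b x i j)‖ ≤ B ∧ ‖φ (D.mat b x⁻¹ i j)‖ ≤ B := by
  obtain ⟨w, hw0, hw⟩ := exists_euclNorm_le_of_isCompact hΩ
  set p := euclNorm (baseMat b D.coord)
  set q := euclNorm (baseMat b D.coord)⁻¹
  have hp : 0 ≤ p := euclNorm_nonneg _
  have hq : 0 ≤ q := euclNorm_nonneg _
  -- The bound `3e²` is for elements near the center, and 9 makes it cover their inverses. The
  -- factors `w` undo the conjugation by `g`, and `p`, `q` the change of basis.
  set e := q * (w * (9 * (Real.exp 2 * 3)) * w) * p with he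
  have he0 : 0 ≤ e := by positivity
  have hconj : ∀ g ∈ Ω, ∀ (x : D.G) (x₀ : G₀), D.IsImage₀ x x₀ →
      euclNorm (toMat (g⁻¹ * x₀ * g)) ≤ 9 * (Real.exp 2 * 3) → ∀ i j,
        ‖D.φ₀ (D.mat b x i j)‖ ≤ e := by
    intro g hg x x₀ hx hb i j
    have h1 : toMat x₀ = toMat g * toMat (g⁻¹ * x₀ * g) * toMat g⁻¹ := by
      rw [← toMat_mul, ← toMat_mul]
      congr 1
      group
    have h2 : euclNorm (toMat x₀) ≤ w * (9 * (Real.exp 2 * 3)) * w := by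
      rw [h1]
      calc _ ≤ euclNorm (toMat g) * euclNorm (toMat (g⁻¹ * x₀ * g)) * euclNorm (toMat g⁻¹) :=
            (euclNorm_mul_le _ _).trans
              (mul_le_mul_of_nonneg_right (euclNorm_mul_le _ _) (euclNorm_nonneg _))
        _ ≤ _ := by
            gcongr
            · exact euclNorm_nonneg _
            · exact euclNorm_nonneg _
            · exact (hw g hg).1
            · exact (hw g hg).2
    calc ‖D.φ₀ (D.mat b x i j)‖ = ‖(D.mat b x).map D.φ₀ i j‖ := rfl
      _ ≤ euclNorm ((D.mat b x).map D.φ₀) := norm_apply_le_euclNorm _ i j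
      _ ≤ q * euclNorm (toMat x₀) * p := by
          rw [D.map_mat_eq_of_isImage₀ b hx]
          exact (euclNorm_mul_le _ _).trans
            (mul_le_mul_of_nonneg_right (euclNorm_mul_le _ _) (euclNorm_nonneg _))
      _ ≤ e := by rw [he]; gcongr
  have hdef : ∀ φ : E →+* ℂ, ∃ B : ℝ, ∀ g ∈ Ω, ∀ (x : D.G) (x₀ : G₀), D.IsImage₀ x x₀ →
      distTo (g⁻¹ * x₀ * g) Z₀ ≤ 1 → ∀ i j,
        ‖φ (D.mat b x i j)‖ ≤ B ∧ ‖φ (D.mat b x⁻¹ i j)‖ ≤ B := by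
    intro φ
    -- Over `v₀` absolute values agree with those under `φ₀`; at every other place the form is
    -- definite.
    by_cases hφ : φ.comp (algebraMap F E) = D.φ₀.comp (algebraMap F E)
    · refine ⟨e, fun g hg x x₀ hx hd i j => ?_⟩
      have hd' := euclNorm_le_of_distTo_Z₀ hd
      rw [D.norm_eq_of_comp_eq hφ, D.norm_eq_of_comp_eq hφ]
      refine ⟨hconj g hg x x₀ hx ?_ i j, hconj g hg x⁻¹ x₀⁻¹ (D.isImage₀_inv hx) ?_ i j⟩
      · linarith [Real.exp_pos 2]
      · have h3 : g⁻¹ * x₀⁻¹ * g = (g⁻¹ * x₀ * g)⁻¹ := by group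
        rw [h3]
        exact (euclNorm_toMat_inv_le _).trans (by linarith)
    · obtain ⟨B, hB⟩ := D.exists_norm_map_mat_le_of_definite b (D.comap_ne_of_comp_ne hφ)
      exact ⟨B, fun g _ x x₀ _ _ i j => ⟨hB x i j, hB x⁻¹ i j⟩⟩
  choose B hB using hdef
  refine ⟨1 + ∑ φ, |B φ|, by positivity, fun g hg x x₀ hx hd φ i j => ?_⟩
  have h1 : B φ ≤ 1 + ∑ φ, |B φ| := by
    have := Finset.single_le_sum (f := fun φ => |B φ|) (fun _ _ => abs_nonneg _)
      (Finset.mem_univ φ)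
    have h2 := le_abs_self (B φ)
    linarith
  exact ⟨(hB φ g hg x x₀ hx hd i j).1.trans h1, (hB φ g hg x x₀ hx hd i j).2.trans h1⟩

/-- Isometries with images close to a conjugate of `MA` almost commute at `v₀`. -/
theorem exists_norm_φ₀_commutator_le {Ω : Set G₀} (hΩ : IsCompact Ω) :
    ∃ B : ℝ, 0 < B ∧ ∀ g ∈ Ω, ∀ κ : ℝ, 0 < κ → κ ≤ 1 → ∀ (x y : D.G) (x₀ y₀ : G₀),
      D.IsImage₀ x x₀ → D.IsImage₀ y y₀ →
      distTo (g⁻¹ * x₀ * g) Z₀ ≤ 1 → distTo (g⁻¹ * y₀ * g) Z₀ ≤ 1 →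
      distTo (g⁻¹ * x₀ * g) MA ≤ ENNReal.ofReal κ → distTo (g⁻¹ * y₀ * g) MA ≤ ENNReal.ofReal κ →
      ∀ i j, ‖D.φ₀ ((D.mat b x * D.mat b y - D.mat b y * D.mat b x) i j)‖ ≤ B * κ := by
  obtain ⟨w, hw0, hw⟩ := exists_euclNorm_le_of_isCompact hΩ
  obtain ⟨B, hB⟩ := exists_euclNorm_commutator_le
  set p := euclNorm (baseMat b D.coord)
  set q := euclNorm (baseMat b D.coord)⁻¹
  have hp : 0 ≤ p := euclNorm_nonneg _
  have hq : 0 ≤ q := euclNorm_nonneg _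
  refine ⟨q * (w * |B| * w) * p + 1, by positivity,
    fun g hg κ hκ hκ1 x y x₀ y₀ hx hy hxZ hyZ hxM hyM i j => ?_⟩
  have h1 : (D.mat b x * D.mat b y - D.mat b y * D.mat b x).map D.φ₀ =
      (baseMat b D.coord)⁻¹ * (toMat g * (toMat (g⁻¹ * x₀ * g) * toMat (g⁻¹ * y₀ * g) -
        toMat (g⁻¹ * y₀ * g) * toMat (g⁻¹ * x₀ * g)) * toMat g⁻¹) * baseMat b D.coord := by
    have hxy : ∀ u v : G₀, toMat g * (toMat (g⁻¹ * u * g) * toMat (g⁻¹ * v * g)) * toMat g⁻¹ =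
        toMat u * toMat v := by
      intro u v
      rw [← toMat_mul, ← toMat_mul, ← toMat_mul, ← toMat_mul]
      congr 1
      group
    have hu := D.isUnit_det_baseMat_coord b
    rw [mul_sub (toMat g), sub_mul, hxy, hxy]
    have hms : ∀ X Y : Matrix (Fin 3) (Fin 3) E, (X - Y).map D.φ₀ = X.map D.φ₀ - Y.map D.φ₀ :=
      fun X Y => by
        ext i j
        simp
    rw [hms, Matrix.map_mul, Matrix.map_mul, D.map_mat_eq_of_isImage₀ b hx,
      D.map_mat_eq_of_isImage₀ b hy]
    have hz : ∀ X Y : Matrix (Fin 3) (Fin 3) ℂ,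
        (baseMat b D.coord)⁻¹ * X * baseMat b D.coord *
          ((baseMat b D.coord)⁻¹ * Y * baseMat b D.coord) =
        (baseMat b D.coord)⁻¹ * (X * Y) * baseMat b D.coord := by
      intro X Y
      calc _ = (baseMat b D.coord)⁻¹ * X * (baseMat b D.coord * (baseMat b D.coord)⁻¹) * Y *
            baseMat b D.coord := by simp only [Matrix.mul_assoc]
        _ = _ := by rw [Matrix.mul_nonsing_inv _ hu]; simp only [Matrix.mul_assoc, one_mul]
    rw [hz, hz, mul_sub, sub_mul]
  calc ‖D.φ₀ ((D.mat b x * D.mat b y - D.mat b y * D.mat b x) i j)‖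
      = ‖(D.mat b x * D.mat b y - D.mat b y * D.mat b x).map D.φ₀ i j‖ := rfl
    _ ≤ euclNorm ((D.mat b x * D.mat b y - D.mat b y * D.mat b x).map D.φ₀) :=
        norm_apply_le_euclNorm _ i j
    _ ≤ q * (w * (|B| * κ) * w) * p := by
        rw [h1]
        refine (euclNorm_mul_le _ _).trans (mul_le_mul_of_nonneg_right
          ((euclNorm_mul_le _ _).trans (mul_le_mul_of_nonneg_left ?_ hq)) hp)
        refine (euclNorm_mul_le _ _).trans (mul_le_mul ((euclNorm_mul_le _ _).trans
          (mul_le_mul (hw g hg).1 ?_ (euclNorm_nonneg _) hw0)) (hw g hg).2 (euclNorm_nonneg _)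
            (by positivity))
        refine (hB κ _ _ hκ hκ1 hxZ hyZ hxM hyM).trans ?_
        gcongr
        exact le_abs_self B
    _ ≤ _ := by nlinarith

end Bounds

end HermitianDatum

/-! ### Integrality at the finite places -/

theorem exists_nat_forall_isIntegral {E : Type*} [Field E] [NumberField E] {T : Set E}
    (hT : T.Finite) : ∃ c : ℕ, 0 < c ∧ ∀ e ∈ T, IsIntegral ℤ ((c : E) * e) := by
  obtain ⟨y, hy, h⟩ := exists_integral_multiples ℤ ℚ (L := E) hT.toFinset
  refine ⟨y.natAbs, Int.natAbs_pos.2 hy, fun e he => ?_⟩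
  have h1 := h e (hT.mem_toFinset.2 he)
  rw [zsmul_eq_mul] at h1
  rcases Int.natAbs_eq y with h2 | h2
  · rw [h2] at h1
    simpa using h1
  · rw [h2] at h1
    simpa using h1.neg

/-! ### Integrality in the completions of `F` -/

section Completion

variable {F : Type*} [Field F] [NumberField F] (v : HeightOneSpectrum (𝓞 F))

theorem algebraMap_mem_adicCompletionIntegers_iff (k : F) :
    algebraMap F (v.adicCompletion F) k ∈ v.adicCompletionIntegers F ↔ v.valuation F k ≤ 1 := by
  rw [HeightOneSpectrum.mem_adicCompletionIntegers]
  change Valued.v (k : v.adicCompletion F) ≤ 1 ↔ _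
  rw [HeightOneSpectrum.valuedAdicCompletion_eq_valuation']

theorem algebraMap_mem_of_isIntegral {k : F} (hk : IsIntegral ℤ k) :
    algebraMap F (v.adicCompletion F) k ∈ v.adicCompletionIntegers F := by
  rw [algebraMap_mem_adicCompletionIntegers_iff]
  exact v.valuation_le_one (⟨k, hk⟩ : 𝓞 F)

theorem isIntegral_of_forall_algebraMap_mem {k : F}
    (h : ∀ v : HeightOneSpectrum (𝓞 F),
      algebraMap F (v.adicCompletion F) k ∈ v.adicCompletionIntegers F) : IsIntegral ℤ k := by
  obtain ⟨r, rfl⟩ := HeightOneSpectrum.mem_integers_of_valuation_le_one F k fun v =>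
    (algebraMap_mem_adicCompletionIntegers_iff v k).1 (h v)
  exact r.2

/-- An element of `v ^ m` is divisible by the `m`-th power of any uniformizer of `𝒪_v`. -/
theorem exists_algebraMap_eq_pow_mul {s : 𝓞 F} {m : ℕ} (hs : s ∈ v.asIdeal ^ m)
    {ϖ : v.adicCompletionIntegers F} (hϖ : Irreducible ϖ) :
    ∃ o : v.adicCompletionIntegers F,
      algebraMap F (v.adicCompletion F) (s : F) = ((ϖ ^ m * o : v.adicCompletionIntegers F) :
        v.adicCompletion F) := by
  -- Compare through a global uniformizer `π`: the quotient of `s` by `π ^ m` is integral at `v`,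
  -- and `ϖ` divides the nonunit `π`.
  obtain ⟨π, hπ⟩ := v.intValuation_exists_uniformizer
  have hπ0 : (π : F) ≠ 0 := by
    intro h
    have h0 : π = 0 := by exact_mod_cast h
    rw [h0, map_zero] at hπ
    exact WithZero.coe_ne_zero hπ.symm
  have hπv : v.valuation F (π : F) = WithZero.exp (-1 : ℤ) := by
    rw [← hπ]
    exact v.valuation_of_algebraMap π
  have hπmem := algebraMap_mem_of_isIntegral v π.2
  have hdvd : ϖ ∣ (⟨_, hπmem⟩ : v.adicCompletionIntegers F) := by
    rw [← Ideal.mem_span_singleton, ← (IsDiscreteValuationRing.irreducible_iff_uniformizer ϖ).1 hϖ,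
      IsLocalRing.mem_maximalIdeal, mem_nonunits_iff,
      HeightOneSpectrum.adicCompletionIntegers.isUnit_iff_valued_eq_one]
    change Valued.v (((π : F) : v.adicCompletion F)) ≠ 1
    rw [HeightOneSpectrum.valuedAdicCompletion_eq_valuation', hπv]
    decide
  obtain ⟨y, hy⟩ := hdvd
  have hq : algebraMap F (v.adicCompletion F) ((s : F) / (π : F) ^ m) ∈
      v.adicCompletionIntegers F := by
    rw [algebraMap_mem_adicCompletionIntegers_iff, map_div₀, map_pow, hπv]
    have h1 : v.valuation F (s : F) ≤ WithZero.exp (-(m : ℤ)) := by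
      refine (v.valuation_of_algebraMap s).trans_le ?_
      exact (v.intValuation_le_pow_iff_mem s m).2 hs
    have h2 : WithZero.exp (-1 : ℤ) ^ m = WithZero.exp (-(m : ℤ)) := by
      rw [← WithZero.exp_nsmul]
      congr 1
      simp
    rw [h2]
    exact div_le_one_of_le₀ h1 zero_le
  refine ⟨y ^ m * ⟨_, hq⟩, ?_⟩
  have h3 : algebraMap F (v.adicCompletion F) (s : F) =
      algebraMap F (v.adicCompletion F) (π : F) ^ m *
        algebraMap F (v.adicCompletion F) ((s : F) / (π : F) ^ m) := by
    rw [← map_pow, ← map_mul, mul_div_cancel₀ _ (pow_ne_zero m hπ0)]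
  have h4 : algebraMap F (v.adicCompletion F) (π : F) = (ϖ : v.adicCompletion F) * y :=
    congrArg Subtype.val hy
  rw [h3, h4, ← mul_assoc]
  push_cast
  ring

end Completion

/-! ### Local orders, local integrality and the local center -/

section LocalLattice

variable {F E V : Type*} [Field F] [NumberField F] [Field E] [NumberField E] [Algebra F E]
  [AddCommGroup V] [Module E V] [Module F V] [IsScalarTower F E V]
  (v : HeightOneSpectrum (𝓞 F))

theorem one_tmul_mem_localLattice {W : Type*} [AddCommGroup W] [Module F W] {T : Set W} {x : W}
    (hx : x ∈ T) : (1 : v.adicCompletion F) ⊗ₜ[F] x ∈ localLattice v T :=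
  Submodule.subset_span ⟨x, hx, rfl⟩

variable (E) in
/-- The order `𝒪_{E,v}` in `F_v ⊗ E`. -/
noncomputable abbrev localOrder : Submodule (v.adicCompletionIntegers F) (v.adicCompletion F ⊗[F] E) :=
  localLattice v (Set.range (algebraMap (𝓞 E) E))

theorem one_tmul_mem_localOrder {e : E} (he : IsIntegral ℤ e) :
    (1 : v.adicCompletion F) ⊗ₜ[F] e ∈ localOrder E v :=
  one_tmul_mem_localLattice v ⟨⟨e, he⟩, rfl⟩

theorem mul_mem_localOrder {a b : v.adicCompletion F ⊗[F] E} (ha : a ∈ localOrder E v)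
    (hb : b ∈ localOrder E v) : a * b ∈ localOrder E v := by
  induction ha using Submodule.span_induction with
  | mem a ha =>
    obtain ⟨_, ⟨e, rfl⟩, rfl⟩ := ha
    induction hb using Submodule.span_induction with
    | mem b hb =>
      obtain ⟨_, ⟨f, rfl⟩, rfl⟩ := hb
      rw [Algebra.TensorProduct.tmul_mul_tmul, one_mul, ← map_mul]
      exact one_tmul_mem_localLattice v ⟨_, rfl⟩
    | zero => rw [mul_zero]; exact zero_mem _
    | add x y _ _ hx hy => rw [mul_add]; exact add_mem hx hy
    | smul r x _ hx =>
      rw [mul_smul_comm]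
      exact Submodule.smul_mem _ _ hx
  | zero => rw [zero_mul]; exact zero_mem _
  | add x y _ _ hx hy => rw [add_mul]; exact add_mem hx hy
  | smul r x _ hx =>
    rw [smul_mul_assoc]
    exact Submodule.smul_mem _ _ hx

/-- A criterion for `2e` to be integral over `v`. -/
def IsIntegralAt (D : HermitianDatum F E V) (e : E) : Prop :=
  ∀ f : F, algebraMap F E f = e + D.conj e ∨ algebraMap F E f = e * D.conj e →
    algebraMap F (v.adicCompletion F) (2 * f) ∈ v.adicCompletionIntegers F

/-- The element `2e` is a root of `X² - 2tr(e)X + 4nm(e)`. Testing trace and norm allows integrality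
in `E` to be checked at the places of `F`. -/
theorem isIntegral_two_mul [Nontrivial V] [Algebra.IsQuadraticExtension F E]
    {D : HermitianDatum F E V} {e : E} (h : ∀ v, IsIntegralAt v D e) : IsIntegral ℤ (2 * e) := by
  obtain ⟨t, ht⟩ := D.exists_trace e
  obtain ⟨n, hn⟩ := D.exists_norm e
  have h1 : IsIntegral ℤ (algebraMap F E (2 * t)) :=
    (isIntegral_of_forall_algebraMap_mem fun v => h v t (Or.inl ht)).algebraMap
  have h2 : IsIntegral ℤ (algebraMap F E (2 * n)) :=
    (isIntegral_of_forall_algebraMap_mem fun v => h v n (Or.inr hn)).algebraMap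
  let a : 𝓞 E := ⟨_, h1⟩
  let c : 𝓞 E := ⟨_, h2⟩
  have h3 : IsIntegral (𝓞 E) (2 * e) := by
    refine ⟨Polynomial.X ^ 2 + (Polynomial.C (-a) * Polynomial.X + Polynomial.C (2 * c)), ?_, ?_⟩
    · refine Polynomial.monic_X_pow_add ?_
      refine lt_of_le_of_lt (Polynomial.degree_linear_le) ?_
      decide
    · simp only [Polynomial.eval₂_add, Polynomial.eval₂_mul, Polynomial.eval₂_pow,
        Polynomial.eval₂_X, Polynomial.eval₂_C, map_mul]
      have ha : algebraMap (𝓞 E) E a = 2 * (e + D.conj e) := by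
        rw [← ht]
        exact map_mul (algebraMap F E) 2 t |>.trans (by rw [map_ofNat])
      have hc : algebraMap (𝓞 E) E c = 2 * (e * D.conj e) := by
        rw [← hn]
        exact map_mul (algebraMap F E) 2 n |>.trans (by rw [map_ofNat])
      rw [map_neg, ha, hc, map_ofNat]
      ring
  exact isIntegral_trans _ h3

/-- The order is stable under conjugation and products, and the trace maps it to `𝒪_v`. On elements
of `F` the trace is multiplication by 2, which is the source of the factor 2 in `IsIntegralAt`. -/
theorem IsIntegralAt.of_mem_localOrder [Algebra.IsQuadraticExtension F E]
    (D : HermitianDatum F E V) {e : E}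
    (he : (1 : v.adicCompletion F) ⊗ₜ[F] e ∈ localOrder E v) : IsIntegralAt v D e := by
  have hconj : (1 : v.adicCompletion F) ⊗ₜ[F] D.conj e ∈ localOrder E v := by
    have key : ∀ a ∈ localOrder E v,
        D.conj.toLinearMap.lTensor (v.adicCompletion F) a ∈ localOrder E v := by
      intro a ha
      induction ha using Submodule.span_induction with
      | mem a ha =>
        obtain ⟨_, ⟨e, rfl⟩, rfl⟩ := ha
        rw [LinearMap.lTensor_tmul]
        exact one_tmul_mem_localOrder v (e.2.map (D.conj.restrictScalars ℤ))
      | zero => rw [map_zero]; exact zero_mem _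
      | add x y _ _ hx hy => rw [map_add]; exact add_mem hx hy
      | smul r x _ hx =>
        have h1 : D.conj.toLinearMap.lTensor (v.adicCompletion F) (r • x) =
            r • D.conj.toLinearMap.lTensor (v.adicCompletion F) x :=
          map_smul (D.conj.toLinearMap.baseChange (v.adicCompletion F))
            (r : v.adicCompletion F) x
        rw [h1]
        exact Submodule.smul_mem _ _ hx
    exact key _ he
  let τ : v.adicCompletion F ⊗[F] E →ₗ[v.adicCompletion F] v.adicCompletion F :=
    (TensorProduct.AlgebraTensorModule.rid F (v.adicCompletion F) (v.adicCompletion F)).toLinearMap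
      ∘ₗ (Algebra.trace F E).baseChange (v.adicCompletion F)
  have hτ : ∀ f, τ (1 ⊗ₜ f) = algebraMap F (v.adicCompletion F) (Algebra.trace F E f) := by
    intro f
    simp [τ, Algebra.smul_def]
  have hτmem : ∀ a ∈ localOrder E v, τ a ∈ v.adicCompletionIntegers F := by
    intro a ha
    induction ha using Submodule.span_induction with
    | mem a ha =>
      obtain ⟨_, ⟨e, rfl⟩, rfl⟩ := ha
      rw [hτ]
      exact algebraMap_mem_of_isIntegral v (Algebra.isIntegral_trace e.2)
    | zero => rw [map_zero]; exact zero_mem _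
    | add x y _ _ hx hy => rw [map_add]; exact add_mem hx hy
    | smul r x _ hx =>
      have h1 : τ (r • x) = (r : v.adicCompletion F) * τ x :=
        map_smul τ (r : v.adicCompletion F) x
      rw [h1]
      exact mul_mem r.2 hx
  have h2 : ∀ f : F, (1 : v.adicCompletion F) ⊗ₜ[F] algebraMap F E f ∈ localOrder E v →
      algebraMap F (v.adicCompletion F) (2 * f) ∈ v.adicCompletionIntegers F := by
    intro f hf
    have h3 := hτmem _ hf
    rwa [hτ, Algebra.trace_algebraMap, Algebra.IsQuadraticExtension.finrank_eq_two,
      nsmul_eq_mul, Nat.cast_two] at h3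
  rintro f (hf | hf)
  · refine h2 f ?_
    rw [hf, TensorProduct.tmul_add]
    exact add_mem he hconj
  · refine h2 f ?_
    have h3 := mul_mem_localOrder v he hconj
    rwa [Algebra.TensorProduct.tmul_mul_tmul, one_mul, ← hf] at h3

theorem IsIntegralAt.of_split (D : HermitianDatum F E V) (ψ : E →ₐ[F] v.adicCompletion F) {e : E}
    (h1 : ψ e ∈ v.adicCompletionIntegers F) (h2 : ψ (D.conj e) ∈ v.adicCompletionIntegers F) :
    IsIntegralAt v D e := by
  have key : ∀ f : F, algebraMap F (v.adicCompletion F) f ∈ v.adicCompletionIntegers F →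
      algebraMap F (v.adicCompletion F) (2 * f) ∈ v.adicCompletionIntegers F := fun f hf => by
    rw [map_mul, map_ofNat]
    exact mul_mem (ofNat_mem _ 2) hf
  rintro f (hf | hf)
  · refine key f ?_
    rw [← ψ.commutes, hf, map_add]
    exact add_mem h1 h2
  · refine key f ?_
    rw [← ψ.commutes, hf, map_mul]
    exact mul_mem h1 h2

namespace HermitianDatum

variable (D : HermitianDatum F E V)

theorem localForm_tmul (a a' : v.adicCompletion F) (x y : V) :
    D.localForm v (a ⊗ₜ x) (a' ⊗ₜ y) = (a * a') ⊗ₜ D.form x y :=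
  LinearMap.BilinMap.baseChange_tmul _ _ _ _ _

theorem toLocal_one_tmul (x : D.G) (y : V) :
    D.toLocal v x ((1 : v.adicCompletion F) ⊗ₜ y) = 1 ⊗ₜ (x : V ≃ₗ[E] V) y := rfl

theorem localForm_localScalar_left (e : E) (p q : v.adicCompletion F ⊗[F] V) :
    D.localForm v (localScalar v e p) q = 1 ⊗ₜ e * D.localForm v p q := by
  induction p with
  | zero => simp
  | add p p' h h' => simp only [map_add, LinearMap.add_apply, h, h', mul_add]
  | tmul a x =>
    induction q with
    | zero => simp
    | add p p' h h' => simp only [map_add, h, h', mul_add]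
    | tmul a' y =>
      have h1 : localScalar v e (a ⊗ₜ[F] x) = a ⊗ₜ[F] (e • x) := rfl
      rw [h1, localForm_tmul, localForm_tmul, Algebra.TensorProduct.tmul_mul_tmul, one_mul,
        form_smul_left]

theorem localForm_localScalar_right (e : E) (p q : v.adicCompletion F ⊗[F] V) :
    D.localForm v p (localScalar v e q) = 1 ⊗ₜ D.conj e * D.localForm v p q := by
  induction p with
  | zero => simp
  | add p p' h h' => simp only [map_add, LinearMap.add_apply, h, h', mul_add]
  | tmul a x =>
    induction q with
    | zero => simp
    | add p p' h h' => simp only [map_add, h, h', mul_add]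
    | tmul a' y =>
      have h1 : localScalar v e (a' ⊗ₜ[F] y) = a' ⊗ₜ[F] (e • y) := rfl
      rw [h1, localForm_tmul, localForm_tmul, Algebra.TensorProduct.tmul_mul_tmul, one_mul,
        form_smul_right]

/-- A central factor cancels in a product of two values of the form. -/
theorem localForm_mul_localForm_of_mem_localZ
    {z : (v.adicCompletion F ⊗[F] V) ≃ₗ[v.adicCompletion F] (v.adicCompletion F ⊗[F] V)}
    (hz : z ∈ D.localZ v) (p q r s : v.adicCompletion F ⊗[F] V) :
    D.localForm v (z p) q * D.localForm v r (z s) = D.localForm v p q * D.localForm v r s := by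
  -- A scalar multiplies the form by some `α` through the first variable and by some `β` through the
  -- second. Being an isometry, `z` has `αβ` acting trivially on all values of the form.
  have key : ∀ T ∈ Submodule.span (v.adicCompletion F)
      (Set.range fun e : E => localScalar (V := V) v e),
      ∃ α β : v.adicCompletion F ⊗[F] E, (∀ p q, D.localForm v (T p) q = α * D.localForm v p q) ∧
        ∀ p q, D.localForm v p (T q) = β * D.localForm v p q := by
    intro T hT
    induction hT using Submodule.span_induction with
    | mem T hT =>
      obtain ⟨e, rfl⟩ := hT
      exact ⟨_, _, D.localForm_localScalar_left v e, D.localForm_localScalar_right v e⟩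
    | zero => exact ⟨0, 0, by simp, by simp⟩
    | add S T _ _ hS hT =>
      obtain ⟨α, β, h1, h2⟩ := hS
      obtain ⟨α', β', h3, h4⟩ := hT
      exact ⟨α + α', β + β', fun p q => by simp [h1, h3, add_mul],
        fun p q => by simp [h2, h4, add_mul]⟩
    | smul c T _ hT =>
      obtain ⟨α, β, h1, h2⟩ := hT
      exact ⟨c • α, c • β, fun p q => by simp [h1], fun p q => by simp [h2]⟩
  obtain ⟨α, β, h1, h2⟩ := key _ hz.2
  have h1' : ∀ p q, D.localForm v (z p) q = α * D.localForm v p q := h1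
  have h2' : ∀ p q, D.localForm v p (z q) = β * D.localForm v p q := h2
  have h3 := hz.1.2 p q
  rw [h1', h2'] at h3
  rw [h1', h2']
  linear_combination D.localForm v r s * h3

end HermitianDatum

end LocalLattice

/-! ### Integrality of products of matrix entries of Hecke returns -/

namespace HermitianDatum

variable {F E V : Type*} [Field F] [NumberField F] [Field E] [NumberField E] [Algebra F E]
  [AddCommGroup V] [Module E V] [Module F V] [IsScalarTower F E V]
  (v : HeightOneSpectrum (𝓞 F)) (D : HermitianDatum F E V)
  [Module (𝓞 E) V] [IsScalarTower (𝓞 E) E V] {L : Submodule (𝓞 E) V}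

theorem exists_nat_mul_form_isIntegral (hL : L.FG) :
    ∃ c : ℕ, 0 < c ∧ ∀ x ∈ L, ∀ y ∈ L, IsIntegral ℤ ((c : E) * D.form x y) := by
  by_cases hV : Nontrivial V
  swap
  · rw [not_nontrivial_iff_subsingleton] at hV
    exact ⟨1, one_pos, fun x _ y _ => by
      rw [Subsingleton.elim x 0, map_zero, LinearMap.zero_apply, mul_zero]
      exact isIntegral_zero⟩
  obtain ⟨s, rfl⟩ := hL
  obtain ⟨c, hc, h⟩ := exists_nat_forall_isIntegral
    (T := Set.image2 (fun x y => D.form x y) (s : Set V) (s : Set V))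
    (Set.Finite.image2 _ s.finite_toSet s.finite_toSet)
  refine ⟨c, hc, fun x hx y hy => ?_⟩
  induction hx using Submodule.span_induction with
  | mem x hx =>
    induction hy using Submodule.span_induction with
    | mem y hy => exact h _ ⟨x, hx, y, hy, rfl⟩
    | zero => rw [map_zero, mul_zero]; exact isIntegral_zero
    | add y z _ _ hy hz => rw [map_add, mul_add]; exact hy.add hz
    | smul r y _ hy =>
      rw [← algebraMap_smul E r y, form_smul_right, mul_left_comm]
      exact (r.2.map (D.conj.restrictScalars ℤ)).mul hy
  | zero => rw [map_zero, LinearMap.zero_apply, mul_zero]; exact isIntegral_zero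
  | add x z _ _ hx hz => rw [map_add, LinearMap.add_apply, mul_add]; exact hx.add hz
  | smul r x _ hx =>
    rw [← algebraMap_smul E r x, form_smul_left, mul_left_comm]
    exact r.2.mul hx

theorem smul_localForm_mem_localOrder {c : ℕ}
    (hc : ∀ x ∈ L, ∀ y ∈ L, IsIntegral ℤ ((c : E) * D.form x y))
    {p q : v.adicCompletion F ⊗[F] V} (hp : p ∈ localLattice v (L : Set V))
    (hq : q ∈ localLattice v (L : Set V)) :
    (1 ⊗ₜ (c : E)) * D.localForm v p q ∈ localOrder E v := by
  have hsl : ∀ (r : v.adicCompletionIntegers F) (p q : v.adicCompletion F ⊗[F] V),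
      D.localForm v (r • p) q = r • D.localForm v p q := fun r p q => by
    have h1 : r • p = (r : v.adicCompletion F) • p := rfl
    rw [h1, map_smul, LinearMap.smul_apply]
    rfl
  have hsr : ∀ (r : v.adicCompletionIntegers F) (p q : v.adicCompletion F ⊗[F] V),
      D.localForm v p (r • q) = r • D.localForm v p q := fun r p q => by
    have h1 : r • q = (r : v.adicCompletion F) • q := rfl
    rw [h1, map_smul]
    rfl
  induction hp using Submodule.span_induction with
  | mem p hp =>
    obtain ⟨x, hx, rfl⟩ := hp
    induction hq using Submodule.span_induction with
    | mem q hq =>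
      obtain ⟨y, hy, rfl⟩ := hq
      rw [localForm_tmul, Algebra.TensorProduct.tmul_mul_tmul, one_mul, one_mul]
      exact one_tmul_mem_localOrder v (hc x hx y hy)
    | zero => rw [map_zero, mul_zero]; exact zero_mem _
    | add y z _ _ hy hz => rw [map_add, mul_add]; exact add_mem hy hz
    | smul r y _ hy =>
      rw [hsr, mul_smul_comm]
      exact Submodule.smul_mem _ _ hy
  | zero => rw [map_zero, LinearMap.zero_apply, mul_zero]; exact zero_mem _
  | add x z _ _ hx hz => rw [map_add, LinearMap.add_apply, mul_add]; exact add_mem hx hz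
  | smul r x _ hx =>
    rw [hsl, mul_smul_comm]
    exact Submodule.smul_mem _ _ hx

/-- Replacing `x` by `ζx` does not change the product, and `ζx` maps `L` into `L_v`; so both
factors, hence the product, lie in the local order. -/
theorem isIntegralAt_of_mem_latticeStab [Algebra.IsQuadraticExtension F E] {c : ℕ}
    (hc : ∀ x ∈ L, ∀ y ∈ L, IsIntegral ℤ ((c : E) * D.form x y)) {x : D.G}
    {ζ : (v.adicCompletion F ⊗[F] V) ≃ₗ[v.adicCompletion F] (v.adicCompletion F ⊗[F] V)}
    (hζ : ζ ∈ D.localZ v) (hx : ζ * D.toLocal v x ∈ D.latticeStab v L) (s : 𝓞 F)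
    {p q r t : V} (hp : p ∈ L) (hq : q ∈ L) (hr : r ∈ L) (ht : t ∈ L) :
    IsIntegralAt v D (algebraMap F E s * ((c * D.form ((x : V ≃ₗ[E] V) p) q) *
      (c * D.form r ((x : V ≃ₗ[E] V) t)))) := by
  refine IsIntegralAt.of_mem_localOrder v D ?_
  have hmem : ∀ {p : V}, p ∈ L → ζ (D.toLocal v x (1 ⊗ₜ p)) ∈ localLattice v (L : Set V) := by
    intro p hp
    have h1 : (ζ * D.toLocal v x : v.adicCompletion F ⊗[F] V → v.adicCompletion F ⊗[F] V)
        (1 ⊗ₜ p) ∈ (localLattice v (L : Set V) : Set (v.adicCompletion F ⊗[F] V)) := by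
      rw [← hx.2]
      exact ⟨_, one_tmul_mem_localLattice v hp, rfl⟩
    exact h1
  have h1 := D.smul_localForm_mem_localOrder v hc (hmem hp) (one_tmul_mem_localLattice v hq)
  have h2 := D.smul_localForm_mem_localOrder v hc (one_tmul_mem_localLattice v hr) (hmem ht)
  have h3 := mul_mem_localOrder v h1 h2
  have h4 : (1 : v.adicCompletion F) ⊗ₜ[F] algebraMap F E s ∈ localOrder E v :=
    one_tmul_mem_localOrder v (IsIntegral.algebraMap s.2)
  have h5 := mul_mem_localOrder v h4 h3
  have h6 := D.localForm_mul_localForm_of_mem_localZ v hζ (D.toLocal v x (1 ⊗ₜ p)) (1 ⊗ₜ q)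
    (1 ⊗ₜ r) (D.toLocal v x (1 ⊗ₜ t))
  rw [mul_mul_mul_comm, h6, toLocal_one_tmul, toLocal_one_tmul, localForm_tmul,
    localForm_tmul] at h5
  simp only [Algebra.TensorProduct.tmul_mul_tmul, one_mul] at h5
  rwa [mul_mul_mul_comm]

variable {v D} in
/-- The elements of a double coset at a split place have integral entries at one of the two places
above `v`, and their inverses become so after multiplication by `s`. -/
theorem SplitFrame.doubleCoset_mem (f : D.SplitFrame v L) {a : Fin 3 → ℕ}
    {g : (v.adicCompletion F ⊗[F] V) ≃ₗ[v.adicCompletion F] (v.adicCompletion F ⊗[F] V)}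
    (hg : g ∈ f.doubleCoset a) {s : 𝓞 F} (hs : s ∈ v.asIdeal ^ (a 0 + a 1 + a 2))
    {p : v.adicCompletion F ⊗[F] V} (hp : p ∈ localLattice v (L : Set V)) (i : Fin 3) :
    (f.ι (g p)).1 i ∈ v.adicCompletionIntegers F ∧
      algebraMap F (v.adicCompletion F) s * (f.ι (g p)).2 i ∈ v.adicCompletionIntegers F := by
  obtain ⟨hgG, ϖ, k, k', hϖ, hgk⟩ := hg
  obtain ⟨hp1, hp2⟩ := (f.lattice p).1 hp
  set N : Matrix (Fin 3) (Fin 3) (v.adicCompletionIntegers F) :=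
    (k : Matrix (Fin 3) (Fin 3) (v.adicCompletionIntegers F)) *
      Matrix.diagonal (fun i => ϖ ^ a i) *
      (k' : Matrix (Fin 3) (Fin 3) (v.adicCompletionIntegers F)) with hN
  set ι₀ := algebraMap (v.adicCompletionIntegers F) (v.adicCompletion F) with hι₀
  have hmul : ∀ (P : Matrix (Fin 3) (Fin 3) (v.adicCompletionIntegers F))
      (w : Fin 3 → v.adicCompletion F), (∀ i, w i ∈ v.adicCompletionIntegers F) →
      ∀ i, (P.map ι₀ *ᵥ w) i ∈ v.adicCompletionIntegers F := fun P w hw i => by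
    rw [Matrix.mulVec, dotProduct]
    exact sum_mem fun j _ => mul_mem (P i j).2 (hw j)
  refine ⟨by rw [hgk]; exact hmul N _ hp1 i, ?_⟩
  -- Invariance of the pairing: on the second component `g` acts by the inverse transpose of `N`.
  have hT : (N.map ι₀)ᵀ *ᵥ (f.ι (g p)).2 = (f.ι p).2 := by
    ext j
    have h1 := f.form_fst (g (f.ι.symm (Pi.single j 1, 0))) (g p)
    rw [hgG.2, f.form_fst, hgk, LinearEquiv.apply_symm_apply] at h1
    simp only [single_one_dotProduct] at h1
    rw [h1, Matrix.mulVec, Matrix.mulVec_single_one]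
    rfl
  -- The adjugate shows that `det N` clears the denominators of the inverse transpose.
  have hdet : ι₀ N.det * (f.ι (g p)).2 i ∈ v.adicCompletionIntegers F := by
    have h1 : (Nᵀ.adjugate.map ι₀) *ᵥ ((N.map ι₀)ᵀ *ᵥ (f.ι (g p)).2) =
        ι₀ N.det • (f.ι (g p)).2 := by
      have h2 : Nᵀ.adjugate.map ι₀ * (N.map ι₀)ᵀ = ι₀ N.det • 1 := by
        rw [← Matrix.transpose_map, ← Matrix.map_mul, Matrix.adjugate_mul, Matrix.det_transpose]
        ext i j
        simp [Matrix.one_apply, apply_ite ι₀]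
      rw [Matrix.mulVec_mulVec, h2, Matrix.smul_mulVec, Matrix.one_mulVec]
    have h3 := hmul Nᵀ.adjugate _ hp2 i
    rw [← hT, h1] at h3
    exact h3
  obtain ⟨o, ho⟩ := exists_algebraMap_eq_pow_mul v hs hϖ
  -- Up to a unit, `det N` is the power of `ϖ` with exponent `a 0 + a 1 + a 2`, and this power
  -- divides `s`.
  have hdvd : N.det ∣ ϖ ^ (a 0 + a 1 + a 2) * o := by
    have hk : IsUnit (k : Matrix (Fin 3) (Fin 3) (v.adicCompletionIntegers F)).det :=
      (Matrix.isUnit_iff_isUnit_det _).1 k.isUnit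
    have hk' : IsUnit (k' : Matrix (Fin 3) (Fin 3) (v.adicCompletionIntegers F)).det :=
      (Matrix.isUnit_iff_isUnit_det _).1 k'.isUnit
    rw [hN, Matrix.det_mul, Matrix.det_mul, Matrix.det_diagonal, Fin.prod_univ_three,
      ← pow_add, ← pow_add, hk'.mul_right_dvd, hk.mul_left_dvd]
    exact dvd_mul_right _ _
  obtain ⟨o', ho'⟩ := hdvd
  have hs' : algebraMap F (v.adicCompletion F) s = ι₀ o' * ι₀ N.det := by
    rw [ho, ho', mul_comm]
    rfl
  rw [hs', mul_assoc]
  exact mul_mem o'.2 hdet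

/-- At each of the two places above `v`, one factor involves `ζx` on `V_w`, where it is integral,
and the other on `V_{w'}`, where `s` makes it integral. Hence a single `s` serves for the product,
and this leads to the exponent `κ ≪ n⁻¹`. -/
theorem isIntegralAt_of_mem_doubleCoset (c : ℕ) {x : D.G}
    {ζ : (v.adicCompletion F ⊗[F] V) ≃ₗ[v.adicCompletion F] (v.adicCompletion F ⊗[F] V)}
    (hζ : ζ ∈ D.localZ v) (f : D.SplitFrame v L) {a : Fin 3 → ℕ}
    (hx : ζ * D.toLocal v x ∈ f.doubleCoset a)
    {s : 𝓞 F} (hs : s ∈ v.asIdeal ^ (a 0 + a 1 + a 2))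
    {p q r t : V} (hp : p ∈ L) (hq : q ∈ L) (hr : r ∈ L) (ht : t ∈ L) :
    IsIntegralAt v D (algebraMap F E s * ((c * D.form ((x : V ≃ₗ[E] V) p) q) *
      (c * D.form r ((x : V ≃ₗ[E] V) t)))) := by
  have hdot : ∀ {u w : Fin 3 → v.adicCompletion F}, (∀ i, u i ∈ v.adicCompletionIntegers F) →
      (∀ i, w i ∈ v.adicCompletionIntegers F) → u ⬝ᵥ w ∈ v.adicCompletionIntegers F :=
    fun hu hw => sum_mem fun i _ => mul_mem (hu i) (hw i)
  have h6 := D.localForm_mul_localForm_of_mem_localZ v hζ (D.toLocal v x (1 ⊗ₜ p)) (1 ⊗ₜ q)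
    (1 ⊗ₜ r) (D.toLocal v x (1 ⊗ₜ t))
  have hgp := fun i => f.doubleCoset_mem hx hs (one_tmul_mem_localLattice v hp) i
  have hgt := fun i => f.doubleCoset_mem hx hs (one_tmul_mem_localLattice v ht) i
  have hq' := (f.lattice _).1 (one_tmul_mem_localLattice v hq)
  have hr' := (f.lattice _).1 (one_tmul_mem_localLattice v hr)
  have hcc : ∀ θ : E →ₐ[F] v.adicCompletion F,
      θ (algebraMap F E s * ((c * D.form ((x : V ≃ₗ[E] V) p) q) *
        (c * D.form r ((x : V ≃ₗ[E] V) t)))) =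
      ((c : v.adicCompletion F) * c) * (algebraMap F (v.adicCompletion F) s *
        Algebra.TensorProduct.lift (Algebra.ofId (v.adicCompletion F) (v.adicCompletion F)) θ
          (fun _ _ => Commute.all _ _)
          (D.localForm v (D.toLocal v x (1 ⊗ₜ p)) (1 ⊗ₜ q) *
            D.localForm v (1 ⊗ₜ r) (D.toLocal v x (1 ⊗ₜ t)))) := by
    intro θ
    rw [toLocal_one_tmul, toLocal_one_tmul, localForm_tmul, localForm_tmul,
      Algebra.TensorProduct.tmul_mul_tmul, Algebra.TensorProduct.lift_tmul]
    simp only [map_mul, AlgHom.commutes, map_natCast, map_one, one_mul]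
    ring
  have hcO : (c : v.adicCompletion F) * c ∈ v.adicCompletionIntegers F :=
    mul_mem (natCast_mem _ c) (natCast_mem _ c)
  refine IsIntegralAt.of_split v D f.ψ ?_ ?_
  · rw [hcc, ← h6, map_mul, f.form_fst, f.form_fst]
    refine mul_mem hcO ?_
    have h7 : algebraMap F (v.adicCompletion F) s *
        ((f.ι (ζ (D.toLocal v x (1 ⊗ₜ p)))).1 ⬝ᵥ (f.ι (1 ⊗ₜ q)).2 *
          ((f.ι (1 ⊗ₜ r)).1 ⬝ᵥ (f.ι (ζ (D.toLocal v x (1 ⊗ₜ t)))).2)) =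
        (f.ι (ζ (D.toLocal v x (1 ⊗ₜ p)))).1 ⬝ᵥ (f.ι (1 ⊗ₜ q)).2 *
          ((f.ι (1 ⊗ₜ r)).1 ⬝ᵥ (algebraMap F (v.adicCompletion F) s •
            (f.ι (ζ (D.toLocal v x (1 ⊗ₜ t)))).2)) := by
      rw [dotProduct_smul, smul_eq_mul]
      ring
    rw [h7]
    exact mul_mem (hdot (fun i => (hgp i).1) hq'.2) (hdot hr'.1 fun i => (hgt i).2)
  · have h8 := hcc (f.ψ.comp D.conj)
    rw [AlgHom.comp_apply] at h8
    rw [h8, ← h6, map_mul, f.form_snd, f.form_snd]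
    refine mul_mem hcO ?_
    have h7 : algebraMap F (v.adicCompletion F) s *
        ((f.ι (1 ⊗ₜ q)).1 ⬝ᵥ (f.ι (ζ (D.toLocal v x (1 ⊗ₜ p)))).2 *
          ((f.ι (ζ (D.toLocal v x (1 ⊗ₜ t)))).1 ⬝ᵥ (f.ι (1 ⊗ₜ r)).2)) =
        ((f.ι (1 ⊗ₜ q)).1 ⬝ᵥ (algebraMap F (v.adicCompletion F) s •
            (f.ι (ζ (D.toLocal v x (1 ⊗ₜ p)))).2)) *
          ((f.ι (ζ (D.toLocal v x (1 ⊗ₜ t)))).1 ⬝ᵥ (f.ι (1 ⊗ₜ r)).2) := by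
      rw [dotProduct_smul, smul_eq_mul]
      ring
    rw [h7]
    exact mul_mem (hdot hq'.1 fun i => (hgp i).2) (hdot (fun i => (hgt i).1) hr'.2)

theorem isIntegral_of_memHecke [Nontrivial V] [Algebra.IsQuadraticExtension F E] {c : ℕ}
    (hc : ∀ x ∈ L, ∀ y ∈ L, IsIntegral ℤ ((c : E) * D.form x y)) (𝓛 : D.Level L)
    {𝔫 : Fin 3 → Ideal (𝓞 F)} {x : D.G} (hx : 𝓛.MemHecke 𝔫 x) {s : 𝓞 F}
    (hs : s ∈ 𝔫 0 * 𝔫 1 * 𝔫 2) {p q r t : V} (hp : p ∈ L) (hq : q ∈ L) (hr : r ∈ L)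
    (ht : t ∈ L) :
    IsIntegral ℤ (2 * (algebraMap F E s * ((c * D.form ((x : V ≃ₗ[E] V) p) q) *
      (c * D.form r ((x : V ≃ₗ[E] V) t))))) := by
  refine isIntegral_two_mul (D := D) fun v => ?_
  by_cases hv : v ∉ 𝓛.S ∧ IsSplitPlace v E
  · obtain ⟨ζ, hζ, hmem⟩ := hx.1 v hv.1 hv.2
    have hle : ∀ i, 𝔫 i ≤ v.asIdeal ^ multiplicity v.asIdeal (𝔫 i) := fun i =>
      Ideal.dvd_iff_le.1 (pow_multiplicity_dvd _ _)
    have hs' : s ∈ v.asIdeal ^ (multiplicity v.asIdeal (𝔫 0) + multiplicity v.asIdeal (𝔫 1) +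
        multiplicity v.asIdeal (𝔫 2)) := by
      rw [pow_add, pow_add]
      exact Ideal.mul_mono (Ideal.mul_mono (hle 0) (hle 1)) (hle 2) hs
    exact D.isIntegralAt_of_mem_doubleCoset v c hζ _ hmem hs' hp hq hr ht
  · obtain ⟨ζ, hζ, hmem⟩ := hx.2 v hv
    refine D.isIntegralAt_of_mem_latticeStab v hc hζ ?_ s hp hq hr ht
    by_cases hS : v ∈ 𝓛.S
    · exact 𝓛.K_stab v hS hmem
    · rw [← 𝓛.K_good v hS]
      exact hmem

/-- Products of matrix entries of a return and of its conjugate, or of its inverse, have bounded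
denominators. -/
theorem exists_nat_isIntegral_mat [FiniteDimensional E V] [Nontrivial V]
    [Algebra.IsQuadraticExtension F E] (hL : L.IsLattice E) (b : Module.Basis (Fin 3) E V) :
    ∃ c : ℕ, 0 < c ∧ ∀ (𝓛 : D.Level L) (𝔫 : Fin 3 → Ideal (𝓞 F)) (x : D.G), 𝓛.MemHecke 𝔫 x →
      ∀ s ∈ 𝔫 0 * 𝔫 1 * 𝔫 2, ∀ i j k l,
        IsIntegral ℤ ((c : E) * (algebraMap F E s * (D.mat b x i j * D.conj (D.mat b x k l)))) ∧
        IsIntegral ℤ ((c : E) * (algebraMap F E s * (D.mat b x i j * D.mat b x⁻¹ k l))) := by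
  obtain ⟨c, hc0, hc⟩ := D.exists_nat_mul_form_isIntegral hL.fg
  -- The dual basis for the form turns matrix entries of `x` into values `⟨x b_j, b'_i⟩`.
  choose b' hb' using fun i => D.exists_form_right_eq (b.coord i)
  have hmul : ∀ y : V, ∃ m : ℕ, 0 < m ∧ (m : E) • y ∈ L := by
    intro y
    have hy : y ∈ Submodule.span E (L : Set V) := hL.span_eq_top ▸ Submodule.mem_top
    induction hy using Submodule.span_induction with
    | mem y hy => exact ⟨1, one_pos, by simpa using hy⟩
    | zero => exact ⟨1, one_pos, by simp⟩
    | add y z _ _ hy hz =>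
      obtain ⟨m, hm, h1⟩ := hy
      obtain ⟨m', hm', h2⟩ := hz
      refine ⟨m * m', Nat.mul_pos hm hm', ?_⟩
      have h3 : ((m * m' : ℕ) : E) • (y + z) =
          (m' : 𝓞 E) • ((m : E) • y) + (m : 𝓞 E) • ((m' : E) • z) := by
        rw [← algebraMap_smul E (m' : 𝓞 E), ← algebraMap_smul E (m : 𝓞 E), map_natCast,
          map_natCast, smul_smul, smul_smul, ← mul_comm (m : E) (m' : E), ← smul_add, Nat.cast_mul]
      rw [h3]
      exact add_mem (L.smul_mem _ h1) (L.smul_mem _ h2)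
    | smul e y _ hy =>
      obtain ⟨m, hm, h1⟩ := hy
      obtain ⟨m', hm', h2⟩ := exists_nat_forall_isIntegral (Set.finite_singleton e)
      refine ⟨m' * m, Nat.mul_pos hm' hm, ?_⟩
      let o : 𝓞 E := ⟨_, h2 e rfl⟩
      have h3 : ((m' * m : ℕ) : E) • e • y = o • ((m : E) • y) := by
        rw [← algebraMap_smul E o]
        change _ = ((m' : E) * e) • _
        rw [smul_smul, smul_smul, Nat.cast_mul]
        congr 1
        ring
      rw [h3]
      exact L.smul_mem _ h1
  choose m hm hmL using hmul
  -- A common multiplier that brings all basis and dual basis vectors into `L`.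
  set d : ℕ := ∏ i, (m (b i) * m (b' i)) with hd
  have hd0 : 0 < d := Finset.prod_pos fun i _ => Nat.mul_pos (hm _) (hm _)
  have hdvd : ∀ y n, m y ∣ n → (n : E) • y ∈ L := by
    rintro y _ ⟨n, rfl⟩
    have h3 : ((m y * n : ℕ) : E) • y = (n : 𝓞 E) • ((m y : E) • y) := by
      rw [← algebraMap_smul E (n : 𝓞 E), map_natCast, smul_smul, Nat.cast_mul, mul_comm]
    rw [h3]
    exact L.smul_mem _ (hmL y)
  have hbL : ∀ i, (d : E) • b i ∈ L := fun i => hdvd _ _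
    ((dvd_mul_right _ _).trans (Finset.dvd_prod_of_mem (fun i => m (b i) * m (b' i))
      (Finset.mem_univ i)))
  have hbL' : ∀ i, (d : E) • b' i ∈ L := fun i => hdvd _ _
    ((dvd_mul_left _ _).trans (Finset.dvd_prod_of_mem (fun i => m (b i) * m (b' i))
      (Finset.mem_univ i)))
  have hd1 : D.conj (d : E) = d := map_natCast _ _
  have hmat : ∀ (x : D.G) i j, D.form ((x : V ≃ₗ[E] V) (b j)) (b' i) = D.mat b x i j := by
    intro x i j
    rw [hb', mat_apply]
    rfl
  -- Four vectors are scaled by `d`, two form values by `c`, and 2 comes from the local integrality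
  -- criterion.
  refine ⟨2 * (c * c * (d * d) * (d * d)), by positivity, fun 𝓛 𝔫 x hx s hs i j k l => ⟨?_, ?_⟩⟩
  · have h1 := D.isIntegral_of_memHecke hc 𝓛 hx hs (hbL j) (hbL' i) (hbL' k) (hbL l)
    simp only [map_smul, LinearMap.smul_apply, smul_eq_mul, form_smul_right, hd1] at h1
    have h2 : D.form (b' k) ((x : V ≃ₗ[E] V) (b l)) = D.conj (D.mat b x k l) := by
      rw [← hmat, D.hermitian]
    rw [hmat, h2] at h1
    convert h1 using 1
    push_cast
    ring
  · have h1 := D.isIntegral_of_memHecke hc 𝓛 hx hs (hbL j) (hbL' i) (hbL l) (hbL' k)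
    simp only [map_smul, LinearMap.smul_apply, smul_eq_mul, form_smul_right, hd1] at h1
    have h2 : D.form (b l) ((x : V ≃ₗ[E] V) (b' k)) = D.mat b x⁻¹ k l := by
      rw [← hmat, form_apply_left, inv_inv]
    rw [hmat, h2] at h1
    convert h1 using 1
    push_cast
    ring

end HermitianDatum

/-! ### Hecke returns commute -/

-- The product `fI` is a nonzero integral ideal, so its norm is a positive integer.
open scoped nonZeroDivisors in
theorem one_le_abs_norm_mul_absNorm {F : Type*} [Field F] [NumberField F] {I : Ideal (𝓞 F)}
    (hI : I ≠ ⊥) {f : F} (hf : f ≠ 0) (h : ∀ r ∈ I, IsIntegral ℤ (f * (r : F))) :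
    1 ≤ |Algebra.norm ℚ f| * Ideal.absNorm I := by
  have hle : FractionalIdeal.spanSingleton (𝓞 F)⁰ f * (I : FractionalIdeal (𝓞 F)⁰ F) ≤ 1 := by
    rw [FractionalIdeal.spanSingleton_mul_le_iff]
    intro z hz
    obtain ⟨r, hr, rfl⟩ := (FractionalIdeal.mem_coeIdeal _).1 hz
    exact (FractionalIdeal.mem_one_iff _).2 ⟨⟨_, h r hr⟩, rfl⟩
  obtain ⟨K, hK⟩ := FractionalIdeal.le_one_iff_exists_coeIdeal.1 hle
  have hnorm := congrArg FractionalIdeal.absNorm hK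
  rw [map_mul, FractionalIdeal.absNorm_span_singleton, FractionalIdeal.coeIdeal_absNorm,
    FractionalIdeal.coeIdeal_absNorm] at hnorm
  rw [← hnorm]
  have hK0 : K ≠ ⊥ := by
    rintro rfl
    have h0 : |Algebra.norm ℚ f| * (Ideal.absNorm I : ℚ) ≠ 0 :=
      mul_ne_zero (abs_ne_zero.2 (Algebra.norm_ne_zero_iff.2 hf))
        (Nat.cast_ne_zero.2 (Ideal.absNorm_ne_zero_iff_mem_nonZeroDivisors.2
          (mem_nonZeroDivisors_of_ne_zero hI)))
    rw [← hnorm] at h0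
    simp at h0
  exact_mod_cast Nat.one_le_iff_ne_zero.2 (Ideal.absNorm_ne_zero_iff_mem_nonZeroDivisors.2
    (mem_nonZeroDivisors_of_ne_zero hK0))

theorem exists_embedding_extension {F E : Type*} [Field F] [NumberField F] [Field E]
    [NumberField E] [Algebra F E] (σ : F →+* ℂ) :
    ∃ φ : E →+* ℂ, φ.comp (algebraMap F E) = σ := by
  let := σ.toAlgebra
  have : Algebra.IsAlgebraic F E := Algebra.IsAlgebraic.tower_top (K := ℚ) F
  let τ : E →ₐ[F] ℂ := IsAlgClosed.lift
  exact ⟨τ, τ.comp_algebraMap⟩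

/-- The norm is the product over all embeddings, one of which is singled out as small. As `1 ≤ B`,
the exponent may be the full degree. -/
theorem abs_norm_le {F : Type*} [Field F] [NumberField F] {f : F} (σ₀ : F →+* ℂ) {a B : ℝ}
    (hB : 1 ≤ B) (h₀ : ‖σ₀ f‖ ≤ a) (h : ∀ σ : F →+* ℂ, ‖σ f‖ ≤ B) :
    ((|Algebra.norm ℚ f| : ℚ) : ℝ) ≤ a * B ^ Module.finrank ℚ F := by
  classical
  have h1 := congrArg norm (Algebra.norm_eq_prod_embeddings ℚ ℂ f)
  rw [norm_prod] at h1
  have h2 : ‖algebraMap ℚ ℂ (Algebra.norm ℚ f)‖ = ((|Algebra.norm ℚ f| : ℚ) : ℝ) := by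
    rw [eq_ratCast, Complex.norm_ratCast, Rat.cast_abs]
  rw [← h2, h1, ← Finset.mul_prod_erase _ _ (Finset.mem_univ σ₀.toRatAlgHom)]
  have ha : 0 ≤ a := (norm_nonneg _).trans h₀
  refine mul_le_mul h₀ ?_ (Finset.prod_nonneg fun _ _ => norm_nonneg _) ha
  calc ∏ σ ∈ Finset.univ.erase σ₀.toRatAlgHom, ‖σ f‖
      ≤ ∏ _σ ∈ Finset.univ.erase σ₀.toRatAlgHom, B :=
        Finset.prod_le_prod (fun _ _ => norm_nonneg _) fun σ _ => h σ.toRingHom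
    _ = B ^ (Finset.univ.erase σ₀.toRatAlgHom).card := by rw [Finset.prod_const]
    _ ≤ B ^ Module.finrank ℚ F := by
        refine pow_le_pow_right₀ hB ((Finset.card_erase_le).trans ?_)
        rw [Finset.card_univ, AlgHom.card]

namespace HermitianDatum

variable {F E V : Type*} [Field F] [NumberField F] [Field E] [NumberField E] [Algebra F E]
  [AddCommGroup V] [Module E V] [Module F V] [IsScalarTower F E V] (D : HermitianDatum F E V)
  [Module (𝓞 E) V] [IsScalarTower (𝓞 E) E V] {L : Submodule (𝓞 E) V}
  [FiniteDimensional E V] [Nontrivial V]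
  [NumberField.IsTotallyReal F] [Algebra.IsQuadraticExtension F E]

/-- Each term in the expansion pairs an entry of `x` with a conjugated entry of `x`, and likewise
for `y`. Each pair uses one element of `I`, hence `I * I`. -/
theorem isIntegral_commutator_mul_conj (b : Module.Basis (Fin 3) E V) {c : ℕ} {I : Ideal (𝓞 F)}
    {x y : D.G}
    (hx : ∀ s ∈ I, ∀ i j k l,
      IsIntegral ℤ ((c : E) * (algebraMap F E s * (D.mat b x i j * D.conj (D.mat b x k l)))))
    (hy : ∀ s ∈ I, ∀ i j k l,
      IsIntegral ℤ ((c : E) * (algebraMap F E s * (D.mat b y i j * D.conj (D.mat b y k l)))))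
    {r : 𝓞 F} (hr : r ∈ I * I) (i j : Fin 3) :
    IsIntegral ℤ ((c : E) * c * (algebraMap F E r *
      ((D.mat b x * D.mat b y - D.mat b y * D.mat b x) i j *
        D.conj ((D.mat b x * D.mat b y - D.mat b y * D.mat b x) i j)))) := by
  induction hr using Submodule.mul_induction_on' with
  | mem_mul_mem s hs s' hs' =>
    have key : (c : E) * c * (algebraMap F E (s * s' : 𝓞 F) *
        ((D.mat b x * D.mat b y - D.mat b y * D.mat b x) i j *
          D.conj ((D.mat b x * D.mat b y - D.mat b y * D.mat b x) i j))) =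
        ∑ k, ∑ l, (
          ((c : E) * (algebraMap F E s * (D.mat b x i k * D.conj (D.mat b x i l)))) *
            ((c : E) * (algebraMap F E s' * (D.mat b y k j * D.conj (D.mat b y l j)))) -
          ((c : E) * (algebraMap F E s * (D.mat b x i k * D.conj (D.mat b x l j)))) *
            ((c : E) * (algebraMap F E s' * (D.mat b y k j * D.conj (D.mat b y i l)))) -
          ((c : E) * (algebraMap F E s * (D.mat b x k j * D.conj (D.mat b x i l)))) *
            ((c : E) * (algebraMap F E s' * (D.mat b y i k * D.conj (D.mat b y l j)))) +
          ((c : E) * (algebraMap F E s * (D.mat b x k j * D.conj (D.mat b x l j)))) *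
            ((c : E) * (algebraMap F E s' * (D.mat b y i k * D.conj (D.mat b y i l))))) := by
      simp only [Matrix.sub_apply, Matrix.mul_apply, Fin.sum_univ_three, map_sub, map_add, map_mul]
      ring
    rw [key]
    exact IsIntegral.sum _ fun k _ => IsIntegral.sum _ fun l _ =>
      ((((hx s hs _ _ _ _).mul (hy s' hs' _ _ _ _)).sub
        ((hx s hs _ _ _ _).mul (hy s' hs' _ _ _ _))).sub
        ((hx s hs _ _ _ _).mul (hy s' hs' _ _ _ _))).add
        ((hx s hs _ _ _ _).mul (hy s' hs' _ _ _ _))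
  | add r _ r' _ h h' =>
    have key : algebraMap F E ((r + r' : 𝓞 F) : F) = algebraMap F E r + algebraMap F E r' := by
      rw [← map_add]
      rfl
    rw [key, add_mul, mul_add]
    exact h.add h'

/-- A nonzero entry of the commutator would have a relative norm whose absolute norm is both `≫
n⁻²`, by the denominator bound, and `≪ κ²`, by smallness at `v₀`. -/
theorem exists_forall_isReturn_commute (hL : L.IsLattice E) (b : Module.Basis (Fin 3) E V)
    {Ω : Set G₀} (hΩ : IsCompact Ω) :
    ∃ C : ℝ, 0 < C ∧ C < 1 ∧ ∀ (𝓛 : D.Level L), ∀ g ∈ Ω, ∀ 𝔫 : Fin 3 → Ideal (𝓞 F),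
      (∀ i, 𝔫 i ≠ ⊥) → ∀ κ : ℝ, 0 < κ →
        κ ≤ C * ((Ideal.absNorm (𝔫 0 * 𝔫 1 * 𝔫 2) : ℕ) : ℝ)⁻¹ →
        ∀ x y : D.G, 𝓛.IsReturn g 𝔫 κ x → 𝓛.IsReturn g 𝔫 κ y → x * y = y * x := by
  obtain ⟨c, hc0, hc⟩ := D.exists_nat_isIntegral_mat hL b
  obtain ⟨B, hB0, hB⟩ := D.exists_norm_map_mat_le b hΩ
  obtain ⟨B', hB'0, hB'⟩ := D.exists_norm_φ₀_commutator_le b hΩ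
  set d := Module.finrank ℚ F
  set B₁ := 1 + (6 * B ^ 2) ^ 2 with hB₁
  -- Collects the cleared denominators `c²`, the squared smallness constant at `v₀` and the bound
  -- `B₁` at all embeddings: a nonzero entry forces `1 ≤ Q(κn)²`.
  set Q : ℝ := ((c : ℝ) * c) ^ d * (B' ^ 2 * B₁ ^ d) with hQ
  have hQ0 : 0 ≤ Q := by positivity
  -- This `C` is below 1, so `QC² ≤ QC < 1` contradicts `1 ≤ Q(κn)²`.
  refine ⟨1 / (2 * (1 + Q)), by positivity, ?_, fun 𝓛 g hg 𝔫 h𝔫 κ hκ hκn x y hx hy => ?_⟩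
  · rw [div_lt_one (by positivity)]
    linarith
  set I := 𝔫 0 * 𝔫 1 * 𝔫 2 with hI
  have hI0 : I ≠ ⊥ := mul_ne_zero (mul_ne_zero (h𝔫 0) (h𝔫 1)) (h𝔫 2)
  have hn1 : (1 : ℝ) ≤ Ideal.absNorm I := by
    exact_mod_cast Nat.one_le_iff_ne_zero.2 (Ideal.absNorm_ne_zero_iff_mem_nonZeroDivisors.2
      (mem_nonZeroDivisors_of_ne_zero hI0))
  set n : ℝ := (Ideal.absNorm I : ℝ) with hn
  have hn0 : 0 < n := by linarith
  have hC1 : 1 / (2 * (1 + Q)) ≤ 1 := by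
    rw [div_le_one (by positivity)]
    linarith
  have hκ1 : κ ≤ 1 := hκn.trans (mul_le_one₀ hC1 (inv_nonneg.2 hn0.le) (inv_le_one_of_one_le₀ hn1))
  obtain ⟨hxH, x₀, hx₀, hxZ, hxM⟩ := hx
  obtain ⟨hyH, y₀, hy₀, hyZ, hyM⟩ := hy
  refine mat_injective b ?_
  rw [mat_mul, mat_mul, ← sub_eq_zero]
  ext i j
  rw [Matrix.zero_apply]
  by_contra ht
  set t := (D.mat b x * D.mat b y - D.mat b y * D.mat b x) i j with ht_def
  obtain ⟨f, hf⟩ := D.exists_norm t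
  have hf0 : f ≠ 0 := by
    rintro rfl
    rw [map_zero, eq_comm, mul_eq_zero, map_eq_zero, or_self] at hf
    exact ht hf
  have hint : ∀ r ∈ I * I, IsIntegral ℤ ((c : F) * c * f * (r : F)) := by
    intro r hr
    have h1 := D.isIntegral_commutator_mul_conj b (fun s hs i j k l => (hc 𝓛 𝔫 x hxH s hs i j k l).1)
      (fun s hs i j k l => (hc 𝓛 𝔫 y hyH s hs i j k l).1) hr i j
    rw [← ht_def, ← hf] at h1
    refine (isIntegral_algebraMap_iff (algebraMap F E).injective).1 ?_
    convert h1 using 1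
    simp only [map_mul, map_natCast]
    ring
  have hcf : (c : F) * c * f ≠ 0 := by
    have : (c : F) ≠ 0 := Nat.cast_ne_zero.2 hc0.ne'
    exact mul_ne_zero (mul_ne_zero this this) hf0
  have h1 := one_le_abs_norm_mul_absNorm (mul_ne_zero hI0 hI0) hcf hint
  have hcnorm : Algebra.norm ℚ ((c : F) * c * f) = ((c : ℚ) * c) ^ d * Algebra.norm ℚ f := by
    have h2 : (c : F) * c = algebraMap ℚ F ((c : ℚ) * c) := by simp
    rw [map_mul, h2, Algebra.norm_algebraMap]
  have hbound : ∀ φ : E →+* ℂ, ‖φ t‖ ≤ 6 * B ^ 2 := by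
    intro φ
    have hprod : ∀ u w : D.G, (∀ i j, ‖φ (D.mat b u i j)‖ ≤ B) →
        (∀ i j, ‖φ (D.mat b w i j)‖ ≤ B) → ‖φ ((D.mat b u * D.mat b w) i j)‖ ≤ 3 * B ^ 2 := by
      intro u w hu hw
      rw [Matrix.mul_apply, map_sum]
      refine (norm_sum_le _ _).trans ?_
      calc ∑ k, ‖φ (D.mat b u i k * D.mat b w k j)‖ ≤ ∑ _k : Fin 3, B * B := by
            refine Finset.sum_le_sum fun k _ => ?_
            rw [map_mul, norm_mul]
            exact mul_le_mul (hu _ _) (hw _ _) (norm_nonneg _) hB0.le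
        _ = 3 * B ^ 2 := by simp; ring
    have hx1 := fun i j => (hB g hg x x₀ hx₀ hxZ φ i j).1
    have hy1 := fun i j => (hB g hg y y₀ hy₀ hyZ φ i j).1
    rw [ht_def, Matrix.sub_apply, map_sub]
    refine (norm_sub_le _ _).trans ?_
    linarith [hprod x y hx1 hy1, hprod y x hy1 hx1]
  have h2 := abs_norm_le (f := f) (D.φ₀.comp (algebraMap F E)) (a := (B' * κ) ^ 2) (B := B₁)
    (by rw [hB₁]; nlinarith [sq_nonneg (6 * B ^ 2)]) (by
      rw [RingHom.comp_apply, hf, map_mul, φ₀_conj, norm_mul, norm_star, pow_two]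
      have h3 := hB' g hg κ hκ hκ1 x y x₀ y₀ hx₀ hy₀ hxZ hyZ hxM hyM i j
      exact mul_le_mul h3 h3 (norm_nonneg _) (by positivity)) fun σ => by
    obtain ⟨φ, rfl⟩ := exists_embedding_extension (E := E) σ
    rw [RingHom.comp_apply, hf, map_mul, norm_mul]
    have h3 := hbound φ
    have h4 := hbound (φ.comp (D.conj : E →+* E))
    have h5 : ‖φ t‖ * ‖φ (D.conj t)‖ ≤ (6 * B ^ 2) * (6 * B ^ 2) :=
      mul_le_mul h3 h4 (norm_nonneg _) (by positivity)
    rw [hB₁]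
    linarith [pow_two (6 * B ^ 2)]
  have h3 : (1 : ℝ) ≤ ((c : ℝ) * c) ^ d * ((|Algebra.norm ℚ f| : ℚ) : ℝ) * (n * n) := by
    rw [hcnorm, abs_mul, abs_of_nonneg (by positivity : (0 : ℚ) ≤ ((c : ℚ) * c) ^ d), map_mul] at h1
    have h4 : ((1 : ℚ) : ℝ) ≤ ((((c : ℚ) * c) ^ d * |Algebra.norm ℚ f| *
        ((Ideal.absNorm I * Ideal.absNorm I : ℕ) : ℚ) : ℚ) : ℝ) := by exact_mod_cast h1
    push_cast at h4
    rw [hn]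
    push_cast
    exact h4
  have h4 : κ * n ≤ 1 / (2 * (1 + Q)) := by
    calc κ * n ≤ 1 / (2 * (1 + Q)) * n⁻¹ * n := mul_le_mul_of_nonneg_right hκn hn0.le
      _ = _ := by rw [mul_assoc, inv_mul_cancel₀ hn0.ne', mul_one]
  have h5 : (1 : ℝ) ≤ Q * (κ * n) ^ 2 := by
    calc (1 : ℝ) ≤ ((c : ℝ) * c) ^ d * ((|Algebra.norm ℚ f| : ℚ) : ℝ) * (n * n) := h3
      _ ≤ ((c : ℝ) * c) ^ d * ((B' * κ) ^ 2 * B₁ ^ d) * (n * n) := by gcongr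
      _ = Q * (κ * n) ^ 2 := by rw [hQ]; ring
  have h6 : Q * (κ * n) ^ 2 ≤ Q * (1 / (2 * (1 + Q))) := by
    refine mul_le_mul_of_nonneg_left ?_ hQ0
    nlinarith [mul_nonneg hκ.le hn0.le]
  have h7 : Q * (1 / (2 * (1 + Q))) < 1 := by
    rw [mul_one_div, div_lt_one (by positivity)]
    linarith
  linarith

end HermitianDatum

/-! ### Counting numbers of bounded size and bounded denominators -/

theorem finite_and_ncard_le {α : Type*} {T : Set α} {M : ℝ}
    (h : ∀ s : Finset α, (s : Set α) ⊆ T → (s.card : ℝ) ≤ M) :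
    T.Finite ∧ (T.ncard : ℝ) ≤ M := by
  have hfin : T.Finite := by
    by_contra hinf
    obtain ⟨s, hs, hcard⟩ := Set.Infinite.exists_subset_card_eq hinf (⌊M⌋₊ + 1)
    have h1 := h s hs
    rw [hcard] at h1
    push_cast at h1
    linarith [Nat.lt_floor_add_one M]
  refine ⟨hfin, ?_⟩
  rw [Set.ncard_eq_toFinset_card T hfin]
  exact h _ (by simp)

/-- Bernoulli's inequality. It handles the exponents of the primes of small norm in the divisor
bound. -/
theorem add_one_le_two_pow_rpow {ε : ℝ} (hε : 0 < ε) :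
    ∃ A : ℝ, 1 ≤ A ∧ ∀ k : ℕ, (k : ℝ) + 1 ≤ A * ((2 : ℝ) ^ ε) ^ k := by
  have h2 : 1 < (2 : ℝ) ^ ε := Real.one_lt_rpow one_lt_two hε
  set a := (2 : ℝ) ^ ε - 1 with ha
  have ha0 : 0 < a := by linarith
  refine ⟨1 + a⁻¹, by linarith [inv_pos.2 ha0], fun k => ?_⟩
  have h3 : 1 + (k : ℝ) * a ≤ ((2 : ℝ) ^ ε) ^ k := by
    have := one_add_mul_le_pow (a := a) (by linarith) k
    rwa [ha, add_sub_cancel] at this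
  have hk : (0 : ℝ) ≤ k := Nat.cast_nonneg k
  calc (k : ℝ) + 1 ≤ (1 + a⁻¹) * (1 + k * a) := by
        have h4 : a⁻¹ * a = 1 := inv_mul_cancel₀ ha0.ne'
        have : (1 + a⁻¹) * (1 + k * a) = 1 + k * a + a⁻¹ + k * (a⁻¹ * a) := by ring
        rw [this, h4]
        have := inv_pos.2 ha0
        nlinarith [mul_nonneg hk ha0.le]
    _ ≤ _ := by
        refine mul_le_mul_of_nonneg_left h3 ?_
        linarith [inv_pos.2 ha0]

/-! ### The divisor bound for ideals -/

section Divisors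

open UniqueFactorizationMonoid

theorem two_le_absNorm_of_prime {K : Type*} [Field K] [NumberField K] {P : Ideal (𝓞 K)}
    (hP : Prime P) : 2 ≤ Ideal.absNorm P := by
  have h0 : Ideal.absNorm P ≠ 0 := Ideal.absNorm_ne_zero_iff_mem_nonZeroDivisors.2
    (mem_nonZeroDivisors_of_ne_zero hP.ne_zero)
  have h1 : Ideal.absNorm P ≠ 1 := fun h => hP.not_isUnit (Ideal.isUnit_iff.2 (Ideal.absNorm_eq_one_iff.1 h))
  omega

/-- The number of prime ideals of bounded norm is bounded in terms of the degree. -/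
theorem card_le_of_absNorm_le {K : Type*} [Field K] [NumberField K] {d X : ℕ}
    (hd : Module.finrank ℚ K ≤ d) {W : Finset (Ideal (𝓞 K))} (hW : ∀ P ∈ W, Prime P)
    (hX : ∀ P ∈ W, Ideal.absNorm P ≤ X) : W.card ≤ X.factorial ^ d := by
  -- A prime contains its norm, and this divides `X!`. Hence all these primes divide `X!`, and
  -- comparison of norms bounds their number.
  have hdvd : ∏ P ∈ W, P ∣ Ideal.span {(X.factorial : 𝓞 K)} := by
    refine Finset.prod_primes_dvd _ hW fun P hP => ?_
    rw [Ideal.dvd_span_singleton]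
    have h1 : Ideal.absNorm P ∣ X.factorial := Nat.dvd_factorial
      (by have := two_le_absNorm_of_prime (hW P hP); omega) (hX P hP)
    obtain ⟨k, hk⟩ := h1
    rw [hk, Nat.cast_mul]
    exact P.mul_mem_right _ (Ideal.absNorm_mem P)
  have h2 := map_dvd Ideal.absNorm hdvd
  have h3 : Ideal.absNorm (Ideal.span {(X.factorial : 𝓞 K)}) =
      X.factorial ^ Module.finrank ℚ K := by
    rw [Ideal.absNorm_span_singleton, Algebra.norm_natCast, RingOfIntegers.rank]
    simp
  rw [h3, map_prod] at h2
  have h4 : 2 ^ W.card ≤ X.factorial ^ d := by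
    calc 2 ^ W.card = ∏ _P ∈ W, 2 := by rw [Finset.prod_const]
      _ ≤ ∏ P ∈ W, Ideal.absNorm P := Finset.prod_le_prod' fun P hP =>
          two_le_absNorm_of_prime (hW P hP)
      _ ≤ X.factorial ^ Module.finrank ℚ K :=
          Nat.le_of_dvd (pow_pos (Nat.factorial_pos X) _) h2
      _ ≤ X.factorial ^ d := Nat.pow_le_pow_right (Nat.factorial_pos X) hd
  exact (Nat.lt_two_pow_self).le.trans h4

/-- The divisor bound for ideals, uniform in number fields of bounded degree. -/
theorem exists_card_divisors_le (d : ℕ) {ε : ℝ} (hε : 0 < ε) :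
    ∃ B : ℝ, 0 < B ∧ ∀ (K : Type) [Field K] [NumberField K], Module.finrank ℚ K ≤ d →
      ∀ I : Ideal (𝓞 K), I ≠ ⊥ → ∀ s : Finset (Ideal (𝓞 K)), (∀ J ∈ s, J ∣ I) →
        (s.card : ℝ) ≤ B * (Ideal.absNorm I : ℝ) ^ ε := by
  classical
  obtain ⟨A, hA1, hA⟩ := add_one_le_two_pow_rpow hε
  -- Above this threshold `N(P)^ε ≥ 2`, so `k + 1 ≤ 2 ^ k` suffices. The boundedly many primes below
  -- it each cost a factor `A`.
  set X : ℕ := ⌈(2 : ℝ) ^ (1 / ε)⌉₊ with hX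
  refine ⟨A ^ (X.factorial ^ d), by positivity, fun K _ _ hK I hI s hs => ?_⟩
  have hinj : s.card ≤ (Finset.Iic (normalizedFactors I)).card := by
    refine Finset.card_le_card_of_injOn normalizedFactors (fun J hJ => ?_) fun J hJ J' hJ' h => ?_
    · rw [Finset.mem_coe, Finset.mem_Iic]
      exact (dvd_iff_normalizedFactors_le_normalizedFactors
        (ne_zero_of_dvd_ne_zero hI (hs J hJ)) hI).1 (hs J hJ)
    · rw [← Ideal.prod_normalizedFactors_eq_self (ne_zero_of_dvd_ne_zero hI (hs J hJ)), h,
        Ideal.prod_normalizedFactors_eq_self (ne_zero_of_dvd_ne_zero hI (hs J' hJ'))]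
  set N := normalizedFactors I with hN
  have hprime : ∀ P ∈ N.toFinset, Prime P := fun P hP =>
    prime_of_normalized_factor P (Multiset.mem_toFinset.1 hP)
  set W := N.toFinset.filter fun P => Ideal.absNorm P ≤ X with hW
  have hWcard : W.card ≤ X.factorial ^ d := card_le_of_absNorm_le hK
    (fun P hP => hprime P (Finset.mem_filter.1 hP).1) fun P hP => (Finset.mem_filter.1 hP).2
  have hnorm : (Ideal.absNorm I : ℝ) ^ ε =
      ∏ P ∈ N.toFinset, ((Ideal.absNorm P : ℝ) ^ ε) ^ N.count P := by
    have h1 : Ideal.absNorm I = ∏ P ∈ N.toFinset, Ideal.absNorm P ^ N.count P := by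
      conv_lhs => rw [← Ideal.prod_normalizedFactors_eq_self hI]
      rw [map_multiset_prod, Finset.prod_multiset_map_count]
    rw [h1, Nat.cast_prod, ← Real.finsetProd_rpow _ _ fun P _ => by positivity]
    refine Finset.prod_congr rfl fun P _ => ?_
    rw [Nat.cast_pow, ← Real.rpow_natCast_mul (Nat.cast_nonneg _), mul_comm,
      Real.rpow_mul_natCast (Nat.cast_nonneg _)]
  have hterm : ∀ P ∈ N.toFinset, ((N.count P + 1 : ℕ) : ℝ) ≤
      (if Ideal.absNorm P ≤ X then A else 1) * ((Ideal.absNorm P : ℝ) ^ ε) ^ N.count P := by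
    intro P hP
    push_cast
    split_ifs with h
    · refine (hA _).trans ?_
      have h2 : (2 : ℝ) ≤ Ideal.absNorm P := by exact_mod_cast two_le_absNorm_of_prime (hprime P hP)
      gcongr
    · rw [one_mul]
      have h2 : (2 : ℝ) ≤ (Ideal.absNorm P : ℝ) ^ ε := by
        have h3 : (2 : ℝ) ^ (1 / ε) ≤ Ideal.absNorm P :=
          (Nat.le_ceil _).trans (by exact_mod_cast (not_le.1 h).le)
        calc (2 : ℝ) = ((2 : ℝ) ^ (1 / ε)) ^ ε := by
              rw [← Real.rpow_mul zero_le_two, one_div_mul_cancel hε.ne', Real.rpow_one]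
          _ ≤ _ := by gcongr
      calc ((N.count P : ℕ) : ℝ) + 1 ≤ 2 ^ N.count P := by
            exact_mod_cast Nat.lt_two_pow_self (n := N.count P)
        _ ≤ _ := by gcongr
  calc (s.card : ℝ) ≤ ((Finset.Iic N).card : ℝ) := by exact_mod_cast hinj
    _ = ∏ P ∈ N.toFinset, ((N.count P + 1 : ℕ) : ℝ) := by rw [Multiset.card_Iic, Nat.cast_prod]
    _ ≤ ∏ P ∈ N.toFinset, ((if Ideal.absNorm P ≤ X then A else 1) *
          ((Ideal.absNorm P : ℝ) ^ ε) ^ N.count P) :=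
        Finset.prod_le_prod (fun _ _ => by positivity) hterm
    _ = A ^ W.card * (Ideal.absNorm I : ℝ) ^ ε := by
        rw [Finset.prod_mul_distrib, ← hnorm, ← Finset.prod_filter, Finset.prod_const]
    _ ≤ _ := by gcongr

end Divisors

/-- The number of algebraic integers of bounded degree and size is bounded. -/
theorem exists_card_isIntegral_le (d : ℕ) (B : ℝ) :
    ∃ N : ℕ, ∀ (K : Type) [Field K] [NumberField K], Module.finrank ℚ K ≤ d →
      ∀ s : Finset K, (∀ x ∈ s, IsIntegral ℤ x ∧ ∀ φ : K →+* ℂ, ‖φ x‖ ≤ B) → s.card ≤ N := by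
  classical
  let C := Nat.ceil (max B 1 ^ d * (2 : ℝ) ^ d)
  -- The integral minimal polynomials have bounded degree and coefficients, so the complex images
  -- lie in one finite set independent of `K`.
  have hfin := Polynomial.bUnion_roots_finite (algebraMap ℤ ℂ) d (Set.finite_Icc (-C : ℤ) C)
  refine ⟨hfin.toFinset.card, fun K _ _ hK s hs => ?_⟩
  obtain ⟨φ⟩ : Nonempty (K →+* ℂ) := inferInstance
  refine Finset.card_le_card_of_injOn φ (fun x hx => ?_) φ.injective.injOn
  obtain ⟨hxi, hxB⟩ := hs x hx
  rw [Set.Finite.coe_toFinset]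
  simp_rw [Set.mem_iUnion]
  have hmin := minpoly.isIntegrallyClosed_eq_field_fractions' ℚ hxi
  refine ⟨minpoly ℤ x, ⟨?_, fun i => ?_⟩, Polynomial.mem_rootSet.2 ⟨minpoly.ne_zero hxi, ?_⟩⟩
  · rw [← (minpoly.monic hxi).natDegree_map (algebraMap ℤ ℚ), ← hmin]
    exact (minpoly.natDegree_le x).trans hK
  · rw [Set.mem_Icc, ← abs_le, ← @Int.cast_le ℝ]
    refine (Eq.trans_le ?_ (Embeddings.coeff_bdd_of_norm_le hxB i)).trans
      (le_trans ?_ (Nat.le_ceil _))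
    · rw [hmin, Polynomial.coeff_map, eq_intCast, Int.norm_cast_rat, Int.norm_eq_abs, Int.cast_abs]
    · have h1 : ((Module.finrank ℚ K).choose (Module.finrank ℚ K / 2) : ℝ) ≤ (2 : ℝ) ^ d := by
        calc ((Module.finrank ℚ K).choose (Module.finrank ℚ K / 2) : ℝ)
            ≤ (2 : ℝ) ^ Module.finrank ℚ K := by exact_mod_cast Nat.choose_le_two_pow _ _
          _ ≤ _ := pow_le_pow_right₀ one_le_two hK
      have h2 : max B 1 ^ Module.finrank ℚ K ≤ max B 1 ^ d :=
        pow_le_pow_right₀ (le_max_right _ _) hK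
      gcongr
  · have h1 := minpoly.aeval ℤ x
    have h2 := congrArg φ h1
    rw [map_zero, Polynomial.aeval_def, Polynomial.hom_eval₂] at h2
    rwa [Polynomial.aeval_def, RingHom.ext_int (algebraMap ℤ ℂ) (φ.comp (algebraMap ℤ K))]

/-- The number of elements `r` of a number field of bounded degree, with `r` and `r⁻¹` of bounded
size and of denominators dividing `m`, is `O(m ^ ε)`. -/
theorem exists_card_le_rpow (d : ℕ) (B : ℝ) {ε : ℝ} (hε : 0 < ε) :
    ∃ A : ℝ, 0 < A ∧ ∀ (K : Type) [Field K] [NumberField K], Module.finrank ℚ K ≤ d →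
      ∀ m : ℕ, 0 < m → ∀ s : Finset K, (∀ r ∈ s, r ≠ 0 ∧ IsIntegral ℤ ((m : K) * r) ∧
        IsIntegral ℤ ((m : K) * r⁻¹) ∧ ∀ φ : K →+* ℂ, ‖φ r‖ ≤ B ∧ ‖φ r⁻¹‖ ≤ B) →
      (s.card : ℝ) ≤ A * (m : ℝ) ^ ε := by
  classical
  -- The ideal `(m²)` has norm `m ^ (2[K:ℚ])`, with exponent at most `2d`.
  obtain ⟨A, hA0, hA⟩ := exists_card_divisors_le d (ε := ε / (2 * (d + 1))) (by positivity)
  obtain ⟨N, hN⟩ := exists_card_isIntegral_le d (B * B)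
  refine ⟨(N + 1) * A, by positivity, fun K _ _ hK m hm s hs => ?_⟩
  have hm1 : (1 : ℝ) ≤ m := by exact_mod_cast hm
  have hmK : (m : K) ≠ 0 := Nat.cast_ne_zero.2 hm.ne'
  let o : ∀ x : K, IsIntegral ℤ x → 𝓞 K := fun x h => ⟨x, h⟩
  -- Sends `r` to the ideal `(mr)`; the value `⊤` is never used. The ideal divides `(m²)` because
  -- `mr · mr⁻¹ = m²`, and two elements of a fiber differ by a unit of bounded size.
  let f : K → Ideal (𝓞 K) := fun r =>
    if h : IsIntegral ℤ ((m : K) * r) then Ideal.span {o _ h} else ⊤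
  have hf : ∀ r (h : IsIntegral ℤ ((m : K) * r)), f r = Ideal.span {o _ h} :=
    fun r h => dif_pos h
  have hfib : ∀ J ∈ s.image f, (s.filter fun r => f r = J).card ≤ N := by
    intro J hJ
    obtain ⟨r₀, hr₀, rfl⟩ := Finset.mem_image.1 hJ
    obtain ⟨h0, hi, -, hφ⟩ := hs r₀ hr₀
    rw [← Finset.card_image_of_injective _ (mul_left_injective₀ (inv_ne_zero h0))]
    refine hN K hK _ fun x hx => ?_
    obtain ⟨r, hr, rfl⟩ := Finset.mem_image.1 hx
    obtain ⟨hrs, hrf⟩ := Finset.mem_filter.1 hr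
    obtain ⟨-, hri, -, hrφ⟩ := hs r hrs
    constructor
    · rw [hf r hri, hf r₀ hi] at hrf
      obtain ⟨u, hu⟩ := (Ideal.span_singleton_eq_span_singleton.1 hrf).symm
      have h1 : (m : K) * r₀ * (u : 𝓞 K) = m * r := congrArg (algebraMap (𝓞 K) K) hu
      have h2 : r * r₀⁻¹ = (u : 𝓞 K) := by
        rw [← div_eq_mul_inv, div_eq_iff h0]
        refine mul_left_cancel₀ hmK ?_
        rw [← h1]
        ring
      change IsIntegral ℤ (r * r₀⁻¹)
      rw [h2]
      exact (u : 𝓞 K).2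
    · intro φ
      change ‖φ (r * r₀⁻¹)‖ ≤ _
      rw [map_mul, norm_mul]
      exact mul_le_mul (hrφ φ).1 (hφ φ).2 (norm_nonneg _) ((norm_nonneg _).trans (hrφ φ).1)
  have hdvd : ∀ J ∈ s.image f, J ∣ Ideal.span {((m * m : ℕ) : 𝓞 K)} := by
    intro J hJ
    obtain ⟨r, hr, rfl⟩ := Finset.mem_image.1 hJ
    obtain ⟨h0, hi, hi', -⟩ := hs r hr
    rw [hf r hi]
    refine Ideal.dvd_span_singleton.2 (Ideal.mem_span_singleton.2 ⟨o _ hi', RingOfIntegers.ext ?_⟩)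
    change ((m * m : ℕ) : K) = (m : K) * r * (m * r⁻¹)
    push_cast
    rw [mul_mul_mul_comm, mul_inv_cancel₀ h0, mul_one]
  have hne : Ideal.span {((m * m : ℕ) : 𝓞 K)} ≠ ⊥ := by
    rw [Ne, Ideal.span_singleton_eq_bot]
    exact Nat.cast_ne_zero.2 (Nat.mul_pos hm hm).ne'
  have h1 := hA K hK _ hne _ hdvd
  have h2 : (Ideal.absNorm (Ideal.span {((m * m : ℕ) : 𝓞 K)}) : ℝ) ^ (ε / (2 * (d + 1))) ≤
      (m : ℝ) ^ ε := by
    rw [Ideal.absNorm_span_singleton, Algebra.norm_natCast, RingOfIntegers.rank]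
    have h3 : (((((m * m : ℕ) : ℤ) ^ Module.finrank ℚ K).natAbs : ℕ) : ℝ) =
        (m : ℝ) ^ (2 * Module.finrank ℚ K) := by
      rw [← Nat.cast_pow, Int.natAbs_natCast]
      push_cast
      rw [← pow_two, pow_mul]
    rw [h3, ← Real.rpow_natCast, ← Real.rpow_mul (by positivity)]
    refine Real.rpow_le_rpow_of_exponent_le hm1 ?_
    have hK' : (Module.finrank ℚ K : ℝ) ≤ d := by exact_mod_cast hK
    rw [mul_div_assoc', div_le_iff₀ (by positivity)]
    push_cast
    nlinarith
  calc (s.card : ℝ) ≤ ((N * (s.image f).card : ℕ) : ℝ) := by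
        exact_mod_cast Finset.card_le_mul_card_image s N hfib
    _ = N * ((s.image f).card : ℝ) := by push_cast; ring
    _ ≤ (N + 1) * (A * (m : ℝ) ^ ε) := by
        refine mul_le_mul (by linarith) (h1.trans ?_) (Nat.cast_nonneg _) (by positivity)
        gcongr
    _ = _ := by ring

/-! ### Characters of commutative algebras of endomorphisms -/

/-- If the products of `m` with the entries of `X` and `Y` are integral, so are the products of
`m` with the eigenvalues. -/
theorem isIntegral_mul_of_mulVec_eq {K ι : Type*} [Field K] [Fintype ι] {X Y : Matrix ι ι K}
    {m a a' : K} (h : ∀ i j k l, IsIntegral ℤ (m * (X i j * Y k l))) {w w' : ι → K} (hw : w ≠ 0)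
    (hw' : w' ≠ 0) (hX : X *ᵥ w = a • w) (hY : Y *ᵥ w' = a' • w') :
    IsIntegral ℤ (m * (a * a')) := by
  -- Multiplication by `m * (a * a')` preserves this nonzero finitely generated module, so that
  -- number is integral.
  let N : Submodule (integralClosure ℤ K) K :=
    Submodule.span _ (Set.range fun p : ι × ι => w p.1 * w' p.2)
  obtain ⟨i, hi⟩ := Function.ne_iff.1 hw
  obtain ⟨k, hk⟩ := Function.ne_iff.1 hw'
  have hN : N ≠ ⊥ := fun h0 => by
    have hmem : w i * w' k ∈ N := Submodule.subset_span ⟨(i, k), rfl⟩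
    rw [h0, Submodule.mem_bot] at hmem
    exact mul_ne_zero hi hk hmem
  have hfg : N.FG := Submodule.fg_span (Set.finite_range _)
  refine isIntegral_trans (A := integralClosure ℤ K) _
    (isIntegral_of_smul_mem_submodule N hN hfg _ fun x hx => ?_)
  induction hx using Submodule.span_induction with
  | mem x hx =>
    obtain ⟨⟨i, k⟩, rfl⟩ := hx
    have h1 := congrFun hX i
    have h2 := congrFun hY k
    simp only [Matrix.mulVec, dotProduct, Pi.smul_apply, smul_eq_mul] at h1 h2
    have h3 : (m * (a * a')) • (w i * w' k) =
        ∑ j, ∑ l, (⟨_, h i j k l⟩ : integralClosure ℤ K) • (w j * w' l) := by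
      calc (m * (a * a')) • (w i * w' k) = m * ((a * w i) * (a' * w' k)) := by
            rw [smul_eq_mul]; ring
        _ = _ := by
          rw [← h1, ← h2, Finset.sum_mul_sum, Finset.mul_sum]
          refine Finset.sum_congr rfl fun j _ => ?_
          rw [Finset.mul_sum]
          refine Finset.sum_congr rfl fun l _ => ?_
          rw [Subalgebra.smul_def, smul_eq_mul]
          ring
    rw [h3]
    exact sum_mem fun j _ => sum_mem fun l _ =>
      N.smul_mem _ (Submodule.subset_span ⟨(j, l), rfl⟩)
  | zero => rw [smul_zero]; exact zero_mem _
  | add x y _ _ hx hy => rw [smul_add]; exact add_mem hx hy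
  | smul c x _ hx => rw [smul_comm]; exact N.smul_mem _ hx

theorem norm_le_of_mulVec_eq {ι : Type*} [Fintype ι] {X : Matrix ι ι ℂ} {a : ℂ} {B : ℝ}
    (h : ∀ i j, ‖X i j‖ ≤ B) {w : ι → ℂ} (hw : w ≠ 0) (hX : X *ᵥ w = a • w) :
    ‖a‖ ≤ Fintype.card ι * B := by
  obtain ⟨i₀, hi₀⟩ := Function.ne_iff.1 hw
  obtain ⟨i, -, hi⟩ := Finset.exists_max_image Finset.univ (fun i => ‖w i‖) ⟨i₀, Finset.mem_univ _⟩
  have hpos : 0 < ‖w i‖ := (norm_pos_iff.2 hi₀).trans_le (hi i₀ (Finset.mem_univ _))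
  refine le_of_mul_le_mul_right ?_ hpos
  have h1 := congrFun hX i
  simp only [Matrix.mulVec, dotProduct, Pi.smul_apply, smul_eq_mul] at h1
  calc ‖a‖ * ‖w i‖ = ‖∑ j, X i j * w j‖ := by rw [h1, norm_mul]
    _ ≤ ∑ j, ‖X i j * w j‖ := norm_sum_le _ _
    _ ≤ ∑ _j : ι, B * ‖w i‖ := Finset.sum_le_sum fun j _ => by
        rw [norm_mul]
        exact mul_le_mul (h i j) (hi j (Finset.mem_univ _)) (norm_nonneg _)
          ((norm_nonneg _).trans (h i j))
    _ = _ := by rw [Finset.sum_const, nsmul_eq_mul, Finset.card_univ, mul_assoc]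

section Characters

variable {E V : Type*} [Field E] [AddCommGroup V] [Module E V]

/-- The value at `x` of a character of an algebra of endomorphisms is an eigenvalue of `x`. -/
theorem exists_mulVec_eq_of_algHom {ι K : Type*} [Fintype ι] [DecidableEq ι] [Field K] [Algebra E K]
    {H : Subalgebra E (Module.End E V)} (χ : H →ₐ[E] K) (b : Module.Basis ι E V) (x : H) :
    ∃ w : ι → K, w ≠ 0 ∧
      (LinearMap.toMatrix b b x.1).map (algebraMap E K) *ᵥ w = χ x • w := by
  set X := (LinearMap.toMatrix b b x.1).map (algebraMap E K) with hX
  -- By Cayley–Hamilton the characteristic polynomial kills `x`, hence it kills `χ x`.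
  have h1 : Polynomial.aeval x (LinearMap.toMatrix b b x.1).charpoly = 0 := by
    refine Subtype.ext ?_
    have : FiniteDimensional E V := Module.Finite.of_basis b
    rw [LinearMap.charpoly_toMatrix, ← Subalgebra.coe_val, ← Polynomial.aeval_algHom_apply]
    exact LinearMap.aeval_self_charpoly x.1
  have h2 : X.charpoly.IsRoot (χ x) := by
    rw [hX, Matrix.charpoly_map, Polynomial.IsRoot,
      Polynomial.eval_map_algebraMap, Polynomial.aeval_algHom_apply, h1, map_zero]
  rw [Polynomial.IsRoot, Matrix.eval_charpoly] at h2
  obtain ⟨w, hw, h3⟩ := Matrix.exists_mulVec_eq_zero_iff.2 h2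
  refine ⟨w, hw, ?_⟩
  rw [Matrix.sub_mulVec, sub_eq_zero] at h3
  rw [← h3]
  ext i
  simp [Matrix.scalar_apply, Matrix.mulVec_diagonal]

end Characters

/-- Two characters of a finite algebra take values in a common field extension of bounded degree. -/
theorem exists_intermediateField {E Ω H : Type*} [Field E] [Field Ω] [Algebra E Ω] [Ring H]
    [Algebra E H] [FiniteDimensional E H] (χ χ' : H →ₐ[E] Ω) :
    ∃ K : IntermediateField E Ω, FiniteDimensional E K ∧
      Module.finrank E K ≤ Module.finrank E H * Module.finrank E H ∧
      (∀ x, χ x ∈ K) ∧ ∀ x, χ' x ∈ K := by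
  have key : ∀ χ : H →ₐ[E] Ω, ∃ K : IntermediateField E Ω, FiniteDimensional E K ∧
      Module.finrank E K ≤ Module.finrank E H ∧ ∀ x, χ x ∈ K := by
    intro χ
    have hfin : FiniteDimensional E χ.range := Module.Finite.range χ.toLinearMap
    let K : IntermediateField E Ω := χ.range.toIntermediateField fun x hx =>
      χ.range.inv_mem_of_algebraic (x := ⟨x, hx⟩) (by
        exact (IsIntegral.of_finite E (⟨x, hx⟩ : χ.range)).isAlgebraic.algHom χ.range.val)
    exact ⟨K, hfin, LinearMap.finrank_range_le χ.toLinearMap, fun x => ⟨x, rfl⟩⟩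
  obtain ⟨K, hK, hd, hχ⟩ := key χ
  obtain ⟨K', hK', hd', hχ'⟩ := key χ'
  exact ⟨K ⊔ K', inferInstance, (IntermediateField.finrank_sup_le K K').trans
    (Nat.mul_le_mul hd hd'), fun x => le_sup_left (α := IntermediateField E Ω) (hχ x),
    fun x => le_sup_right (α := IntermediateField E Ω) (hχ' x)⟩

/-- The minimal polynomial is separable with a single root, so it has degree 1. -/
theorem mem_range_algebraMap_of_forall_algHom_eq {E K Ω : Type*} [Field E] [CharZero E] [Field K]
    [Algebra E K] [FiniteDimensional E K] [Field Ω] [Algebra E Ω] [IsAlgClosed Ω] {a : K} {t : Ω}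
    (h : ∀ ψ : K →ₐ[E] Ω, ψ a = t) : ∃ e : E, algebraMap E K e = a := by
  have hint := Algebra.IsIntegral.isIntegral (R := E) a
  have h1 : (minpoly E a).rootSet Ω ⊆ {t} := by
    rw [← Algebra.IsAlgebraic.range_eval_eq_rootSet_minpoly]
    rintro _ ⟨ψ, rfl⟩
    exact h ψ
  have h2 : (minpoly E a).natDegree ≤ 1 := by
    rw [← Polynomial.card_rootSet_eq_natDegree (K := Ω)
      (Algebra.IsSeparable.isSeparable E a) (IsAlgClosed.splits _)]
    have := Set.card_le_card h1
    simpa using this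
  exact minpoly.natDegree_eq_one_iff.1 (le_antisymm h2 (minpoly.natDegree_pos hint))

/-- An element of a finite reduced algebra on which all characters agree is a scalar. -/
theorem exists_algebraMap_eq_of_forall_algHom_eq {E H Ω : Type*} [Field E] [CharZero E]
    [CommRing H] [Algebra E H] [FiniteDimensional E H] [IsReduced H] [Field Ω] [Algebra E Ω]
    [IsAlgClosed Ω] {u : H} (h : ∀ χ χ' : H →ₐ[E] Ω, χ u = χ' u) :
    ∃ e : E, algebraMap E H e = u := by
  have : IsArtinianRing H := IsArtinianRing.of_finite E H
  -- On each residue field `u` is a scalar. Comparing characters of different residue fields shows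
  -- that the scalars coincide, and `H` is the product of these fields.
  have key : ∀ I : MaximalSpectrum H, ∃ χ : H →ₐ[E] Ω, ∃ e : E,
      u - algebraMap E H e ∈ I.asIdeal ∧ χ u = algebraMap E Ω e := by
    intro I
    let := Ideal.Quotient.field I.asIdeal
    let q := Ideal.Quotient.mkₐ E I.asIdeal
    let ψ₀ : (H ⧸ I.asIdeal) →ₐ[E] Ω := IsAlgClosed.lift
    obtain ⟨e, he⟩ := mem_range_algebraMap_of_forall_algHom_eq (a := q u) (t := ψ₀ (q u))
      fun ψ => h (ψ.comp q) (ψ₀.comp q)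
    refine ⟨ψ₀.comp q, e, ?_, ?_⟩
    · rw [← Ideal.Quotient.eq_zero_iff_mem, map_sub, sub_eq_zero]
      exact he.symm
    · change ψ₀ (q u) = _
      rw [← he, AlgHom.commutes]
  rcases isEmpty_or_nonempty (MaximalSpectrum H) with hI | ⟨⟨I₀⟩⟩
  · have : Subsingleton H := (IsArtinianRing.equivPi H).injective.subsingleton
    exact ⟨0, Subsingleton.elim _ _⟩
  · obtain ⟨χ₀, e, he, hχ⟩ := key I₀
    refine ⟨e, (IsArtinianRing.equivPi H).injective (funext fun I => ?_)⟩
    obtain ⟨χ, e', he', hχ'⟩ := key I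
    have hee : e' = e := (algebraMap E Ω).injective (by rw [← hχ', ← hχ, h])
    rw [hee] at he'
    exact (Ideal.Quotient.eq.2 he').symm

/-! ### Counting Hecke returns -/

/-- `u` and `v` are mutually inverse endomorphisms, with entries of size at most `B` under all
complex embeddings and such that `m` clears the denominators of the products of an entry of `u` and
an entry of `v`. -/
structure IsBoundedPair {ι E V : Type*} [Field E] [AddCommGroup V] [Module E V] [Fintype ι]
    [DecidableEq ι] (b : Module.Basis ι E V) (m : ℕ) (B : ℝ) (u v : Module.End E V) : Prop where
  mul_eq_one : u * v = 1
  isIntegral : ∀ i j k l, IsIntegral ℤ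
    ((m : E) * (LinearMap.toMatrix b b u i j * LinearMap.toMatrix b b v k l))
  norm_le_left : ∀ (φ : E →+* ℂ) i j, ‖φ (LinearMap.toMatrix b b u i j)‖ ≤ B
  norm_le_right : ∀ (φ : E →+* ℂ) i j, ‖φ (LinearMap.toMatrix b b v i j)‖ ≤ B

/-! ### Counting through ratios of characters -/

section Pairs

variable {ι E V : Type*} [Field E] [NumberField E] [AddCommGroup V] [Module E V] [Fintype ι]
  [DecidableEq ι] (b : Module.Basis ι E V)

variable {b} in
theorem IsBoundedPair.isIntegral_and_norm_le {m : ℕ} {B : ℝ} {H : Subalgebra E (Module.End E V)}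
    {u v : H} (h : IsBoundedPair b m B u.1 v.1) {K : Type*} [Field K] [Algebra E K]
    (χ χ' : H →ₐ[E] K) :
    IsIntegral ℤ ((m : K) * (χ u * χ' v)) ∧ ∀ φ : K →+* ℂ,
      ‖φ (χ u * χ' v)‖ ≤ (Fintype.card ι * B) * (Fintype.card ι * B) := by
  obtain ⟨w, hw, hu⟩ := exists_mulVec_eq_of_algHom χ b u
  obtain ⟨w', hw', hv⟩ := exists_mulVec_eq_of_algHom χ' b v
  constructor
  · refine isIntegral_mul_of_mulVec_eq (fun i j k l => ?_) hw hw' hu hv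
    have := (h.isIntegral i j k l).map (algebraMap E K).toIntAlgHom
    simpa using this
  · intro φ
    have key : ∀ {X : Matrix ι ι E} {a : K} {w : ι → K}, (∀ (φ : E →+* ℂ) i j, ‖φ (X i j)‖ ≤ B) →
        w ≠ 0 → X.map (algebraMap E K) *ᵥ w = a • w → ‖φ a‖ ≤ Fintype.card ι * B := by
      intro X a w hX hw hXw
      refine norm_le_of_mulVec_eq (X := (X.map (algebraMap E K)).map φ) (w := φ ∘ w)
        (fun i j => hX (φ.comp (algebraMap E K)) i j) (fun h0 => hw (funext fun i => ?_)) ?_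
      · exact φ.injective (by simpa using congrFun h0 i)
      · ext i
        rw [← RingHom.map_mulVec, hXw]
        simp
    rw [map_mul, norm_mul]
    have h1 := key h.norm_le_left hw hu
    exact mul_le_mul h1 (key h.norm_le_right hw' hv) (norm_nonneg _) ((norm_nonneg _).trans h1)

/-- The values lie in a number field of bounded degree, and the inverse of `χ(u)χ'(v)` is
`χ(v)χ'(u)`. Both orders of the pair are required so that this inverse is bounded too. -/
theorem exists_card_image_le (d : ℕ) (B : ℝ) {ε : ℝ} (hε : 0 < ε) [Algebra E ℂ] :
    ∃ A : ℝ, 0 < A ∧ ∀ H : Subalgebra E (Module.End E V), Module.finrank E H ≤ d →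
      ∀ χ χ' : H →ₐ[E] ℂ, ∀ m : ℕ, 0 < m → ∀ s : Finset (H × H),
        (∀ p ∈ s, IsBoundedPair b m B p.1.1 p.2.1 ∧ IsBoundedPair b m B p.2.1 p.1.1) →
        ((s.image fun p => χ p.1 * χ' p.2).card : ℝ) ≤ A * (m : ℝ) ^ ε := by
  classical
  obtain ⟨A, hA0, hA⟩ := exists_card_le_rpow (Module.finrank ℚ E * (d * d))
    ((Fintype.card ι * B) * (Fintype.card ι * B)) hε
  refine ⟨A, hA0, fun H hH χ χ' m hm s hs => ?_⟩
  have : FiniteDimensional E V := Module.Finite.of_basis b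
  obtain ⟨K, hfin, hK, hχ, hχ'⟩ := exists_intermediateField χ χ'
  let α : H →ₐ[E] K := χ.codRestrict K.toSubalgebra hχ
  let α' : H →ₐ[E] K := χ'.codRestrict K.toSubalgebra hχ'
  have : NumberField K := NumberField.of_module_finite E K
  have hdeg : Module.finrank ℚ K ≤ Module.finrank ℚ E * (d * d) := by
    rw [← Module.finrank_mul_finrank ℚ E K]
    exact Nat.mul_le_mul le_rfl (hK.trans (Nat.mul_le_mul hH hH))
  have himage : (s.image fun p => χ p.1 * χ' p.2) =
      (s.image fun p => α p.1 * α' p.2).image K.val := by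
    rw [Finset.image_image]
    rfl
  rw [himage, Finset.card_image_of_injective _
    (show Function.Injective K.val from Subtype.val_injective)]
  refine hA K hdeg m hm _ fun r hr => ?_
  obtain ⟨p, hp, rfl⟩ := Finset.mem_image.1 hr
  obtain ⟨h1, h2⟩ := hs p hp
  have h12 : p.1 * p.2 = 1 := Subtype.ext h1.mul_eq_one
  have h21 : p.2 * p.1 = 1 := Subtype.ext h2.mul_eq_one
  have hmul : (α p.1 * α' p.2) * (α p.2 * α' p.1) = 1 := by
    rw [mul_mul_mul_comm, ← map_mul, ← map_mul, h12, h21, map_one, map_one, one_mul]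
  have hinv : (α p.1 * α' p.2)⁻¹ = α p.2 * α' p.1 := inv_eq_of_mul_eq_one_right hmul
  rw [hinv]
  exact ⟨left_ne_zero_of_mul_eq_one hmul, (h1.isIntegral_and_norm_le α α').1,
    (h2.isIntegral_and_norm_le α α').1, fun φ => ⟨(h1.isIntegral_and_norm_le α α').2 φ,
      (h2.isIntegral_and_norm_le α α').2 φ⟩⟩

/-- The family of ratios `χ(u)/χ'(u)` determines `u` up to a scalar, and there are at most `d²`
ratios, each with few possible values. -/
theorem exists_card_isBoundedPair_le (d : ℕ) (B : ℝ) {ε : ℝ} (hε : 0 < ε) (φ₀ : E →+* ℂ) :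
    ∃ A : ℝ, 0 < A ∧ ∀ H : Subalgebra E (Module.End E V), IsCommReduced H →
      Module.finrank E H ≤ d → ∀ m : ℕ, 0 < m → ∀ s : Finset (H × H),
        (∀ p ∈ s, IsBoundedPair b m B p.1.1 p.2.1 ∧ IsBoundedPair b m B p.2.1 p.1.1) →
        (∀ p ∈ s, ∀ q ∈ s, ∀ e : E, q.1 = e • p.1 → p = q) →
        (s.card : ℝ) ≤ A * (m : ℝ) ^ ε := by
  classical
  let := φ₀.toAlgebra
  obtain ⟨A, hA0, hA⟩ := exists_card_image_le b d B (ε := ε / (d * d + 1)) (by positivity)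
  refine ⟨(1 + A) ^ (d * d), by positivity, fun H hH hd m hm s hs hinj => ?_⟩
  have : FiniteDimensional E V := Module.Finite.of_basis b
  let := hH.commRing
  have := hH.isReduced
  let := Fintype.ofFinite (H →ₐ[E] ℂ)
  have hm1 : (1 : ℝ) ≤ m := by exact_mod_cast hm
  have hcard : Fintype.card (H →ₐ[E] ℂ) ≤ d := by
    rw [← Nat.card_eq_fintype_card]
    exact (card_algHom_le_finrank E H ℂ).trans hd
  let I := (H →ₐ[E] ℂ) × (H →ₐ[E] ℂ)
  let t : I → Finset ℂ := fun c => s.image fun p => c.1 p.1 * c.2 p.2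
  have hle : s.card ≤ (Fintype.piFinset t).card := by
    refine Finset.card_le_card_of_injOn (fun p c => c.1 p.1 * c.2 p.2) (fun p hp => ?_)
      fun p hp q hq hpq => ?_
    · exact Fintype.mem_piFinset.2 fun c => Finset.mem_image_of_mem _ hp
    · have hp1 : p.1 * p.2 = 1 := Subtype.ext (hs p hp).1.mul_eq_one
      have hq1 : q.1 * q.2 = 1 := Subtype.ext (hs q hq).1.mul_eq_one
      -- Equal ratios mean that all characters agree on the quotient `q.1 * p.2` of the two
      -- elements, which is therefore a scalar.
      obtain ⟨e, he⟩ := exists_algebraMap_eq_of_forall_algHom_eq (Ω := ℂ) (u := q.1 * p.2)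
        fun χ χ' => by
          have h1 : χ p.1 * χ' p.2 = χ q.1 * χ' q.2 := congrFun hpq (χ, χ')
          have h2 : χ p.1 * χ p.2 = 1 := by rw [← map_mul, hp1, map_one]
          have h3 : χ' q.1 * χ' q.2 = 1 := by rw [← map_mul, hq1, map_one]
          rw [map_mul, map_mul]
          linear_combination χ' q.1 * χ' p.2 * h2 - χ p.2 * χ' q.1 * h1 - χ q.1 * χ p.2 * h3
      refine hinj p hp q hq e ?_
      rw [Algebra.smul_def, he, mul_assoc, mul_comm p.2, hp1, mul_one]
  have hX : (1 : ℝ) ≤ (m : ℝ) ^ (ε / (d * d + 1)) := Real.one_le_rpow hm1 (by positivity)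
  have hX' : (1 : ℝ) ≤ (1 + A) * (m : ℝ) ^ (ε / (d * d + 1)) := by nlinarith
  have hI : Fintype.card I ≤ d * d := by
    rw [Fintype.card_prod]
    exact Nat.mul_le_mul hcard hcard
  calc (s.card : ℝ) ≤ ((Fintype.piFinset t).card : ℝ) := by exact_mod_cast hle
    _ = ∏ c, ((t c).card : ℝ) := by rw [Fintype.card_piFinset, Nat.cast_prod]
    _ ≤ ∏ _c : I, (1 + A) * (m : ℝ) ^ (ε / (d * d + 1)) :=
        Finset.prod_le_prod (fun _ _ => Nat.cast_nonneg _) fun c _ =>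
          (hA H hd c.1 c.2 m hm s hs).trans (by nlinarith)
    _ = ((1 + A) * (m : ℝ) ^ (ε / (d * d + 1))) ^ Fintype.card I := by
        rw [Finset.prod_const, Finset.card_univ]
    _ ≤ ((1 + A) * (m : ℝ) ^ (ε / (d * d + 1))) ^ (d * d) := pow_le_pow_right₀ hX' hI
    _ = (1 + A) ^ (d * d) * (m : ℝ) ^ (ε / (d * d + 1) * (d * d : ℕ)) := by
        rw [mul_pow, ← Real.rpow_mul_natCast (by positivity)]
    _ ≤ (1 + A) ^ (d * d) * (m : ℝ) ^ ε := by
        refine mul_le_mul_of_nonneg_left (Real.rpow_le_rpow_of_exponent_le hm1 ?_) (by positivity)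
        rw [div_mul_eq_mul_div, div_le_iff₀ (by positivity)]
        push_cast
        nlinarith

end Pairs

namespace HermitianDatum

variable {F E V : Type*} [Field F] [NumberField F] [Field E] [NumberField E] [Algebra F E]
  [AddCommGroup V] [Module E V] [Module F V] [IsScalarTower F E V] (D : HermitianDatum F E V)

theorem mk_eq_mk_iff {x y : D.G} : (x : D.G ⧸ D.Z) = y ↔
    ∃ e : E, ((y : V ≃ₗ[E] V) : Module.End E V) = e • ((x : V ≃ₗ[E] V) : Module.End E V) := by
  have h : ∀ z, (x : V ≃ₗ[E] V) (((x⁻¹ : D.G) : V ≃ₗ[E] V) z) = z := D.apply_coe_inv x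
  have hxy : ∀ z, ((x⁻¹ * y : D.G) : V ≃ₗ[E] V) z =
      ((x⁻¹ : D.G) : V ≃ₗ[E] V) ((y : V ≃ₗ[E] V) z) := fun z => rfl
  rw [QuotientGroup.eq]
  refine exists_congr fun e => ⟨fun he => LinearMap.ext fun z => ?_, fun he z => ?_⟩
  · have h1 := congrArg (x : V ≃ₗ[E] V) (he z)
    rw [hxy, h, map_smul] at h1
    exact h1
  · refine (x : V ≃ₗ[E] V).injective ?_
    rw [hxy, h, map_smul]
    exact LinearMap.congr_fun he z

variable {D} [NumberField.IsTotallyReal F] [Module (𝓞 E) V] {L : Submodule (𝓞 E) V}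

/-- Commuting Hecke returns lie in an étale algebra of dimension `dim V`. -/
theorem Level.exists_isCommReduced_of_commute [FiniteDimensional E V]
    (hF : Module.finrank ℚ F ≠ 1) (𝓛 : D.Level L) {g : G₀} {𝔫 : Fin 3 → Ideal (𝓞 F)} {κ : ℝ}
    (h : ∀ x y : D.G, 𝓛.IsReturn g 𝔫 κ x → 𝓛.IsReturn g 𝔫 κ y → x * y = y * x) :
    ∃ H : Subalgebra E (Module.End E V), IsCommReduced H ∧
      Module.finrank E H = Module.finrank E V ∧ ∀ x : D.G, 𝓛.IsReturn g 𝔫 κ x →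
        ((x : V ≃ₗ[E] V) : Module.End E V) ∈ H ∧
        (((x⁻¹ : D.G) : V ≃ₗ[E] V) : Module.End E V) ∈ H := by
  obtain ⟨R, hR, hxR⟩ := D.exists_isCommReduced hF (T := {x | 𝓛.IsReturn g 𝔫 κ x})
    fun x hx y hy => h x y hx hy
  obtain ⟨H, hRH, hH, h3⟩ := hR.exists_le_finrank_eq
  exact ⟨H, hH, h3, fun x hx => ⟨hRH (hxR x hx).1, hRH (hxR x hx).2⟩⟩

theorem exists_forall_card_returns_le [FiniteDimensional E V] [Nontrivial V]
    [IsScalarTower (𝓞 E) E V] [Algebra.IsQuadraticExtension F E] (hF : Module.finrank ℚ F ≠ 1)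
    (hL : L.IsLattice E) (b : Module.Basis (Fin 3) E V) {Ω : Set G₀} (hΩ : IsCompact Ω)
    {ε : ℝ} (hε : 0 < ε) :
    ∃ B : ℝ, ∀ (𝓛 : D.Level L), ∀ g ∈ Ω, ∀ 𝔫 : Fin 3 → Ideal (𝓞 F), (∀ i, 𝔫 i ≠ ⊥) → ∀ κ : ℝ,
      (∀ x y : D.G, 𝓛.IsReturn g 𝔫 κ x → 𝓛.IsReturn g 𝔫 κ y → x * y = y * x) →
      ∀ s : Finset (D.G ⧸ D.Z), (s : Set (D.G ⧸ D.Z)) ⊆ 𝓛.returns g 𝔫 κ →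
        (s.card : ℝ) ≤ B * (Ideal.absNorm (𝔫 0 * 𝔫 1 * 𝔫 2) : ℝ) ^ ε := by
  classical
  obtain ⟨c, hc0, hc⟩ := D.exists_nat_isIntegral_mat hL b
  obtain ⟨B, hB0, hB⟩ := D.exists_norm_map_mat_le b hΩ
  obtain ⟨A, hA0, hA⟩ := exists_card_isBoundedPair_le b (Module.finrank E V) B hε D.φ₀
  refine ⟨A * (c : ℝ) ^ ε, fun 𝓛 g hg 𝔫 h𝔫 κ hcomm s hs => ?_⟩
  obtain ⟨H, hH, h3, hxH⟩ := 𝓛.exists_isCommReduced_of_commute hF hcomm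
  set n := Ideal.absNorm (𝔫 0 * 𝔫 1 * 𝔫 2) with hn
  have hn0 : 0 < n := Nat.pos_of_ne_zero (Ideal.absNorm_ne_zero_iff_mem_nonZeroDivisors.2
    (mem_nonZeroDivisors_of_ne_zero (mul_ne_zero (mul_ne_zero (h𝔫 0) (h𝔫 1)) (h𝔫 2))))
  have hpair : ∀ x : D.G, 𝓛.IsReturn g 𝔫 κ x →
      IsBoundedPair b (c * n) B ((x : V ≃ₗ[E] V) : Module.End E V)
        (((x⁻¹ : D.G) : V ≃ₗ[E] V) : Module.End E V) ∧
      IsBoundedPair b (c * n) B (((x⁻¹ : D.G) : V ≃ₗ[E] V) : Module.End E V)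
        ((x : V ≃ₗ[E] V) : Module.End E V) := by
    rintro x ⟨hxm, x₀, hx₀, hd, -⟩
    -- The norm `n` lies in the ideal, so the integer `c * n` clears the denominators.
    have hint : ∀ i j k l, IsIntegral ℤ (((c * n : ℕ) : E) *
        (D.mat b x i j * D.mat b x⁻¹ k l)) := fun i j k l => by
      have := (hc 𝓛 𝔫 x hxm n (Ideal.absNorm_mem _) i j k l).2
      simpa [mul_assoc] using this
    have hbd := hB g hg x x₀ hx₀ hd
    refine ⟨⟨LinearMap.ext (D.apply_coe_inv x), hint, fun φ i j => (hbd φ i j).1,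
      fun φ i j => (hbd φ i j).2⟩, ⟨LinearMap.ext (D.coe_inv_apply x), fun i j k l => ?_,
      fun φ i j => (hbd φ i j).2, fun φ i j => (hbd φ i j).1⟩⟩
    have := hint k l i j
    rwa [mul_comm (D.mat b x k l)] at this
  choose rep hrep hret using fun γ : s => hs γ.2
  let f : s → H × H := fun γ => (⟨_, (hxH _ (hret γ)).1⟩, ⟨_, (hxH _ (hret γ)).2⟩)
  have hinj : ∀ γ γ' : s, ∀ e : E, (f γ').1 = e • (f γ).1 → γ = γ' := fun γ γ' e he => by
    refine Subtype.ext ?_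
    rw [← hrep γ, ← hrep γ']
    exact D.mk_eq_mk_iff.2 ⟨e, congrArg Subtype.val he⟩
  have hcard : (Finset.univ.image f).card = s.card := by
    rw [Finset.card_image_of_injective _ fun γ γ' h => hinj γ γ' 1 (by rw [h, one_smul]),
      Finset.card_univ, Fintype.card_coe]
  have key := hA H hH h3.le (c * n) (Nat.mul_pos hc0 hn0) (Finset.univ.image f) ?_ ?_
  · rw [hcard] at key
    refine key.trans_eq ?_
    rw [Nat.cast_mul, Real.mul_rpow (Nat.cast_nonneg _) (Nat.cast_nonneg _), mul_assoc]
  · intro p hp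
    obtain ⟨γ, -, rfl⟩ := Finset.mem_image.1 hp
    exact hpair _ (hret γ)
  · intro p hp q hq e he
    obtain ⟨γ, -, rfl⟩ := Finset.mem_image.1 hp
    obtain ⟨γ', -, rfl⟩ := Finset.mem_image.1 hq
    rw [hinj γ γ' e he]

end HermitianDatum

end HeckeReturn

theorem proposition3p4 {F E : Type*} {V : Type*} [Field F] [NumberField F] [Field E]
    [NumberField E] [Algebra F E] [NumberField.IsTotallyReal F] [NumberField.IsTotallyComplex E]
    [Algebra.IsQuadraticExtension F E] (hF : Module.finrank ℚ F ≠ 1)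
    [AddCommGroup V] [Module E V] [Module F V] [IsScalarTower F E V]
    [Module (𝓞 E) V] [IsScalarTower (𝓞 E) E V] (hV : Module.finrank E V = 3)
    (D : HeckeReturn.HermitianDatum F E V) (L : Submodule (𝓞 E) V) (hL : L.IsLattice E)
    (Ω : Set HeckeReturn.G₀) (hΩ : IsCompact Ω) :
    ∃ C : ℝ, 0 < C ∧ C < 1 ∧
      (∀ ε : ℝ, 0 < ε → ∃ B : ℝ, ∀ (𝓛 : D.Level L), ∀ g ∈ Ω, ∀ 𝔫 : Fin 3 → Ideal (𝓞 F),
        (∀ i, 𝓛.IsSupported (𝔫 i)) → ∀ n : ℕ, n = Ideal.absNorm (𝔫 0 * 𝔫 1 * 𝔫 2) →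
        ∀ κ : ℝ, 0 < κ → κ ≤ C * (n : ℝ)⁻¹ →
          (𝓛.returns g 𝔫 κ).Finite ∧ ((𝓛.returns g 𝔫 κ).ncard : ℝ) ≤ B * (n : ℝ) ^ ε) ∧
      (∀ (𝓛 : D.Level L), ∀ g ∈ Ω, ∀ 𝔫 : Fin 3 → Ideal (𝓞 F),
        (∀ i, 𝓛.IsSupported (𝔫 i)) → ∀ n : ℕ, n = Ideal.absNorm (𝔫 0 * 𝔫 1 * 𝔫 2) →
        ∀ κ : ℝ, 0 < κ → κ ≤ C * (n : ℝ)⁻¹ →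
          ∃ H : Subalgebra E (Module.End E V), HeckeReturn.IsCubicEtale H ∧
            ∀ x : D.G, (x : D.G ⧸ D.Z) ∈ 𝓛.returns g 𝔫 κ →
              ((x : V ≃ₗ[E] V) : Module.End E V) ∈ H) := by
  have : FiniteDimensional E V := Module.finite_of_finrank_pos (by omega)
  have : Nontrivial V := Module.nontrivial_of_finrank_pos (R := E) (by omega)
  let b := Module.finBasisOfFinrankEq E V hV
  obtain ⟨C, hC0, hC1, hC⟩ := D.exists_forall_isReturn_commute hL b hΩ
  refine ⟨C, hC0, hC1, fun ε hε => ?_, fun 𝓛 g hg 𝔫 h𝔫 n hn κ hκ hκn => ?_⟩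
  · obtain ⟨B, hB⟩ := D.exists_forall_card_returns_le hF hL b hΩ hε
    refine ⟨B, fun 𝓛 g hg 𝔫 h𝔫 n hn κ hκ hκn => ?_⟩
    subst hn
    exact HeckeReturn.finite_and_ncard_le (hB 𝓛 g hg 𝔫 (fun i => (h𝔫 i).1) κ
      (hC 𝓛 g hg 𝔫 (fun i => (h𝔫 i).1) κ hκ hκn))
  · subst hn
    obtain ⟨H, hH, h3, hxH⟩ := 𝓛.exists_isCommReduced_of_commute hF
      (hC 𝓛 g hg 𝔫 (fun i => (h𝔫 i).1) κ hκ hκn)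
    refine ⟨H, HeckeReturn.isCubicEtale_of_isCommReduced hH (h3.trans hV), ?_⟩
    rintro x ⟨y, hyx, hy⟩
    -- The return conditions are known for some representative `y` of the class; `x` is an
    -- `E`-multiple of it and `H` contains the scalars.
    obtain ⟨e, he⟩ := D.mk_eq_mk_iff.1 hyx
    rw [he]
    exact H.smul_mem (hxH y hy).1 e
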